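/- Let $(\mathscr V,\otimes,\mathcal I)$ be a cocomplete closed symmetric monoidal category. For $n\ge 0$ let $\mathbf n=\{0,1,\dots,n\}$, based at $0$. Let $\Lambda$ be the category whose objects are the $\mathbf n$ and whose morphisms are the based injections, and let $\Sigma\subset\Lambda$ be the subcategory of based bijections; both are symmetric monoidal under the wedge $\mathbf m\vee\mathbf n=\mathbf{m+n}$. Write $\Lambda^{op}[\mathscr V]$ and $\Sigma^{op}[\mathscr V]$ for the categories of functors $\Lambda^{op}\to\mathscr V$ ($\Lambda$-objects) and $\Sigma^{op}\to\mathscr V$ ($\Sigma$-objects, or $\Sigma$-sequences), with Day convolution $\boxtimes$ and its unit $\mathscr I_0$. A $\Lambda$-sequence is a $\Lambda$-object $\mathscr E$ with a map $\mathscr I_0\to\mathscr E$ of $\Lambda$-objects; these form the category $\Lambda^{op}[\mathscr V]_{\mathscr I_0}$ of objects under $\mathscr I_0$. For a $\Lambda$-object $\mathscr D$ and a $\Lambda$-sequence $\mathscr E$, the assignment $\mathbf k\mapsto\mathscr E^{\boxtimes k}$ is a covariant functor on $\Lambda$ (permutations permute the factors, and injections insert the map $\mathscr I_0\to\mathscr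 E$), and one sets $$(\mathscr D\odot_\Lambda\mathscr E)(\mathbf n)=\int^{\mathbf k\in\Lambda}\mathscr D(\mathbf k)\otimes\mathscr E^{\boxtimes k}(\mathbf n).$$ For $\Sigma$-objects, $\mathscr D\odot_\Sigma\mathscr E$ is defined in the same way with $\Sigma$ in place of $\Lambda$ (and no base map). These are the Kelly products; $\odot_\Lambda$ is a monoidal structure on $\Lambda^{op}[\mathscr V]_{\mathscr I_0}$ with unit $\mathscr I_1=\coprod_{\Lambda(-,\mathbf 1)}\mathcal I$, and $\odot_\Sigma$ is one on $\Sigma^{op}[\mathscr V]$ with unit $\mathscr I_1^\Sigma=\coprod_{\Sigma(-,\mathbf 1)}\mathcal I$. A based operad is a monoid in $(\Lambda^{op}[\mathscr V]_{\mathscr I_0},\odot_\Lambda,\mathscr I_1)$. Restriction along $\Sigma\subset\Lambda$ comes with the canonical quotient map $q:\mathscr D\odot_\Sigma\mathscr E\to\mathscr D\odot_\Lambda\mathscr E$ and the inclusion $\iota:\mathscr I_1^\Sigma\to\mathscr I_1$. Through $q$ and $\iota$, a based operad $\mathscr C$ is also a monoid in $(\Sigma^{op}[\mathscr V],\odot_\Sigma,\mathscr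 I_1^\Sigma)$. Let $\mathrm{RMod}_{\mathscr C}[\Lambda^{op}[\mathscr V]]$ be the category of $\Lambda$-objects $\mathscr M$ with an associative and unital action $a:\mathscr M\odot_\Lambda\mathscr C\to\mathscr M$, and define $\mathrm{RMod}_{\mathscr C}[\Sigma^{op}[\mathscr V]]$ in the same way with $\Sigma$-objects and $\odot_\Sigma$. **Theorem.** For every based operad $\mathscr C$ the forgetful functor $$\mathrm{RMod}_{\mathscr C}[\Lambda^{op}[\mathscr V]]\longrightarrow\mathrm{RMod}_{\mathscr C}[\Sigma^{op}[\mathscr V]],\qquad(\mathscr M,a)\longmapsto(\mathscr M|_{\Sigma},\,a\circ q),$$ is an isomorphism of categories. In particular, for $\mathscr C=\mathscr I_1$: the functor $\mathrm{RMod}_{\mathscr I_1}[\Lambda^{op}[\mathscr V]]\to\Lambda^{op}[\mathscr V]$ that forgets the action is an isomorphism of categories, and hence $$\Lambda^{op}[\mathscr V]\;\cong\;\mathrm{RMod}_{\mathscr I_1}[\Lambda^{op}[\mathscr V]]\;\cong\;\mathrm{RMod}_{\mathscr I_1}[\Sigma^{op}[\mathscr V]],$$ where the second isomorphism is the forgetful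 functor above, and the composite is compatible with the functors to $\Sigma^{op}[\mathscr V]$ that restrict to $\Sigma$, respectively forget the action. -/

import Mathlib

open CategoryTheory MonoidalCategory Opposite Limits

universe v u v' u'

set_option linter.unusedSectionVars false
set_option linter.unusedVariables false

namespace Kelly

/-- The two shapes of sequences: `sigma` (permutations only) and `lambda` (all injections). -/
inductive SeqKind
  | sigma
  | lambda

/-- Objects `𝐧 = {0, 1, …, n}` of the indexing categories `Σ` and `Λ`. -/
structure Idx (s : SeqKind) where
  n : ℕ

namespace Idx

variable {s : SeqKind}

/-- A based injection `{0, …, m} → {0, …, n}` is the same thing as an injection of the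
non-base points `Fin m → Fin n`.  For `s = lambda` all of them are morphisms, for `s = sigma` only
the bijective ones are. -/
@[ext]
structure Hom (a b : Idx s) where
  toFun : Fin a.n → Fin b.n
  inj : Function.Injective toFun
  bij : s = .sigma → Function.Bijective toFun

instance : Category (Idx s) where
  Hom a b := Hom a b
  id a := ⟨id, Function.injective_id, fun _ => Function.bijective_id⟩
  comp f g := ⟨g.toFun ∘ f.toFun, g.inj.comp f.inj, fun h => (g.bij h).comp (f.bij h)⟩

@[ext]
lemma hom_ext {a b : Idx s} {f g : a ⟶ b} (h : ∀ i, f.toFun i = g.toFun i) : f = g :=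
  Hom.ext (funext h)

@[simp] lemma id_toFun (a : Idx s) (i : Fin a.n) : Hom.toFun (𝟙 a) i = i := rfl
@[simp] lemma comp_toFun {a b c : Idx s} (f : a ⟶ b) (g : b ⟶ c) (i : Fin a.n) :
    (f ≫ g).toFun i = g.toFun (f.toFun i) := rfl

/-- An isomorphism from a bijection of the non-base points. -/
def isoOfEquiv {a b : Idx s} (e : Fin a.n ≃ Fin b.n) : a ≅ b where
  hom := ⟨e, e.injective, fun _ => e.bijective⟩
  inv := ⟨e.symm, e.symm.injective, fun _ => e.symm.bijective⟩
  hom_inv_id := by ext i; exact congrArg Fin.val (e.symm_apply_apply i)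
  inv_hom_id := by ext i; exact congrArg Fin.val (e.apply_symm_apply i)

@[simp] lemma isoOfEquiv_hom_toFun {a b : Idx s} (e : Fin a.n ≃ Fin b.n) (i : Fin a.n) :
    (isoOfEquiv (s := s) e).hom.toFun i = e i := rfl
@[simp] lemma isoOfEquiv_inv_toFun {a b : Idx s} (e : Fin a.n ≃ Fin b.n) (i : Fin b.n) :
    (isoOfEquiv (s := s) e).inv.toFun i = e.symm i := rfl

/-- The wedge `f ∨ g` of two based injections. -/
def wedge {a a' b b' : Idx s} (f : a ⟶ a') (g : b ⟶ b') :
    (⟨a.n + b.n⟩ : Idx s) ⟶ ⟨a'.n + b'.n⟩ where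
  toFun := finSumFinEquiv ∘ Sum.map f.toFun g.toFun ∘ finSumFinEquiv.symm
  inj := finSumFinEquiv.injective.comp
    ((Function.Injective.sumMap f.inj g.inj).comp finSumFinEquiv.symm.injective)
  bij h := finSumFinEquiv.bijective.comp
    ((Function.Bijective.sumMap (f.bij h) (g.bij h)).comp finSumFinEquiv.symm.bijective)

@[simp] lemma wedge_castAdd {a a' b b' : Idx s} (f : a ⟶ a') (g : b ⟶ b') (i : Fin a.n) :
    (wedge f g).toFun (Fin.castAdd b.n i) = Fin.castAdd b'.n (f.toFun i) := by
  simp [wedge]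

@[simp] lemma wedge_natAdd {a a' b b' : Idx s} (f : a ⟶ a') (g : b ⟶ b') (i : Fin b.n) :
    (wedge f g).toFun (Fin.natAdd a.n i) = Fin.natAdd a'.n (g.toFun i) := by
  simp [wedge]

instance : MonoidalCategoryStruct (Idx s) where
  tensorObj a b := ⟨a.n + b.n⟩
  tensorUnit := ⟨0⟩
  tensorHom f g := wedge f g
  whiskerLeft a _ _ f := wedge (𝟙 a) f
  whiskerRight f b := wedge f (𝟙 b)
  associator a b c := isoOfEquiv (a := ⟨(a.n + b.n) + c.n⟩) (b := ⟨a.n + (b.n + c.n)⟩)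
    (finCongr (Nat.add_assoc _ _ _))
  leftUnitor a := isoOfEquiv (a := ⟨0 + a.n⟩) (b := a) (finCongr (Nat.zero_add _))
  rightUnitor a := isoOfEquiv (a := ⟨a.n + 0⟩) (b := a) (finCongr (Nat.add_zero _))

@[simp] lemma tensorObj_n (a b : Idx s) : (a ⊗ b).n = a.n + b.n := rfl
@[simp] lemma tensorUnit_n : (𝟙_ (Idx s)).n = 0 := rfl
lemma tensorHom_eq {a a' b b' : Idx s} (f : a ⟶ a') (g : b ⟶ b') : f ⊗ₘ g = wedge f g := rfl
lemma whiskerLeft_eq (a : Idx s) {b b' : Idx s} (g : b ⟶ b') : a ◁ g = wedge (𝟙 a) g := rfl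
lemma whiskerRight_eq {a a' : Idx s} (f : a ⟶ a') (b : Idx s) : f ▷ b = wedge f (𝟙 b) := rfl
@[simp] lemma associator_hom_val (a b c : Idx s) (i : Fin (a.n + b.n + c.n)) :
  ((α_ a b c).hom.toFun i).val = i.val := rfl
@[simp] lemma associator_inv_val (a b c : Idx s) (i : Fin (a.n + (b.n + c.n))) :
  ((α_ a b c).inv.toFun i).val = i.val := rfl
@[simp] lemma leftUnitor_hom_val (a : Idx s) (i : Fin (0 + a.n)) :
  ((λ_ a).hom.toFun i).val = i.val := rfl
@[simp] lemma rightUnitor_hom_val (a : Idx s) (i : Fin (a.n + 0)) :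
  ((ρ_ a).hom.toFun i).val = i.val := rfl

lemma wedge_val {a a' b b' : Idx s} (f : a ⟶ a') (g : b ⟶ b') (i : Fin (a.n + b.n)) :
    ((wedge f g).toFun i).val =
      if h : i.val < a.n then (f.toFun ⟨i, h⟩).val
      else a'.n + (g.toFun ⟨i - a.n, by omega⟩).val := by
  induction i using Fin.addCases with
  | left i => simp
  | right i => simp

lemma val_congr {a b : Idx s} (f : a ⟶ b) {i j : Fin a.n} (h : i.val = j.val) :
    (f.toFun i).val = (f.toFun j).val := by rw [Fin.ext h]

instance : MonoidalCategory (Idx s) := MonoidalCategory.ofTensorHom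
  (id_tensorHom_id := fun a b => by
    ext i; simp only [tensorHom_eq, wedge_val]; split_ifs <;> simp; omega)
  (tensorHom_comp_tensorHom := fun f g h k => by
    ext i; simp only [tensorHom_eq, comp_toFun]
    induction i using Fin.addCases <;> simp)
  (associator_naturality := fun f g h => by
    ext i
    simp only [comp_toFun, tensorHom_eq, wedge_val, associator_hom_val, tensorObj_n]
    split_ifs <;> first | omega | simp [Nat.sub_sub, Nat.add_assoc])
  (leftUnitor_naturality := fun f => by
    ext i
    simp only [comp_toFun, tensorHom_eq, wedge_val, leftUnitor_hom_val, tensorUnit_n]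
    split_ifs
    · omega
    · simp; exact val_congr f (by simp))
  (rightUnitor_naturality := fun f => by
    ext i
    simp only [comp_toFun, tensorHom_eq, wedge_val, rightUnitor_hom_val, tensorUnit_n]
    split_ifs with h
    · exact val_congr f (by simp)
    · exact absurd i.2 h)
  (pentagon := fun a b c d => by
    ext i
    simp only [comp_toFun, tensorHom_eq, wedge_val, associator_hom_val, id_toFun, tensorObj_n]
    split_ifs <;> omega)
  (triangle := fun a b => by
    ext i
    simp only [comp_toFun, tensorHom_eq, wedge_val, associator_hom_val, id_toFun, tensorObj_n,
      tensorUnit_n, leftUnitor_hom_val, rightUnitor_hom_val]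
    grind)

lemma finAddFlip_val {m n : ℕ} (i : Fin (m + n)) :
    (finAddFlip i).val = if i.val < m then n + i.val else i.val - m := by
  induction i using Fin.addCases <;> simp

instance : SymmetricCategory (Idx s) where
  braiding a b := isoOfEquiv (a := ⟨a.n + b.n⟩) (b := ⟨b.n + a.n⟩) finAddFlip
  braiding_naturality_right a b c f := by
    ext i
    simp only [comp_toFun, whiskerLeft_eq, whiskerRight_eq, isoOfEquiv_hom_toFun]
    induction i using Fin.addCases <;> simp
  braiding_naturality_left f c := by
    ext i
    simp only [comp_toFun, whiskerLeft_eq, whiskerRight_eq, isoOfEquiv_hom_toFun]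
    induction i using Fin.addCases <;> simp
  hexagon_forward a b c := by
    ext i
    simp only [comp_toFun, whiskerLeft_eq, whiskerRight_eq, isoOfEquiv_hom_toFun, wedge_val,
      finAddFlip_val, associator_hom_val, tensorObj_n, id_toFun]
    grind
  hexagon_reverse a b c := by
    ext i
    simp only [comp_toFun, whiskerLeft_eq, whiskerRight_eq, isoOfEquiv_hom_toFun, wedge_val,
      finAddFlip_val, associator_inv_val, tensorObj_n, id_toFun]
    grind
  symmetry a b := by
    ext i
    simp only [comp_toFun, isoOfEquiv_hom_toFun, id_toFun]
    induction i using Fin.addCases <;> simp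

lemma braiding_hom_val (a b : Idx s) (i : Fin (a.n + b.n)) :
    ((β_ a b).hom.toFun i).val = if i.val < a.n then b.n + i.val else i.val - a.n :=
  finAddFlip_val i

end Idx

namespace Idx
variable {s : SeqKind}

/-- Remove the point `j` from the source and the point `g j` from the target of `g`. -/
noncomputable def remove {k l : ℕ} (g : (⟨k + 1⟩ : Idx s) ⟶ ⟨l + 1⟩) (j : Fin (k + 1)) :
    (⟨k⟩ : Idx s) ⟶ ⟨l⟩ where
  toFun i := (finSuccAboveEquiv (g.toFun j)).symm
    ⟨g.toFun (j.succAbove i), fun h => Fin.succAbove_ne j i (g.inj h)⟩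
  inj a b h := by
    simpa using g.inj (congrArg Subtype.val ((finSuccAboveEquiv (g.toFun j)).symm.injective h))
  bij hs := by
    refine ⟨fun a b h => ?_, fun r => ?_⟩
    · simpa using g.inj (congrArg Subtype.val ((finSuccAboveEquiv (g.toFun j)).symm.injective h))
    · obtain ⟨i, hi⟩ := (g.bij hs).2 ((g.toFun j).succAbove r)
      have hij : i ≠ j := fun h => Fin.succAbove_ne (g.toFun j) r (by rw [← hi, h])
      obtain ⟨i', rfl⟩ := Fin.exists_succAbove_eq hij
      exact ⟨i', by rw [Equiv.symm_apply_eq]; exact Subtype.ext hi⟩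

lemma succAbove_remove {k l : ℕ} (g : (⟨k + 1⟩ : Idx s) ⟶ ⟨l + 1⟩) (j : Fin (k + 1)) (i : Fin k) :
    (g.toFun j).succAbove ((remove g j).toFun i) = g.toFun (j.succAbove i) :=
  congrArg Subtype.val ((finSuccAboveEquiv (g.toFun j)).apply_symm_apply
    ⟨g.toFun (j.succAbove i), fun h => Fin.succAbove_ne j i (g.inj h)⟩)

lemma remove_eq {k l : ℕ} {g : (⟨k + 1⟩ : Idx s) ⟶ ⟨l + 1⟩} {j : Fin (k + 1)}
    {h : (⟨k⟩ : Idx s) ⟶ ⟨l⟩}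
    (H : ∀ i : Fin k, (g.toFun j).succAbove (h.toFun i) = g.toFun (j.succAbove i)) :
    remove g j = h := by
  apply hom_ext
  intro i
  exact Fin.succAbove_right_injective ((succAbove_remove g j i).trans (H i).symm)

lemma remove_id {k : ℕ} (j : Fin (k + 1)) : remove (𝟙 (⟨k + 1⟩ : Idx s)) j = 𝟙 _ :=
  remove_eq fun _ => rfl

lemma remove_comp {k l m : ℕ} (f : (⟨k + 1⟩ : Idx s) ⟶ ⟨l + 1⟩) (g : (⟨l + 1⟩ : Idx s) ⟶ ⟨m + 1⟩)
    (j : Fin (k + 1)) : remove (f ≫ g) j = remove f j ≫ remove g (f.toFun j) :=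
  remove_eq fun i => by
    simp only [comp_toFun]
    rw [succAbove_remove, succAbove_remove]

lemma hom_zero_right {k : ℕ} (f : (⟨k + 1⟩ : Idx s) ⟶ ⟨0⟩) : False := (f.toFun 0).elim0

lemma hom_zero_left {l : ℕ} (f : (⟨0⟩ : Idx s) ⟶ ⟨l⟩) : l = 0 ∨ s = .lambda := by
  rcases s with _ | _
  · left
    rcases l with _ | l
    · rfl
    · exact ((f.bij rfl).2 0).choose.elim0
  · exact Or.inr rfl

end Idx

lemma succAbove_swap {l : ℕ} {p q : Fin (l + 2)} {r t : Fin (l + 1)} (hr : p.succAbove r = q)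
    (ht : q.succAbove t = p) (x : Fin l) :
    p.succAbove (r.succAbove x) = q.succAbove (t.succAbove x) := by
  simp only [Fin.succAbove, Fin.lt_def, Fin.ext_iff] at *
  grind

/-- An object of a monoidal category, equipped, if `s = lambda`, with a map from the unit object.
For `s = sigma` there is no extra datum. -/
structure Pointed (s : SeqKind) (W : Type u) [Category.{v} W] [MonoidalCategory W] where
  X : W
  base : s = .lambda → (𝟙_ W ⟶ X)

namespace Pointed

variable {s : SeqKind} {W : Type u} [Category.{v} W] [MonoidalCategory W]

/-- Morphisms preserve the map from the unit object (if there is one). -/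
@[ext]
structure Hom (E F : Pointed s W) where
  hom : E.X ⟶ F.X
  base_hom : ∀ h, E.base h ≫ hom = F.base h

@[simps]
instance : Category (Pointed s W) where
  Hom := Hom
  id E := ⟨𝟙 _, by simp⟩
  comp f g := ⟨f.hom ≫ g.hom, fun h => by rw [← Category.assoc, f.base_hom, g.base_hom]⟩

@[ext] lemma hom_ext {E F : Pointed s W} {f g : E ⟶ F} (h : f.hom = g.hom) : f = g := Hom.ext h

variable (E : Pointed s W)

/-- The tensor power `E^{⊗ k}`. -/
@[reducible]
def pow : ℕ → W
  | 0 => 𝟙_ W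
  | k + 1 => pow k ⊗ E.X

/-- Insert a new last factor using the base map. -/
def push (h : s = .lambda) (X : W) : X ⟶ X ⊗ E.X := (ρ_ X).inv ≫ X ◁ E.base h

/-- The `k`-fold tensor power of the base map. -/
def powBase : (k : ℕ) → (k = 0 ∨ s = .lambda) → (𝟙_ W ⟶ E.pow k)
  | 0, _ => 𝟙 _
  | k + 1, h => powBase k (.inr (h.resolve_left (Nat.succ_ne_zero k))) ≫
      E.push (h.resolve_left (Nat.succ_ne_zero k)) _

lemma push_naturality (h : s = .lambda) {X Y : W} (f : X ⟶ Y) :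
    f ≫ E.push h Y = E.push h X ≫ f ▷ E.X := by
  simp [push, whisker_exchange]

lemma push_naturality_assoc : type_of% (reassoc_of% @push_naturality) := by
  have h := reassoc_of% @push_naturality
  exact @h

lemma powBase_succ (h : s = .lambda) (k : ℕ) :
    E.powBase (k + 1) (.inr h) = E.powBase k (.inr h) ≫ E.push h _ := rfl

variable [SymmetricCategory W]

/-- Exchange of the last two tensor factors. -/
def swap (X : W) : (X ⊗ E.X) ⊗ E.X ⟶ (X ⊗ E.X) ⊗ E.X :=
  (α_ _ _ _).hom ≫ X ◁ (β_ E.X E.X).hom ≫ (α_ _ _ _).inv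

/-- Move the last tensor factor to position `j`. -/
def insert : (k : ℕ) → Fin (k + 1) → (E.pow k ⊗ E.X ⟶ E.pow (k + 1))
  | 0, _ => 𝟙 _
  | k + 1, j => Fin.lastCases (motive := fun _ => (E.pow (k + 1) ⊗ E.X ⟶ E.pow (k + 2)))
      (𝟙 _) (fun j => E.swap (E.pow k) ≫ insert k j ▷ E.X) j

/-- The map `E^{⊗ k} ⟶ E^{⊗ l}` induced by a morphism `f`: the `i`-th factor is sent to the
`f i`-th one, and the factors not in the image of `f` are filled in by the base map. -/
noncomputable def powMap : (k l : ℕ) → ((⟨k⟩ : Idx s) ⟶ ⟨l⟩) → (E.pow k ⟶ E.pow l)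
  | 0, l, f => E.powBase l (Idx.hom_zero_left f)
  | _ + 1, 0, f => (Idx.hom_zero_right f).elim
  | k + 1, l + 1, f =>
      powMap k l (Idx.remove f (Fin.last k)) ▷ E.X ≫ E.insert l (f.toFun (Fin.last k))

@[simp] lemma insert_last (k : ℕ) : E.insert k (Fin.last k) = 𝟙 _ := by
  cases k <;> simp [insert]

lemma insert_castSucc (k : ℕ) (j : Fin (k + 1)) :
    E.insert (k + 1) j.castSucc = E.swap (E.pow k) ≫ E.insert k j ▷ E.X := by
  simp [insert]

lemma powMap_succ {k l : ℕ} (f : (⟨k + 1⟩ : Idx s) ⟶ ⟨l + 1⟩) : E.powMap (k + 1) (l + 1) f =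
    E.powMap k l (Idx.remove f (Fin.last k)) ▷ E.X ≫ E.insert l (f.toFun (Fin.last k)) := rfl

@[simp]
lemma swap_swap (X : W) : E.swap X ≫ E.swap X = 𝟙 _ := by
  simp [swap, ← MonoidalCategory.whiskerLeft_comp_assoc]

@[simp]
lemma swap_swap_assoc : type_of% (reassoc_of% @swap_swap) := by
  have h := reassoc_of% @swap_swap
  exact @h

lemma swap_naturality {X Y : W} (f : X ⟶ Y) :
    f ▷ E.X ▷ E.X ≫ E.swap Y = E.swap X ≫ f ▷ E.X ▷ E.X := by
  simp only [swap, Category.assoc, associator_naturality_left_assoc,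
    ← associator_inv_naturality_left, whisker_exchange_assoc]

lemma swap_naturality_assoc : type_of% (reassoc_of% @swap_naturality) := by
  have h := reassoc_of% @swap_naturality
  exact @h

lemma swap_yang_baxter (X : W) :
    E.swap (X ⊗ E.X) ≫ E.swap X ▷ E.X ≫ E.swap (X ⊗ E.X) =
      E.swap X ▷ E.X ≫ E.swap (X ⊗ E.X) ≫ E.swap X ▷ E.X := by
  have := BraidedCategory.yang_baxter E.X E.X E.X
  calc
    _ = 𝟙 _ ⊗≫ X ◁ (E.X ◁ (β_ E.X E.X).hom ≫ (α_ E.X E.X E.X).inv ≫ (β_ E.X E.X).hom ▷ E.X ≫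
          (α_ E.X E.X E.X).hom ≫ E.X ◁ (β_ E.X E.X).hom) ⊗≫ 𝟙 _ := by
      simp only [swap]; monoidal
    _ = _ := by
      rw [← this]; simp only [swap]; monoidal

lemma push_swap (h : s = .lambda) (X : W) :
    E.push h (X ⊗ E.X) ≫ E.swap X = E.push h X ▷ E.X := by
  have h1 : (ρ_ E.X).inv ≫ E.X ◁ E.base h ≫ (β_ E.X E.X).hom = (λ_ E.X).inv ≫ E.base h ▷ E.X := by
    simp
  have h2 := congrArg (fun t => X ◁ t ≫ (α_ X E.X E.X).inv) h1
  simp only [push, swap]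
  simp only [MonoidalCategory.whiskerLeft_comp, Category.assoc] at h2
  simpa using h2

lemma push_swap_assoc : type_of% (reassoc_of% @push_swap) := by
  have h := reassoc_of% @push_swap
  exact @h

lemma powBase_push_insert (h : s = .lambda) (k : ℕ) (j : Fin (k + 1)) :
    E.powBase k (.inr h) ≫ E.push h _ ≫ E.insert k j = E.powBase (k + 1) (.inr h) := by
  induction k with
  | zero =>
    obtain rfl : j = Fin.last 0 := by omega
    rw [insert_last, Category.comp_id]; rfl
  | succ k ih =>
    induction j using Fin.lastCases with
    | last => rw [insert_last, Category.comp_id]; rfl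
    | cast j =>
      rw [insert_castSucc, push_swap_assoc, ← comp_whiskerRight, powBase_succ E h (k + 1),
        powBase_succ E h k, Category.assoc, ← push_naturality, ← powBase_succ E h k, ← ih j]
      simp only [Category.assoc]

lemma swap_insert_insert (k : ℕ) {a a' : Fin (k + 2)} {b b' : Fin (k + 1)}
    (h : a.succAbove b = a') (h' : a'.succAbove b' = a) :
    E.swap (E.pow k) ≫ E.insert k b ▷ E.X ≫ E.insert (k + 1) a =
      E.insert k b' ▷ E.X ≫ E.insert (k + 1) a' := by
  induction k with
  | zero =>
    obtain rfl : b = Fin.last 0 := by omega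
    obtain rfl : b' = Fin.last 0 := by omega
    rw [insert_last, id_whiskerRight, Category.id_comp, Category.id_comp]
    induction a using Fin.lastCases with
    | last =>
      obtain rfl : a' = (Fin.last 0).castSucc := by rw [← h]; rfl
      rw [insert_last, insert_castSucc, insert_last, id_whiskerRight]
    | cast a =>
      obtain rfl : a = Fin.last 0 := by omega
      obtain rfl : a' = Fin.last 1 := by rw [← h]; rfl
      rw [insert_last, insert_castSucc, insert_last, id_whiskerRight, Category.comp_id, swap_swap]
  | succ k ih =>
    induction a using Fin.lastCases with
    | last =>
      obtain rfl : a' = b.castSucc := by rw [← h]; simp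
      obtain rfl : b' = Fin.last _ := by
        simp only [Fin.succAbove, Fin.lt_def, Fin.ext_iff] at h'
        ext; grind
      simp [insert_castSucc]
    | cast a =>
      induction b using Fin.lastCases with
      | last =>
        obtain rfl : a' = Fin.last _ := by
          rw [← h]; simp only [Fin.succAbove, Fin.lt_def, Fin.ext_iff]; grind
        obtain rfl : b' = a := by
          simpa using h'
        simp [insert_castSucc]
      | cast b =>
        obtain rfl : a' = (a.succAbove b).castSucc := by rw [← h]; simp
        have hb : b' ≠ Fin.last _ := by
          rintro rfl
          simp only [Fin.succAbove, Fin.lt_def, Fin.ext_iff] at h'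
          grind
        obtain ⟨b', rfl⟩ := Fin.exists_castSucc_eq.2 hb
        have ih' := ih (a := a) (b := b) (b' := b') rfl
          (by simpa using h')
        have ih' := congrArg (fun t => t ▷ E.X) ih'
        simp only [comp_whiskerRight] at ih'
        simp only [insert_castSucc, comp_whiskerRight, Category.assoc]
        rw [swap_naturality_assoc, swap_naturality_assoc, ← ih', reassoc_of% E.swap_yang_baxter]

lemma insert_powMap (l m : ℕ) (g : (⟨l + 1⟩ : Idx s) ⟶ ⟨m + 1⟩) (j : Fin (l + 1)) :
    E.insert l j ≫ E.powMap (l + 1) (m + 1) g =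
      E.powMap l m (Idx.remove g j) ▷ E.X ≫ E.insert m (g.toFun j) := by
  induction l generalizing m with
  | zero =>
    obtain rfl : j = Fin.last 0 := by omega
    rw [insert_last, Category.id_comp, powMap_succ]
  | succ l ih =>
    induction j using Fin.lastCases with
    | last => rw [insert_last, Category.id_comp, powMap_succ]
    | cast j =>
      rcases m with _ | m
      · exact (Idx.hom_zero_right (Idx.remove g j.castSucc)).elim
      · have e1 := Idx.succAbove_remove g (Fin.last _) j
        have e2 := Idx.succAbove_remove g j.castSucc (Fin.last _)
        rw [Fin.succAbove_last] at e1
        have e3 : j.castSucc.succAbove (Fin.last l) = Fin.last (l + 1) := by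
          simp only [Fin.succAbove, Fin.lt_def, Fin.ext_iff]; grind
        rw [e3] at e2
        have e4 : Idx.remove (Idx.remove g (Fin.last _)) j =
            Idx.remove (Idx.remove g j.castSucc) (Fin.last _) := by
          apply Idx.remove_eq
          intro i
          apply Fin.succAbove_right_injective (p := g.toFun (Fin.last _))
          rw [succAbove_swap e1 e2, Idx.succAbove_remove, Idx.succAbove_remove,
            Idx.succAbove_remove, Fin.succAbove_last, Fin.succAbove_last]
          simp
        rw [insert_castSucc, powMap_succ, powMap_succ E (Idx.remove g j.castSucc), Category.assoc, ← comp_whiskerRight_assoc,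
          ih, comp_whiskerRight, comp_whiskerRight, Category.assoc, ← swap_naturality_assoc, e4,
          E.swap_insert_insert m e1 e2, Category.assoc]

lemma powMap_id (k : ℕ) : E.powMap k k (𝟙 _) = 𝟙 _ := by
  induction k with
  | zero => rfl
  | succ k ih => rw [powMap_succ, Idx.remove_id, ih]; simp

lemma powMap_comp (k l m : ℕ) (f : (⟨k⟩ : Idx s) ⟶ ⟨l⟩) (g : (⟨l⟩ : Idx s) ⟶ ⟨m⟩) :
    E.powMap k m (f ≫ g) = E.powMap k l f ≫ E.powMap l m g := by
  induction k generalizing l m with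
  | zero =>
    change E.powBase m _ = E.powBase l (Idx.hom_zero_left f) ≫ _
    induction l generalizing m with
    | zero => exact (Category.id_comp _).symm
    | succ l ih =>
      rcases m with _ | m
      · exact (Idx.hom_zero_right g).elim
      · have hs : s = .lambda := (Idx.hom_zero_left f).resolve_left (Nat.succ_ne_zero l)
        have ih' := ih m ⟨Fin.elim0, fun i => i.elim0, fun h => by simp [hs] at h⟩
          (Idx.remove g (Fin.last _))
        rw [powMap_succ, powBase_succ _ hs, powBase_succ _ hs, Category.assoc,
          ← push_naturality_assoc, ← reassoc_of% ih', powBase_push_insert, powBase_succ _ hs]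
  | succ k ih =>
    rcases l with _ | l
    · exact (Idx.hom_zero_right f).elim
    rcases m with _ | m
    · exact (Idx.hom_zero_right g).elim
    rw [powMap_succ, powMap_succ, Category.assoc, insert_powMap, Idx.remove_comp, ih]
    simp

/-- The functor `k ↦ E^{⊗ k}` on `Σ` or `Λ`. -/
@[simps obj map]
noncomputable def powFunctor : Idx s ⥤ W where
  obj a := E.pow a.n
  map f := E.powMap _ _ f
  map_id a := E.powMap_id a.n
  map_comp f g := E.powMap_comp _ _ _ f g

end Pointed

namespace Idx

variable {s' s : SeqKind} (h : s' = .lambda → s = .lambda)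

/-- A morphism of `Σ` as a morphism of `Λ` (or of the same category). -/
def inclMap {k l : ℕ} (f : (⟨k⟩ : Idx s') ⟶ ⟨l⟩) : (⟨k⟩ : Idx s) ⟶ ⟨l⟩ :=
  ⟨f.toFun, f.inj, fun hs => f.bij (by
    cases s'
    · rfl
    · rw [h rfl] at hs; cases hs)⟩

/-- The inclusion `Σ ⟶ Λ` (and the identity functors of `Σ` and `Λ`). -/
@[simps]
def incl : Idx s' ⥤ Idx s where
  obj a := ⟨a.n⟩
  map f := inclMap h f

lemma inclMap_remove {k l : ℕ} (f : (⟨k + 1⟩ : Idx s') ⟶ ⟨l + 1⟩) (j : Fin (k + 1)) :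
    remove (inclMap h f) j = inclMap h (remove f j) :=
  remove_eq fun i => succAbove_remove f j i

end Idx

namespace Pointed

open Functor.LaxMonoidal

variable {s' s : SeqKind} (h : s' = .lambda → s = .lambda)
  {W : Type u} [Category.{v} W] [MonoidalCategory W]
  {W' : Type u'} [Category.{v'} W'] [MonoidalCategory W']
  (Φ : W ⥤ W')

section
variable [Φ.LaxMonoidal]

/-- A morphism from `E'` to the image of `E` under a lax monoidal functor `Φ`, compatible with the
base maps. -/
structure HomOver (E' : Pointed s' W') (E : Pointed s W) where
  hom : E'.X ⟶ Φ.obj E.X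
  base_hom : ∀ hs, E'.base hs ≫ hom = ε Φ ≫ Φ.map (E.base (h hs))

variable {h Φ} {E' : Pointed s' W'} {E : Pointed s W} (φ : HomOver h Φ E' E)

namespace HomOver

/-- The comparison map `E'^{⊗ k} ⟶ Φ (E^{⊗ k})`. -/
def pow : (k : ℕ) → (E'.pow k ⟶ Φ.obj (E.pow k))
  | 0 => ε Φ
  | k + 1 => (pow k ⊗ₘ φ.hom) ≫ μ Φ _ _

lemma pow_succ (k : ℕ) : φ.pow (k + 1) = (φ.pow k ⊗ₘ φ.hom) ≫ μ Φ _ _ := rfl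

lemma push_hom (hs : s' = .lambda) {X : W} {X' : W'} (x : X' ⟶ Φ.obj X) :
    E'.push hs X' ≫ (x ⊗ₘ φ.hom) ≫ μ Φ X E.X = x ≫ Φ.map (E.push (h hs) X) := by
  have := φ.base_hom hs
  simp only [push, Category.assoc, MonoidalCategory.tensorHom_def',
    ← MonoidalCategory.whiskerLeft_comp_assoc]
  rw [this, whisker_exchange_assoc, MonoidalCategory.whiskerLeft_comp, Category.assoc,
    Functor.LaxMonoidal.μ_natural_right]
  simp

lemma powBase_pow (hs : s' = .lambda) (k : ℕ) :
    E'.powBase k (.inr hs) ≫ φ.pow k = ε Φ ≫ Φ.map (E.powBase k (.inr (h hs))) := by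
  induction k with
  | zero => simp [powBase, pow]
  | succ k ih =>
    rw [powBase_succ _ hs, powBase_succ _ (h hs), pow_succ, Category.assoc, push_hom,
      reassoc_of% ih, Φ.map_comp]

end HomOver
end

namespace HomOver

variable [SymmetricCategory W] [SymmetricCategory W'] [Φ.LaxBraided] {h Φ} {E' : Pointed s' W'}
  {E : Pointed s W} (φ : HomOver h Φ E' E)

lemma swap_hom {X : W} {X' : W'} (x : X' ⟶ Φ.obj X) :
    E'.swap X' ≫ ((x ⊗ₘ φ.hom) ≫ μ Φ X E.X ⊗ₘ φ.hom) ≫ μ Φ (X ⊗ E.X) E.X =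
      ((x ⊗ₘ φ.hom) ≫ μ Φ X E.X ⊗ₘ φ.hom) ≫ μ Φ (X ⊗ E.X) E.X ≫ Φ.map (E.swap X) := by
  have h1 := Functor.LaxBraided.braided (F := Φ) E.X E.X
  have h2 := BraidedCategory.braiding_naturality φ.hom φ.hom
  have h3 : ((x ⊗ₘ φ.hom) ≫ μ Φ X E.X ⊗ₘ φ.hom) ≫ μ Φ (X ⊗ E.X) E.X =
    (α_ _ _ _).hom ≫ (x ⊗ₘ (φ.hom ⊗ₘ φ.hom) ≫ μ Φ E.X E.X) ≫ μ Φ X (E.X ⊗ E.X) ≫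
      Φ.map (α_ _ _ _).inv := by
    have h4 : ((x ⊗ₘ φ.hom) ≫ μ Φ X E.X ⊗ₘ φ.hom) =
        (α_ _ _ _).hom ≫ (x ⊗ₘ (φ.hom ⊗ₘ φ.hom)) ≫ (α_ _ _ _).inv ≫ μ Φ X E.X ▷ Φ.obj E.X := by
      simp [← tensorHom_comp_whiskerRight]
    rw [h4, ← tensorHom_comp_whiskerLeft_assoc]
    simp only [Category.assoc, associativity_inv]
  rw [reassoc_of% h3, h3]
  simp only [swap, Category.assoc, Functor.map_comp, Iso.inv_hom_id_assoc,
    Iso.map_inv_hom_id_assoc]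
  rw [← Functor.LaxMonoidal.μ_natural_right_assoc, tensorHom_comp_whiskerLeft_assoc,
    whiskerLeft_comp_tensorHom_assoc, ← reassoc_of% h2, Category.assoc, h1]

lemma swap_hom_assoc : type_of% (reassoc_of% @swap_hom) := by
  have h := reassoc_of% @swap_hom
  exact @h

lemma insert_pow (k : ℕ) (j : Fin (k + 1)) :
    E'.insert k j ≫ φ.pow (k + 1) = φ.pow (k + 1) ≫ Φ.map (E.insert k j) := by
  induction k with
  | zero =>
    obtain rfl : j = Fin.last 0 := by omega
    rw [insert_last, insert_last, Φ.map_id]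
    simp
  | succ k ih =>
    induction j using Fin.lastCases with
    | last => rw [insert_last, insert_last, Φ.map_id]; simp
    | cast j =>
      rw [insert_castSucc, insert_castSucc, pow_succ, Category.assoc, whiskerRight_comp_tensorHom_assoc,
        ih]
      rw [← tensorHom_comp_whiskerRight_assoc, μ_natural_left, pow_succ, swap_hom_assoc]
      simp

lemma powMap_pow (k l : ℕ) (f : (⟨k⟩ : Idx s') ⟶ ⟨l⟩) :
    E'.powMap k l f ≫ φ.pow l = φ.pow k ≫ Φ.map (E.powMap k l (Idx.inclMap h f)) := by
  induction k generalizing l with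
  | zero =>
    rcases s' with _ | _
    · obtain rfl : l = 0 := by simpa using Idx.hom_zero_left f
      change 𝟙 _ ≫ _ = _ ≫ Φ.map (𝟙 _)
      simp
    · exact φ.powBase_pow rfl l
  | succ k ih =>
    rcases l with _ | l
    · exact (Idx.hom_zero_right f).elim
    rw [powMap_succ, powMap_succ, Category.assoc, insert_pow, Idx.inclMap_remove, pow_succ, pow_succ,
      Category.assoc, whiskerRight_comp_tensorHom_assoc, ih, ← tensorHom_comp_whiskerRight_assoc,
      μ_natural_left_assoc, Φ.map_comp, Category.assoc]
    rfl

end HomOver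
end Pointed

namespace Pointed

variable {s : SeqKind} {W : Type u} [Category.{v} W] [MonoidalCategory W] [SymmetricCategory W]
  (E : Pointed s W)

/-- The isomorphism `E^{⊗ k} ⊗ E^{⊗ l} ≅ E^{⊗ (k + l)}`. -/
def powAdd (k : ℕ) : (l : ℕ) → (E.pow k ⊗ E.pow l ≅ E.pow (k + l))
  | 0 => ρ_ _
  | l + 1 => (α_ _ _ _).symm ≪≫ whiskerRightIso (powAdd k l) E.X

lemma powAdd_zero (k : ℕ) : (E.powAdd k 0).hom = (ρ_ _).hom := rfl

lemma powAdd_succ (k l : ℕ) :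
    (E.powAdd k (l + 1)).hom = (α_ _ _ _).inv ≫ (E.powAdd k l).hom ▷ E.X := rfl

lemma powMap_of_last {k l : ℕ} (f : (⟨k + 1⟩ : Idx s) ⟶ ⟨l + 1⟩) (g : (⟨k⟩ : Idx s) ⟶ ⟨l⟩)
    (h : ∀ i : Fin k, (f.toFun i.castSucc).val = (g.toFun i).val)
    (h' : (f.toFun (Fin.last k)).val = l) :
    E.powMap (k + 1) (l + 1) f = E.powMap k l g ▷ E.X := by
  have e1 : f.toFun (Fin.last k) = Fin.last l := Fin.ext h'
  have e2 : Idx.remove f (Fin.last k) = g := Idx.remove_eq fun i => by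
    rw [e1, Fin.succAbove_last, Fin.succAbove_last]
    exact Fin.ext (h i).symm
  rw [powMap_succ, e1, e2, insert_last, Category.comp_id]

lemma powMap_of_castSucc (hs : s = .lambda) {k l : ℕ} (f : (⟨k⟩ : Idx s) ⟶ ⟨l + 1⟩)
    (g : (⟨k⟩ : Idx s) ⟶ ⟨l⟩) (h : ∀ i : Fin k, f.toFun i = (g.toFun i).castSucc) :
    E.powMap k (l + 1) f = E.powMap k l g ≫ E.push hs _ := by
  induction k generalizing l with
  | zero => rfl
  | succ k ih =>
    rcases l with _ | l
    · exact (Idx.hom_zero_right g).elim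
    have e : ∀ i, (Idx.remove f (Fin.last k)).toFun i =
        ((Idx.remove g (Fin.last k)).toFun i).castSucc := by
      intro i
      apply Fin.succAbove_right_injective (p := f.toFun (Fin.last k))
      have e3 := Idx.succAbove_remove g (Fin.last k) i
      rw [Idx.succAbove_remove, h, h, ← e3]
      simp
    have e2 : E.push hs (E.pow l) ▷ E.X ≫ E.swap (E.pow l) = E.push hs _ := by
      rw [← push_swap, Category.assoc, swap_swap, Category.comp_id]
    rw [powMap_succ, h, insert_castSucc, ih _ _ e, comp_whiskerRight, Category.assoc,
      reassoc_of% e2, powMap_succ, Category.assoc, push_naturality]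

lemma powMap_whiskerRight_succ {k k' : ℕ} (f : (⟨k⟩ : Idx s) ⟶ ⟨k'⟩) (l : ℕ) :
    E.powMap (k + (l + 1)) (k' + (l + 1)) (f ▷ (⟨l + 1⟩ : Idx s)) =
      E.powMap (k + l) (k' + l) (f ▷ (⟨l⟩ : Idx s)) ▷ E.X :=
  E.powMap_of_last (k := k + l) (l := k' + l) _ _
    (fun i => by
      induction i using Fin.addCases with
      | left i =>
        exact (congrArg Fin.val (Idx.wedge_castAdd f (𝟙 (⟨l + 1⟩ : Idx s)) i)).trans
          (congrArg Fin.val (Idx.wedge_castAdd f (𝟙 (⟨l⟩ : Idx s)) i)).symm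
      | right i =>
        exact (congrArg Fin.val (Idx.wedge_natAdd f (𝟙 (⟨l + 1⟩ : Idx s)) i.castSucc)).trans
          (congrArg Fin.val (Idx.wedge_natAdd f (𝟙 (⟨l⟩ : Idx s)) i)).symm)
    (congrArg Fin.val (Idx.wedge_natAdd f (𝟙 (⟨l + 1⟩ : Idx s)) (Fin.last l)))

lemma powAdd_natural_left {k k' : ℕ} (f : (⟨k⟩ : Idx s) ⟶ ⟨k'⟩) (l : ℕ) :
    E.powMap k k' f ▷ E.pow l ≫ (E.powAdd k' l).hom =
      (E.powAdd k l).hom ≫ E.powMap (k + l) (k' + l) (f ▷ (⟨l⟩ : Idx s)) := by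
  induction l with
  | zero =>
    have : f ▷ (⟨0⟩ : Idx s) = f := by
      ext i;
      exact congrArg Fin.val (Idx.wedge_castAdd f (𝟙 (⟨0⟩ : Idx s)) i)
    simp only [powAdd_zero]
    erw [this]
    simp
  | succ l ih =>
    rw [powAdd_succ, powAdd_succ, powMap_whiskerRight_succ, Category.assoc, ← comp_whiskerRight,
      ← ih]
    simp

lemma whiskerLeft_push (hs : s = .lambda) (X Y : W) :
    X ◁ E.push hs Y ≫ (α_ _ _ _).inv = E.push hs (X ⊗ Y) := by
  simp [push]

lemma whiskerLeft_swap (X Y : W) :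
    X ◁ E.swap Y = (α_ _ _ _).inv ≫ (α_ _ _ _).inv ▷ E.X ≫ E.swap (X ⊗ Y) ≫
      (α_ _ _ _).hom ▷ E.X ≫ (α_ _ _ _).hom := by
  simp [swap]

lemma whiskerLeft_insert_powAdd (k l : ℕ) (j : Fin (l + 1)) :
    E.pow k ◁ E.insert l j ≫ (E.powAdd k (l + 1)).hom =
      (E.powAdd k (l + 1)).hom ≫ E.insert (k + l) (Fin.natAdd k j) := by
  induction l with
  | zero =>
    obtain rfl : j = Fin.last 0 := by omega
    rw [insert_last, Fin.natAdd_last, insert_last]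
    simp
  | succ l ih =>
    induction j using Fin.lastCases with
    | last =>
      rw [insert_last, Fin.natAdd_last, insert_last]
      simp
    | cast j =>
      have e : Fin.natAdd k j.castSucc = (Fin.natAdd k j).castSucc := rfl
      have e' := E.insert_castSucc (k + l) (Fin.natAdd k j)
      rw [e, insert_castSucc, powAdd_succ, MonoidalCategory.whiskerLeft_comp, Category.assoc,
        associator_inv_naturality_middle_assoc, ← comp_whiskerRight, ih, whiskerLeft_swap,
        powAdd_succ]
      refine Eq.trans ?_ (congrArg _ e'.symm)
      simp [swap_naturality_assoc]

lemma powAdd_natural_right (k : ℕ) {l l' : ℕ} (g : (⟨l⟩ : Idx s) ⟶ ⟨l'⟩) :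
    E.pow k ◁ E.powMap l l' g ≫ (E.powAdd k l').hom =
      (E.powAdd k l).hom ≫ E.powMap (k + l) (k + l') ((⟨k⟩ : Idx s) ◁ g) := by
  induction l generalizing l' with
  | zero =>
    induction l' with
    | zero =>
      obtain rfl : g = 𝟙 _ := by ext i; exact i.elim0
      rw [powMap_id, MonoidalCategory.whiskerLeft_id, MonoidalCategory.whiskerLeft_id]
      erw [powMap_id]
      simp
    | succ l' ih =>
      have hs : s = .lambda := (Idx.hom_zero_left g).resolve_left (Nat.succ_ne_zero l')
      let g' : (⟨0⟩ : Idx s) ⟶ ⟨l'⟩ := ⟨Fin.elim0, fun i => i.elim0, fun h => by simp [hs] at h⟩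
      have e1 : E.powMap 0 (l' + 1) g = E.powMap 0 l' g' ≫ E.push hs _ := rfl
      have e2 : E.powMap (k + 0) (k + (l' + 1)) ((⟨k⟩ : Idx s) ◁ g) =
          E.powMap (k + 0) (k + l') ((⟨k⟩ : Idx s) ◁ g') ≫ E.push hs _ :=
        E.powMap_of_castSucc hs (l := k + l') _ _ (fun i => Fin.ext (by
          exact (congrArg Fin.val (Idx.wedge_castAdd (𝟙 (⟨k⟩ : Idx s)) g i)).trans
            (congrArg Fin.val (Idx.wedge_castAdd (𝟙 (⟨k⟩ : Idx s)) g' i)).symm))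
      rw [e1, e2, ← reassoc_of% ih g', powAdd_succ, MonoidalCategory.whiskerLeft_comp,
        Category.assoc, reassoc_of% whiskerLeft_push, push_naturality]
  | succ l ih =>
    rcases l' with _ | l'
    · exact (Idx.hom_zero_right g).elim
    have e : Idx.remove (k := k + l) (l := k + l') ((⟨k⟩ : Idx s) ◁ g) (Fin.last (k + l)) =
        (⟨k⟩ : Idx s) ◁ Idx.remove g (Fin.last l) := Idx.remove_eq fun i => by
      have e1 : Idx.Hom.toFun ((⟨k⟩ : Idx s) ◁ g) (Fin.last (k + l)) =
        Fin.natAdd k (g.toFun (Fin.last l)) := Idx.wedge_natAdd (𝟙 (⟨k⟩ : Idx s)) g (Fin.last l)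
      rw [e1, Fin.succAbove_last]
      induction i using Fin.addCases with
      | left i =>
        have e2 := Idx.wedge_castAdd (𝟙 (⟨k⟩ : Idx s)) g i
        have e3 := Idx.wedge_castAdd (𝟙 (⟨k⟩ : Idx s)) (Idx.remove g (Fin.last l)) i
        refine Eq.trans (congrArg _ e3) (Eq.trans ?_ e2.symm)
        change Fin.succAbove (n := k + l') (Fin.natAdd k (m := l' + 1) (g.toFun (Fin.last l)))
          (Fin.castAdd l' i) = Fin.castAdd (l' + 1) i
        rw [Fin.succAbove_of_castSucc_lt]
        · rfl
        · simp only [Fin.lt_def, Fin.val_castSucc, Fin.val_castAdd, Fin.val_natAdd]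
          omega
      | right i =>
        have e2 := Idx.wedge_natAdd (𝟙 (⟨k⟩ : Idx s)) g i.castSucc
        have e3 := Idx.wedge_natAdd (𝟙 (⟨k⟩ : Idx s)) (Idx.remove g (Fin.last l)) i
        refine Eq.trans (congrArg _ e3) (Eq.trans ?_ e2.symm)
        have e4 := Idx.succAbove_remove g (Fin.last l) i
        rw [Fin.succAbove_last] at e4
        rw [← e4]
        ext
        simp [Fin.succAbove, Fin.lt_def]
        grind
    have e' : E.powMap (k + (l + 1)) (k + (l' + 1)) ((⟨k⟩ : Idx s) ◁ g) =
        E.powMap (k + l) (k + l') ((⟨k⟩ : Idx s) ◁ Idx.remove g (Fin.last l)) ▷ E.X ≫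
          E.insert (k + l') (Fin.natAdd k (g.toFun (Fin.last l))) := by
      rw [← e]
      have e1 : Idx.Hom.toFun ((⟨k⟩ : Idx s) ◁ g) (Fin.last (k + l)) =
        Fin.natAdd k (g.toFun (Fin.last l)) := Idx.wedge_natAdd (𝟙 (⟨k⟩ : Idx s)) g (Fin.last l)
      rw [← e1]
      exact E.powMap_succ (k := k + l) (l := k + l') ((⟨k⟩ : Idx s) ◁ g)
    rw [e', powMap_succ, MonoidalCategory.whiskerLeft_comp, Category.assoc,
      whiskerLeft_insert_powAdd, powAdd_succ, powAdd_succ]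
    simp only [Category.assoc, associator_inv_naturality_middle_assoc]
    rw [← comp_whiskerRight_assoc, ih, comp_whiskerRight_assoc]

lemma powAdd_assoc (k l m : ℕ) :
    (E.powAdd k l).hom ▷ E.pow m ≫ (E.powAdd (k + l) m).hom ≫
      E.powMap (k + l + m) (k + (l + m)) (α_ (⟨k⟩ : Idx s) ⟨l⟩ ⟨m⟩).hom =
    (α_ _ _ _).hom ≫ E.pow k ◁ (E.powAdd l m).hom ≫ (E.powAdd k (l + m)).hom := by
  induction m with
  | zero =>
    have e : E.powMap (k + l + 0) (k + (l + 0)) (α_ (⟨k⟩ : Idx s) ⟨l⟩ ⟨0⟩).hom = 𝟙 _ :=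
      E.powMap_id (k + l)
    rw [e, powAdd_zero, powAdd_zero]
    simp
  | succ m ih =>
    have e : E.powMap (k + l + (m + 1)) (k + (l + (m + 1))) (α_ (⟨k⟩ : Idx s) ⟨l⟩ ⟨m + 1⟩).hom =
        E.powMap (k + l + m) (k + (l + m)) (α_ (⟨k⟩ : Idx s) ⟨l⟩ ⟨m⟩).hom ▷ E.X :=
      E.powMap_of_last (k := k + l + m) (l := k + (l + m)) _ _ (fun i => rfl)
        (Nat.add_assoc _ _ _)
    have ih' := congrArg (fun t => (α_ _ _ _).inv ≫ t ▷ E.X) ih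
    simp only [comp_whiskerRight] at ih'
    have e3 : (E.powAdd k (l + (m + 1))).hom =
      (α_ _ _ _).inv ≫ (E.powAdd k (l + m)).hom ▷ E.X := rfl
    rw [e, e3, powAdd_succ, powAdd_succ]
    simp only [Category.assoc, associator_inv_naturality_left_assoc]
    rw [ih']
    simp

lemma powAdd_left_unit (l : ℕ) :
    (E.powAdd 0 l).hom ≫ E.powMap (0 + l) l (λ_ (⟨l⟩ : Idx s)).hom = (λ_ (E.pow l)).hom := by
  induction l with
  | zero =>
    have e : E.powMap (0 + 0) 0 (λ_ (⟨0⟩ : Idx s)).hom = 𝟙 _ := E.powMap_id 0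
    rw [e, powAdd_zero, Category.comp_id]
    exact unitors_equal.symm
  | succ l ih =>
    have e : E.powMap (0 + (l + 1)) (l + 1) (λ_ (⟨l + 1⟩ : Idx s)).hom =
        E.powMap (0 + l) l (λ_ (⟨l⟩ : Idx s)).hom ▷ E.X :=
      E.powMap_of_last (k := 0 + l) (l := l) _ _ (fun i => rfl) (Nat.zero_add _)
    rw [e, powAdd_succ, Category.assoc, ← comp_whiskerRight, ih]
    simp

instance : E.powFunctor.LaxMonoidal where
  ε := 𝟙 _
  μ a b := (E.powAdd a.n b.n).hom
  μ_natural_left f b := E.powAdd_natural_left f b.n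
  μ_natural_right a f := E.powAdd_natural_right a.n f
  associativity a b c := E.powAdd_assoc a.n b.n c.n
  left_unitality a := by
    refine (E.powAdd_left_unit a.n).symm.trans ?_
    exact ((congrArg (· ≫ _) (id_whiskerRight (𝟙_ W) (E.pow a.n))).trans (Category.id_comp _)).symm
  right_unitality a := by
    refine Eq.symm ((congrArg (· ≫ _) (MonoidalCategory.whiskerLeft_id (E.pow a.n) (𝟙_ W))).trans
      ((Category.id_comp _).trans ?_))
    exact (congrArg (_ ≫ ·) (E.powMap_id a.n)).trans (Category.comp_id _)

lemma μ_powFunctor (a b : Idx s) :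
    Functor.LaxMonoidal.μ E.powFunctor a b = (E.powAdd a.n b.n).hom := rfl

lemma ε_powFunctor : Functor.LaxMonoidal.ε E.powFunctor = 𝟙 _ := rfl

instance (a b : Idx s) : IsIso (Functor.LaxMonoidal.μ E.powFunctor a b) :=
  inferInstanceAs (IsIso (E.powAdd a.n b.n).hom)

instance : IsIso (Functor.LaxMonoidal.ε E.powFunctor) := inferInstanceAs (IsIso (𝟙 (𝟙_ W)))

end Pointed

section Hex
open Functor.LaxMonoidal
variable {C : Type u} [Category.{v} C] [MonoidalCategory C] [SymmetricCategory C]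
  {D : Type u'} [Category.{v'} D] [MonoidalCategory D] [SymmetricCategory D]
  (F : C ⥤ D) [F.LaxMonoidal]

/-- The compatibility of a lax monoidal functor with one particular braiding. -/
def BraidedAt (X Y : C) : Prop :=
  μ F X Y ≫ F.map (β_ X Y).hom = (β_ (F.obj X) (F.obj Y)).hom ≫ μ F Y X

variable {F}

lemma BraidedAt.symm {X Y : C} (h : BraidedAt F X Y) : BraidedAt F Y X := by
  have h' := (β_ (F.obj Y) (F.obj X)).hom ≫= h =≫ F.map (β_ Y X).hom
  simp only [Category.assoc, SymmetricCategory.symmetry_assoc, ← F.map_comp,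
    SymmetricCategory.symmetry, F.map_id, Category.comp_id] at h'
  exact h'.symm

lemma BraidedAt.unit (X : C) [IsIso (ε F)] : BraidedAt F X (𝟙_ C) := by
  unfold BraidedAt
  rw [← cancel_epi (F.obj X ◁ ε F)]
  simp [braiding_tensorUnit_right]

lemma BraidedAt.tensor {X Y Z : C} [IsIso (μ F Y Z)] (h : BraidedAt F X Y) (h' : BraidedAt F X Z) :
    BraidedAt F X (Y ⊗ Z) := by
  unfold BraidedAt at *
  rw [← cancel_epi (F.obj X ◁ μ F Y Z)]
  rw [BraidedCategory.braiding_naturality_right_assoc, BraidedCategory.braiding_tensor_right_hom,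
    BraidedCategory.braiding_tensor_right_hom]
  simp only [Functor.map_comp, Category.assoc]
  rw [associativity_inv_assoc, ← μ_natural_left_assoc, ← comp_whiskerRight_assoc, h]
  simp only [comp_whiskerRight, Category.assoc]
  rw [associativity_assoc, ← μ_natural_right_assoc, ← MonoidalCategory.whiskerLeft_comp_assoc, h']
  simp only [MonoidalCategory.whiskerLeft_comp, Category.assoc]
  rw [associativity_inv]

end Hex

namespace Pointed
variable {s : SeqKind} {W : Type u} [Category.{v} W] [MonoidalCategory W] [SymmetricCategory W]
  (E : Pointed s W)

lemma braidedAt_one_one : BraidedAt E.powFunctor (⟨1⟩ : Idx s) ⟨1⟩ := by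
  have e : E.powMap (1 + 1) (1 + 1) (β_ (⟨1⟩ : Idx s) ⟨1⟩).hom = E.swap (𝟙_ W) := by
    have e1 : Idx.remove (k := 1) (l := 1) (β_ (⟨1⟩ : Idx s) ⟨1⟩).hom (Fin.last 1) = 𝟙 _ := by
      ext i; exact congrArg Fin.val (Subsingleton.elim (α := Fin 1) _ _)
    have e2 : Idx.Hom.toFun (β_ (⟨1⟩ : Idx s) ⟨1⟩).hom (Fin.last 1) = (Fin.last 0).castSucc :=
      Fin.ext (Idx.braiding_hom_val (⟨1⟩ : Idx s) ⟨1⟩ (Fin.last 1))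
    refine (E.powMap_succ (k := 1) (l := 1) _).trans ?_
    rw [e1, e2, powMap_id, insert_castSucc, insert_last]
    simp
  refine (congrArg (_ ≫ ·) e).trans ?_
  change (E.powAdd 1 1).hom ≫ _ = (β_ (𝟙_ W ⊗ E.X) (𝟙_ W ⊗ E.X)).hom ≫ (E.powAdd 1 1).hom
  have e3 : (E.powAdd 1 1).hom = ((λ_ E.X).hom ⊗ₘ (λ_ E.X).hom) ≫ (λ_ E.X).inv ▷ E.X := by
    change (α_ _ _ _).inv ≫ (ρ_ _).hom ▷ _ = _
    monoidal
  have e4 : (λ_ E.X).inv ▷ E.X ≫ E.swap (𝟙_ W) = (β_ E.X E.X).hom ≫ (λ_ E.X).inv ▷ E.X := by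
    simp only [swap, leftUnitor_inv_whiskerRight, Category.assoc, Iso.inv_hom_id_assoc]
    rw [← leftUnitor_inv_naturality_assoc]
  rw [e3, Category.assoc, e4, BraidedCategory.braiding_naturality_assoc]

instance : E.powFunctor.LaxBraided where
  braided a b := by
    have h1 : ∀ l : ℕ, BraidedAt E.powFunctor (⟨1⟩ : Idx s) ⟨l⟩ := fun l => by
      induction l with
      | zero => exact BraidedAt.unit (F := E.powFunctor) _
      | succ l ih => exact BraidedAt.tensor (F := E.powFunctor) ih E.braidedAt_one_one
    have h2 : ∀ l : ℕ, BraidedAt E.powFunctor a ⟨l⟩ := fun l => by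
      induction l with
      | zero => exact BraidedAt.unit (F := E.powFunctor) _
      | succ l ih => exact BraidedAt.tensor (F := E.powFunctor) ih (h1 a.n).symm
    exact h2 b.n

end Pointed

section Day

open scoped DayFunctor ExternalProduct

variable {V : Type u} [Category.{v} V] [MonoidalCategory V] [SymmetricCategory V]
  [MonoidalClosed V] [HasColimits V]

instance preservesColimits_tensorLeft (X : V) : PreservesColimitsOfSize.{v', u'} (tensorLeft X) :=
  (ihom.adjunction X).leftAdjoint_preservesColimits

instance preservesColimits_tensorRight (X : V) : PreservesColimitsOfSize.{v', u'} (tensorRight X) :=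
  preservesColimits_of_natIso (BraidedCategory.tensorLeftIsoTensorRight X)

variable {C : Type} [Category.{0} C] [MonoidalCategory C]

/-- The Day convolution monoidal structure on functors `C ⥤ V`. -/
noncomputable instance dayMonoidal : MonoidalCategory (C ⊛⥤ V) := inferInstance

open LawfulDayConvolutionMonoidalCategoryStruct in
/-- The universal maps `F x ⊗ G y ⟶ (F ⊠ G) (x ⊗ y)` of the Day convolution. -/
noncomputable def inc (F G : C ⊛⥤ V) (x y : C) :
    F.functor.obj x ⊗ G.functor.obj y ⟶ (F ⊗ G).functor.obj (x ⊗ y) :=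
  (DayFunctor.η F G).app (x, y)

variable (V C) in
/-- The universal map `I ⟶ 𝟙 (𝟙)` of the unit for Day convolution. -/
noncomputable def incUnit : 𝟙_ V ⟶ (𝟙_ (C ⊛⥤ V)).functor.obj (𝟙_ C) := DayFunctor.ν C V

section Lemmas
open LawfulDayConvolutionMonoidalCategoryStruct

lemma inc_hom_ext {F G H : C ⊛⥤ V} {α β : F ⊗ G ⟶ H}
    (h : ∀ x y : C, inc F G x y ≫ α.natTrans.app (x ⊗ y) = inc F G x y ≫ β.natTrans.app (x ⊗ y)) :
    α = β := DayFunctor.tensor_hom_ext h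

lemma incUnit_hom_ext {F : C ⊛⥤ V} {α β : 𝟙_ (C ⊛⥤ V) ⟶ F}
    (h : incUnit V C ≫ α.natTrans.app (𝟙_ C) = incUnit V C ≫ β.natTrans.app (𝟙_ C)) :
    α = β := DayFunctor.unit_hom_ext h

lemma inc_natural (F G : C ⊛⥤ V) {x x' y y' : C} (f : x ⟶ x') (g : y ⟶ y') :
    (F.functor.map f ⊗ₘ G.functor.map g) ≫ inc F G x' y' =
      inc F G x y ≫ (F ⊗ G).functor.map (f ⊗ₘ g) := by
  have := (DayFunctor.η F G).naturality (X := (x, y)) (Y := (x', y')) (f, g)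
  rw [MonoidalCategory.tensorHom_def]
  exact this

lemma inc_natural_assoc : type_of% (reassoc_of% @inc_natural) := by
  have h := reassoc_of% @inc_natural
  exact @h

lemma inc_natural_left (F G : C ⊛⥤ V) {x x' : C} (f : x ⟶ x') (y : C) :
    F.functor.map f ▷ G.functor.obj y ≫ inc F G x' y =
      inc F G x y ≫ (F ⊗ G).functor.map (f ▷ y) := by
  simpa using inc_natural F G f (𝟙 y)

lemma inc_natural_left_assoc : type_of% (reassoc_of% @inc_natural_left) := by
  have h := reassoc_of% @inc_natural_left
  exact @h

lemma inc_natural_right (F G : C ⊛⥤ V) (x : C) {y y' : C} (g : y ⟶ y') :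
    F.functor.obj x ◁ G.functor.map g ≫ inc F G x y' =
      inc F G x y ≫ (F ⊗ G).functor.map (x ◁ g) := by
  simpa using inc_natural F G (𝟙 x) g

lemma inc_natural_right_assoc : type_of% (reassoc_of% @inc_natural_right) := by
  have h := reassoc_of% @inc_natural_right
  exact @h

lemma inc_tensorHom {F F' G G' : C ⊛⥤ V} (f : F ⟶ F') (g : G ⟶ G') (x y : C) :
    inc F G x y ≫ (f ⊗ₘ g).natTrans.app (x ⊗ y) =
      (f.natTrans.app x ⊗ₘ g.natTrans.app y) ≫ inc F' G' x y :=
  convolutionExtensionUnit_comp_ι_map_tensorHom_app C V f g x y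

lemma inc_tensorHom_assoc : type_of% (reassoc_of% @inc_tensorHom) := by
  have h := reassoc_of% @inc_tensorHom
  exact @h

lemma inc_whiskerLeft (F : C ⊛⥤ V) {G G' : C ⊛⥤ V} (g : G ⟶ G') (x y : C) :
    inc F G x y ≫ (F ◁ g).natTrans.app (x ⊗ y) =
      (F.functor.obj x ◁ g.natTrans.app y) ≫ inc F G' x y :=
  convolutionExtensionUnit_comp_ι_map_whiskerLeft_app V F g x y

lemma inc_whiskerLeft_assoc : type_of% (reassoc_of% @inc_whiskerLeft) := by
  have h := reassoc_of% @inc_whiskerLeft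
  exact @h

lemma inc_whiskerRight {F F' : C ⊛⥤ V} (f : F ⟶ F') (G : C ⊛⥤ V) (x y : C) :
    inc F G x y ≫ (f ▷ G).natTrans.app (x ⊗ y) =
      (f.natTrans.app x ▷ G.functor.obj y) ≫ inc F' G x y :=
  convolutionExtensionUnit_comp_ι_map_whiskerRight_app C V f G x y

lemma inc_whiskerRight_assoc : type_of% (reassoc_of% @inc_whiskerRight) := by
  have h := reassoc_of% @inc_whiskerRight
  exact @h

lemma inc_associator (F G H : C ⊛⥤ V) (x y z : C) :
    inc F G x y ▷ H.functor.obj z ≫ inc (F ⊗ G) H (x ⊗ y) z ≫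
      (α_ F G H).hom.natTrans.app ((x ⊗ y) ⊗ z) =
    (α_ _ _ _).hom ≫ (F.functor.obj x ◁ inc G H y z) ≫ inc F (G ⊗ H) x (y ⊗ z) ≫
      (F ⊗ G ⊗ H).functor.map (α_ _ _ _).inv :=
  associator_hom_unit_unit V F G H x y z

lemma inc_associator_assoc : type_of% (reassoc_of% @inc_associator) := by
  have h := reassoc_of% @inc_associator
  exact @h

lemma inc_associator_inv (F G H : C ⊛⥤ V) (x y z : C) :
    F.functor.obj x ◁ inc G H y z ≫ inc F (G ⊗ H) x (y ⊗ z) ≫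
      (α_ F G H).inv.natTrans.app (x ⊗ (y ⊗ z)) =
    (α_ _ _ _).inv ≫ (inc F G x y ▷ H.functor.obj z) ≫ inc (F ⊗ G) H (x ⊗ y) z ≫
      ((F ⊗ G) ⊗ H).functor.map (α_ _ _ _).hom := by
  have h1 : (α_ F G H).hom.natTrans.app ((x ⊗ y) ⊗ z) ≫
      (α_ F G H).inv.natTrans.app ((x ⊗ y) ⊗ z) = 𝟙 _ := by
    rw [← NatTrans.comp_app, ← DayFunctor.comp_natTrans]; simp
  have h2 := inc_associator F G H x y z =≫ ((α_ F G H).inv.natTrans.app _ ≫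
    ((F ⊗ G) ⊗ H).functor.map (α_ x y z).hom)
  simp only [Category.assoc, reassoc_of% h1, NatTrans.naturality_assoc, ← Functor.map_comp] at h2
  simp [h2]

lemma inc_associator_inv_assoc : type_of% (reassoc_of% @inc_associator_inv) := by
  have h := reassoc_of% @inc_associator_inv
  exact @h

lemma inc_leftUnitor (F : C ⊛⥤ V) (y : C) :
    incUnit V C ▷ F.functor.obj y ≫ inc (𝟙_ _) F (𝟙_ C) y ≫
      (λ_ F).hom.natTrans.app (𝟙_ C ⊗ y) = (λ_ (F.functor.obj y)).hom ≫ F.functor.map (λ_ y).inv :=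
  leftUnitor_hom_unit_app V F y

lemma inc_leftUnitor_assoc : type_of% (reassoc_of% @inc_leftUnitor) := by
  have h := reassoc_of% @inc_leftUnitor
  exact @h

lemma inc_rightUnitor (F : C ⊛⥤ V) (y : C) :
    F.functor.obj y ◁ incUnit V C ≫ inc F (𝟙_ _) y (𝟙_ C) ≫
      (ρ_ F).hom.natTrans.app (y ⊗ 𝟙_ C) = (ρ_ (F.functor.obj y)).hom ≫ F.functor.map (ρ_ y).inv :=
  rightUnitor_hom_unit_app V F y

lemma inc_rightUnitor_assoc : type_of% (reassoc_of% @inc_rightUnitor) := by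
  have h := reassoc_of% @inc_rightUnitor
  exact @h

/-- Morphisms out of a Day convolution. -/
noncomputable def dayDesc {F G H : C ⊛⥤ V}
    (f : ∀ x y : C, F.functor.obj x ⊗ G.functor.obj y ⟶ H.functor.obj (x ⊗ y))
    (hf : ∀ (x x' y y' : C) (a : x ⟶ x') (b : y ⟶ y'),
      (F.functor.map a ⊗ₘ G.functor.map b) ≫ f x' y' = f x y ≫ H.functor.map (a ⊗ₘ b)) :
    F ⊗ G ⟶ H :=
  DayFunctor.tensorDesc
    { app p := f p.1 p.2
      naturality p q a := by
        have := hf _ _ _ _ a.1 a.2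
        rw [MonoidalCategory.tensorHom_def] at this
        exact this }

@[simp]
lemma inc_dayDesc {F G H : C ⊛⥤ V}
    (f : ∀ x y : C, F.functor.obj x ⊗ G.functor.obj y ⟶ H.functor.obj (x ⊗ y))
    (hf : ∀ (x x' y y' : C) (a : x ⟶ x') (b : y ⟶ y'),
      (F.functor.map a ⊗ₘ G.functor.map b) ≫ f x' y' = f x y ≫ H.functor.map (a ⊗ₘ b)) (x y : C) :
    inc F G x y ≫ (dayDesc f hf).natTrans.app (x ⊗ y) = f x y :=
  DayFunctor.η_comp_tensorDesc_app _ x y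

@[simp]
lemma inc_dayDesc_assoc : type_of% (reassoc_of% @inc_dayDesc) := by
  have h := reassoc_of% @inc_dayDesc
  exact @h

/-- Morphisms out of the unit for Day convolution. -/
noncomputable def unitDesc {F : C ⊛⥤ V} (f : 𝟙_ V ⟶ F.functor.obj (𝟙_ C)) : 𝟙_ (C ⊛⥤ V) ⟶ F :=
  DayFunctor.unitDesc f

@[simp]
lemma incUnit_unitDesc {F : C ⊛⥤ V} (f : 𝟙_ V ⟶ F.functor.obj (𝟙_ C)) :
    incUnit V C ≫ (unitDesc f).natTrans.app (𝟙_ C) = f :=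
  DayFunctor.ν_comp_unitDesc f

@[simp]
lemma incUnit_unitDesc_assoc : type_of% (reassoc_of% @incUnit_unitDesc) := by
  have h := reassoc_of% @incUnit_unitDesc
  exact @h

lemma inc_hom_ext_at {F G : C ⊛⥤ V} {c : C} {X : V} {f g : (F ⊗ G).functor.obj c ⟶ X}
    (h : ∀ (x y : C) (u : x ⊗ y ⟶ c), inc F G x y ≫ (F ⊗ G).functor.map u ≫ f =
      inc F G x y ≫ (F ⊗ G).functor.map u ≫ g) : f = g := by
  let := convolution C V (C ⊛⥤ V) F G
  exact DayConvolution.convolution_hom_ext_at ((ι C V (C ⊛⥤ V)).obj F) ((ι C V (C ⊛⥤ V)).obj G) c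
    (fun {x y} u => h x y u)

lemma inc_whiskerLeft_ext_at {F G : C ⊛⥤ V} {c : C} {X Z : V}
    {f g : Z ⊗ (F ⊗ G).functor.obj c ⟶ X}
    (h : ∀ (x y : C) (u : x ⊗ y ⟶ c), Z ◁ inc F G x y ≫ Z ◁ (F ⊗ G).functor.map u ≫ f =
      Z ◁ inc F G x y ≫ Z ◁ (F ⊗ G).functor.map u ≫ g) : f = g := by
  apply MonoidalClosed.curry_injective
  apply inc_hom_ext_at
  intro x y u
  simp only [← MonoidalClosed.curry_natural_left]
  exact congrArg _ (h x y u)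

lemma inc_whiskerRight_ext_at {F G : C ⊛⥤ V} {c : C} {X Z : V}
    {f g : (F ⊗ G).functor.obj c ⊗ Z ⟶ X}
    (h : ∀ (x y : C) (u : x ⊗ y ⟶ c), inc F G x y ▷ Z ≫ (F ⊗ G).functor.map u ▷ Z ≫ f =
      inc F G x y ▷ Z ≫ (F ⊗ G).functor.map u ▷ Z ≫ g) : f = g := by
  rw [← cancel_epi (β_ _ _).hom]
  apply inc_whiskerLeft_ext_at
  intro x y u
  simp only [BraidedCategory.braiding_naturality_right_assoc, h]

lemma inc_hom_ext₃ {F G H K : C ⊛⥤ V} {α β : (F ⊗ G) ⊗ H ⟶ K}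
    (h : ∀ x y z : C, inc F G x y ▷ H.functor.obj z ≫ inc (F ⊗ G) H (x ⊗ y) z ≫
        α.natTrans.app ((x ⊗ y) ⊗ z) =
      inc F G x y ▷ H.functor.obj z ≫ inc (F ⊗ G) H (x ⊗ y) z ≫ β.natTrans.app ((x ⊗ y) ⊗ z)) :
    α = β := by
  apply inc_hom_ext
  intro c z
  apply inc_whiskerRight_ext_at
  intro x y u
  have e := inc_natural_left (F ⊗ G) H u z
  rw [reassoc_of% e, NatTrans.naturality, reassoc_of% e, NatTrans.naturality, reassoc_of% (h x y z)]

lemma inc_hom_ext₃' {F G H K : C ⊛⥤ V} {α β : F ⊗ (G ⊗ H) ⟶ K}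
    (h : ∀ x y z : C, F.functor.obj x ◁ inc G H y z ≫ inc F (G ⊗ H) x (y ⊗ z) ≫
        α.natTrans.app (x ⊗ (y ⊗ z)) =
      F.functor.obj x ◁ inc G H y z ≫ inc F (G ⊗ H) x (y ⊗ z) ≫ β.natTrans.app (x ⊗ (y ⊗ z))) :
    α = β := by
  apply inc_hom_ext
  intro x c
  apply inc_whiskerLeft_ext_at
  intro y z u
  have e := inc_natural_right F (G ⊗ H) x u
  rw [reassoc_of% e, NatTrans.naturality, reassoc_of% e, NatTrans.naturality, reassoc_of% (h x y z)]

end Lemmas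

section Braiding

variable [SymmetricCategory C]

/-- The symmetry of the Day convolution. -/
noncomputable def dayBraiding (F G : C ⊛⥤ V) : F ⊗ G ⟶ G ⊗ F :=
  dayDesc (fun x y => (β_ (F.functor.obj x) (G.functor.obj y)).hom ≫ inc G F y x ≫
      (G ⊗ F).functor.map (β_ y x).hom) (fun x x' y y' a b => by
    rw [BraidedCategory.braiding_naturality_assoc, inc_natural_assoc, ← Functor.map_comp,
      BraidedCategory.braiding_naturality]
    simp)

lemma inc_dayBraiding (F G : C ⊛⥤ V) (x y : C) :
    inc F G x y ≫ (dayBraiding F G).natTrans.app (x ⊗ y) =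
      (β_ (F.functor.obj x) (G.functor.obj y)).hom ≫ inc G F y x ≫
        (G ⊗ F).functor.map (β_ y x).hom := by
  rw [dayBraiding, inc_dayDesc]

lemma inc_dayBraiding_assoc : type_of% (reassoc_of% @inc_dayBraiding) := by
  have h := reassoc_of% @inc_dayBraiding
  exact @h

lemma dayBraiding_dayBraiding (F G : C ⊛⥤ V) : dayBraiding F G ≫ dayBraiding G F = 𝟙 _ := by
  apply inc_hom_ext
  intro x y
  rw [DayFunctor.comp_natTrans, NatTrans.comp_app, inc_dayBraiding_assoc, NatTrans.naturality,
    inc_dayBraiding_assoc, ← Functor.map_comp]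
  simp

/-- The Day convolution is symmetric monoidal. -/
noncomputable instance daySymmetric : SymmetricCategory (C ⊛⥤ V) where
  braiding F G := ⟨dayBraiding F G, dayBraiding G F, dayBraiding_dayBraiding F G,
    dayBraiding_dayBraiding G F⟩
  braiding_naturality_right F G H f := by
    apply inc_hom_ext
    intro x y
    simp only [DayFunctor.comp_natTrans, NatTrans.comp_app, inc_whiskerLeft_assoc,
      inc_dayBraiding, inc_dayBraiding_assoc, NatTrans.naturality, inc_whiskerRight_assoc,
      BraidedCategory.braiding_naturality_right_assoc]
  braiding_naturality_left f H := by
    apply inc_hom_ext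
    intro x y
    simp only [DayFunctor.comp_natTrans, NatTrans.comp_app, inc_whiskerLeft_assoc,
      inc_dayBraiding, inc_dayBraiding_assoc, NatTrans.naturality, inc_whiskerRight_assoc,
      BraidedCategory.braiding_naturality_left_assoc]
  hexagon_forward F G H := by
    apply inc_hom_ext₃
    intro x y z
    simp only [DayFunctor.comp_natTrans, NatTrans.comp_app, inc_associator_assoc,
      NatTrans.naturality, NatTrans.naturality_assoc, inc_dayBraiding_assoc,
      BraidedCategory.braiding_naturality_right_assoc, inc_whiskerRight_assoc]
    rw [← comp_whiskerRight_assoc, inc_dayBraiding]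
    simp only [comp_whiskerRight, Category.assoc, inc_natural_left_assoc, NatTrans.naturality,
      NatTrans.naturality_assoc, inc_associator_assoc, inc_whiskerLeft_assoc]
    rw [← MonoidalCategory.whiskerLeft_comp_assoc _ (inc F H x z), inc_dayBraiding]
    simp only [MonoidalCategory.whiskerLeft_comp, Category.assoc, inc_natural_right_assoc,
      ← Functor.map_comp]
    rw [BraidedCategory.hexagon_forward_assoc]
    congr 5
    simp
  hexagon_reverse F G H := by
    apply inc_hom_ext₃'
    intro x y z
    simp only [DayFunctor.comp_natTrans, NatTrans.comp_app, inc_associator_inv_assoc,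
      NatTrans.naturality, NatTrans.naturality_assoc, inc_dayBraiding_assoc,
      BraidedCategory.braiding_naturality_left_assoc, inc_whiskerLeft_assoc]
    rw [← MonoidalCategory.whiskerLeft_comp_assoc _ (inc G H y z), inc_dayBraiding]
    simp only [MonoidalCategory.whiskerLeft_comp, Category.assoc, inc_natural_right_assoc, NatTrans.naturality,
      NatTrans.naturality_assoc, inc_associator_inv_assoc, inc_whiskerRight_assoc]
    rw [← comp_whiskerRight_assoc (inc F H x z), inc_dayBraiding]
    simp only [comp_whiskerRight, Category.assoc, inc_natural_left_assoc,
      ← Functor.map_comp]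
    rw [BraidedCategory.hexagon_reverse_assoc]
    congr 5
    simp
  symmetry F G := dayBraiding_dayBraiding F G

end Braiding

end Day

section Coends

open scoped DayFunctor

variable {V : Type u} [Category.{v} V] [MonoidalCategory V] [SymmetricCategory V]
  [MonoidalClosed V] [HasColimits V]
  {K : Type} [Category.{0} K] [MonoidalCategory K]
  {C : Type} [Category.{0} C] [MonoidalCategory C]

instance opSymmetric {K : Type} [Category.{0} K] [MonoidalCategory K] [SymmetricCategory K] :
    SymmetricCategory Kᵒᵖ where
  symmetry X Y := Quiver.Hom.unop_inj (by simp)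

/-- The functor `(k', k) ↦ D k' ⊗ P k c`. -/
def integrand (D : Kᵒᵖ ⊛⥤ V) (P : K ⥤ C ⊛⥤ V) (c : C) : Kᵒᵖ ⥤ K ⥤ V :=
  D.functor ⋙ curriedTensor V ⋙ (Functor.whiskeringLeft K V V).obj
    (P ⋙ (DayFunctor.equiv C V).functor ⋙ (evaluation C V).obj c)

variable (D : Kᵒᵖ ⊛⥤ V) (P : K ⥤ C ⊛⥤ V)

/-- The coend `∫^k D k ⊗ P k c`. -/
noncomputable def kellyObj (c : C) : V := coend (integrand D P c)

/-- The inclusions into the coend. -/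
noncomputable def preι (k : K) (c : C) :
    D.functor.obj (op k) ⊗ (P.obj k).functor.obj c ⟶ kellyObj D P c :=
  coend.ι (integrand D P c) k

variable {D P}

lemma pre_ext {c : C} {X : V} {f g : kellyObj D P c ⟶ X}
    (h : ∀ k, preι D P k c ≫ f = preι D P k c ≫ g) : f = g :=
  coend.hom_ext h

lemma preι_condition {i j : K} (f : i ⟶ j) (c : C) :
    D.functor.map f.op ▷ (P.obj i).functor.obj c ≫ preι D P i c =
      D.functor.obj (op j) ◁ (P.map f).natTrans.app c ≫ preι D P j c :=
  coend.condition (integrand D P c) f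

/-- Maps out of the coend. -/
noncomputable def preDesc {c : C} {X : V}
    (f : ∀ k : K, D.functor.obj (op k) ⊗ (P.obj k).functor.obj c ⟶ X)
    (hf : ∀ (i j : K) (g : i ⟶ j), D.functor.map g.op ▷ (P.obj i).functor.obj c ≫ f i =
      D.functor.obj (op j) ◁ (P.map g).natTrans.app c ≫ f j) : kellyObj D P c ⟶ X :=
  coend.desc (F := integrand D P c) f (fun i j g => hf i j g)

@[simp]
lemma preι_preDesc {c : C} {X : V}
    (f : ∀ k : K, D.functor.obj (op k) ⊗ (P.obj k).functor.obj c ⟶ X)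
    (hf : ∀ (i j : K) (g : i ⟶ j), D.functor.map g.op ▷ (P.obj i).functor.obj c ≫ f i =
      D.functor.obj (op j) ◁ (P.map g).natTrans.app c ≫ f j) (k : K) :
    preι D P k c ≫ preDesc f hf = f k :=
  coend.ι_desc (F := integrand D P c) f (fun i j g => hf i j g) k

@[simp]
lemma preι_preDesc_assoc : type_of% (reassoc_of% @preι_preDesc) := by
  have h := reassoc_of% @preι_preDesc
  exact @h

lemma kelly_aux {c c' : C} (u : c ⟶ c') (i j : K) (g : i ⟶ j) :
    D.functor.map g.op ▷ (P.obj i).functor.obj c ≫ D.functor.obj (op i) ◁ (P.obj i).functor.map u ≫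
        preι D P i c' =
      D.functor.obj (op j) ◁ (P.map g).natTrans.app c ≫
        D.functor.obj (op j) ◁ (P.obj j).functor.map u ≫ preι D P j c' := by
  rw [← whisker_exchange_assoc, preι_condition, ← MonoidalCategory.whiskerLeft_comp_assoc,
    ← MonoidalCategory.whiskerLeft_comp_assoc, NatTrans.naturality]

variable (D P) in
/-- The functor `c ↦ ∫^k D k ⊗ P k c`. -/
noncomputable def kelly : C ⊛⥤ V where
  functor :=
    { obj := kellyObj D P
      map {c c'} u := preDesc
        (fun k => D.functor.obj (op k) ◁ (P.obj k).functor.map u ≫ preι D P k c') (kelly_aux u)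
      map_id c := by apply pre_ext; simp
      map_comp f g := by apply pre_ext; simp }

variable (D P) in
/-- The inclusions into the coend. -/
noncomputable def kι (k : K) (c : C) :
    D.functor.obj (op k) ⊗ (P.obj k).functor.obj c ⟶ (kelly D P).functor.obj c := preι D P k c

lemma kelly_ext {c : C} {X : V} {f g : (kelly D P).functor.obj c ⟶ X}
    (h : ∀ k, kι D P k c ≫ f = kι D P k c ≫ g) : f = g := pre_ext h

lemma kι_condition {i j : K} (f : i ⟶ j) (c : C) :
    D.functor.map f.op ▷ (P.obj i).functor.obj c ≫ kι D P i c =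
      D.functor.obj (op j) ◁ (P.map f).natTrans.app c ≫ kι D P j c := preι_condition f c

/-- Maps out of the coend. -/
noncomputable def kellyDesc {c : C} {X : V}
    (f : ∀ k : K, D.functor.obj (op k) ⊗ (P.obj k).functor.obj c ⟶ X)
    (hf : ∀ (i j : K) (g : i ⟶ j), D.functor.map g.op ▷ (P.obj i).functor.obj c ≫ f i =
      D.functor.obj (op j) ◁ (P.map g).natTrans.app c ≫ f j) : (kelly D P).functor.obj c ⟶ X :=
  preDesc f hf

@[simp]
lemma kι_kellyDesc {c : C} {X : V}
    (f : ∀ k : K, D.functor.obj (op k) ⊗ (P.obj k).functor.obj c ⟶ X)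
    (hf : ∀ (i j : K) (g : i ⟶ j), D.functor.map g.op ▷ (P.obj i).functor.obj c ≫ f i =
      D.functor.obj (op j) ◁ (P.map g).natTrans.app c ≫ f j) (k : K) :
    kι D P k c ≫ kellyDesc f hf = f k := preι_preDesc f hf k

@[simp]
lemma kι_kellyDesc_assoc : type_of% (reassoc_of% @kι_kellyDesc) := by
  have h := reassoc_of% @kι_kellyDesc
  exact @h

lemma kι_map (k : K) {c c' : C} (u : c ⟶ c') : kι D P k c ≫ (kelly D P).functor.map u =
    D.functor.obj (op k) ◁ (P.obj k).functor.map u ≫ kι D P k c' :=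
  preι_preDesc (fun k => D.functor.obj (op k) ◁ (P.obj k).functor.map u ≫ preι D P k c') (kelly_aux u) k

lemma kι_map_assoc : type_of% (reassoc_of% @kι_map) := by
  have h := reassoc_of% @kι_map
  exact @h

lemma kellyMap_aux {D' : Kᵒᵖ ⊛⥤ V} {P' : K ⥤ C ⊛⥤ V} (d : D ⟶ D') (p : P ⟶ P') (c : C)
    (i j : K) (g : i ⟶ j) :
    D.functor.map g.op ▷ (P.obj i).functor.obj c ≫
        (d.natTrans.app (op i) ⊗ₘ (p.app i).natTrans.app c) ≫ kι D' P' i c =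
      D.functor.obj (op j) ◁ (P.map g).natTrans.app c ≫
        (d.natTrans.app (op j) ⊗ₘ (p.app j).natTrans.app c) ≫ kι D' P' j c := by
  have h1 := congrArg (fun t => DayFunctor.Hom.natTrans t |>.app c) (p.naturality g)
  simp only [DayFunctor.comp_natTrans, NatTrans.comp_app] at h1
  simp only [whiskerRight_comp_tensorHom_assoc, whiskerLeft_comp_tensorHom_assoc,
    NatTrans.naturality, h1, ← tensorHom_comp_whiskerRight_assoc,
    ← tensorHom_comp_whiskerLeft_assoc, kι_condition]

/-- Functoriality of the coend in both variables. -/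
noncomputable def kellyMap {D' : Kᵒᵖ ⊛⥤ V} {P' : K ⥤ C ⊛⥤ V} (d : D ⟶ D') (p : P ⟶ P') :
    kelly D P ⟶ kelly D' P' where
  natTrans :=
    { app c := kellyDesc
        (fun k => (d.natTrans.app (op k) ⊗ₘ (p.app k).natTrans.app c) ≫ kι D' P' k c)
        (kellyMap_aux d p c)
      naturality c c' u := by
        refine kelly_ext fun k => ?_
        rw [kι_map_assoc, kι_kellyDesc, kι_kellyDesc_assoc, Category.assoc, kι_map,
          whiskerLeft_comp_tensorHom_assoc, tensorHom_comp_whiskerLeft_assoc, NatTrans.naturality] }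

lemma kι_kellyMap {D' : Kᵒᵖ ⊛⥤ V} {P' : K ⥤ C ⊛⥤ V} (d : D ⟶ D') (p : P ⟶ P') (k : K) (c : C) :
    kι D P k c ≫ (kellyMap d p).natTrans.app c =
      (d.natTrans.app (op k) ⊗ₘ (p.app k).natTrans.app c) ≫ kι D' P' k c :=
  kι_kellyDesc (fun k => (d.natTrans.app (op k) ⊗ₘ (p.app k).natTrans.app c) ≫ kι D' P' k c)
    (kellyMap_aux d p c) k

lemma kι_kellyMap_assoc : type_of% (reassoc_of% @kι_kellyMap) := by
  have h := reassoc_of% @kι_kellyMap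
  exact @h

lemma kelly_hom_ext {X : C ⊛⥤ V} {f g : kelly D P ⟶ X}
    (h : ∀ k c, kι D P k c ≫ f.natTrans.app c = kι D P k c ≫ g.natTrans.app c) : f = g := by
  ext : 1
  ext c : 2
  exact kelly_ext fun k => h k c

lemma kellyMap_id : kellyMap (𝟙 D) (𝟙 P) = 𝟙 _ := by
  apply kelly_hom_ext
  intro k c
  rw [kι_kellyMap]
  simp

lemma kellyMap_comp {D' D'' : Kᵒᵖ ⊛⥤ V} {P' P'' : K ⥤ C ⊛⥤ V} (d : D ⟶ D') (p : P ⟶ P')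
    (d' : D' ⟶ D'') (p' : P' ⟶ P'') :
    kellyMap d p ≫ kellyMap d' p' = kellyMap (d ≫ d') (p ≫ p') := by
  apply kelly_hom_ext
  intro k c
  rw [DayFunctor.comp_natTrans, NatTrans.comp_app, kι_kellyMap_assoc, kι_kellyMap, kι_kellyMap]
  simp

variable (P) in
/-- The functor `D ↦ (c ↦ ∫^k D k ⊗ P k c)`. -/
@[simps]
noncomputable def kellyFunctor : (Kᵒᵖ ⊛⥤ V) ⥤ (C ⊛⥤ V) where
  obj D := kelly D P
  map d := kellyMap d (𝟙 P)
  map_id D := kellyMap_id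
  map_comp d d' := by rw [kellyMap_comp]; simp

/-! Maps out of a tensor product with a coend. -/

lemma kelly_whiskerLeft_ext {c : C} {X Z : V} {f g : Z ⊗ (kelly D P).functor.obj c ⟶ X}
    (h : ∀ k, Z ◁ kι D P k c ≫ f = Z ◁ kι D P k c ≫ g) : f = g := by
  apply MonoidalClosed.curry_injective
  refine kelly_ext fun k => ?_
  have := congrArg MonoidalClosed.curry (h k)
  rwa [MonoidalClosed.curry_natural_left, MonoidalClosed.curry_natural_left] at this

lemma kelly_whiskerRight_ext {c : C} {X Z : V} {f g : (kelly D P).functor.obj c ⊗ Z ⟶ X}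
    (h : ∀ k, kι D P k c ▷ Z ≫ f = kι D P k c ▷ Z ≫ g) : f = g := by
  rw [← cancel_epi (β_ _ _).hom]
  apply kelly_whiskerLeft_ext
  intro k
  have e := BraidedCategory.braiding_naturality_right Z (kι D P k c)
  calc
    _ = (Z ◁ kι D P k c ≫ (β_ _ _).hom) ≫ f := (Category.assoc _ _ _).symm
    _ = (Z ◁ kι D P k c ≫ (β_ _ _).hom) ≫ g := by rw [e, Category.assoc, h k, Category.assoc]
    _ = _ := Category.assoc _ _ _

/-- Maps out of `Z ⊗ ∫^k D k ⊗ P k c`. -/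
noncomputable def kellyDescLeft {c : C} {X Z : V}
    (f : ∀ k : K, Z ⊗ (D.functor.obj (op k) ⊗ (P.obj k).functor.obj c) ⟶ X)
    (hf : ∀ (i j : K) (g : i ⟶ j), Z ◁ D.functor.map g.op ▷ (P.obj i).functor.obj c ≫ f i =
      Z ◁ D.functor.obj (op j) ◁ (P.map g).natTrans.app c ≫ f j) :
    Z ⊗ (kelly D P).functor.obj c ⟶ X :=
  MonoidalClosed.uncurry (kellyDesc (fun k => MonoidalClosed.curry (f k)) (fun i j g => by
    rw [← MonoidalClosed.curry_natural_left, hf, MonoidalClosed.curry_natural_left]))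

@[simp]
lemma kι_kellyDescLeft {c : C} {X Z : V}
    (f : ∀ k : K, Z ⊗ (D.functor.obj (op k) ⊗ (P.obj k).functor.obj c) ⟶ X)
    (hf : ∀ (i j : K) (g : i ⟶ j), Z ◁ D.functor.map g.op ▷ (P.obj i).functor.obj c ≫ f i =
      Z ◁ D.functor.obj (op j) ◁ (P.map g).natTrans.app c ≫ f j) (k : K) :
    Z ◁ kι D P k c ≫ kellyDescLeft f hf = f k := by
  refine (MonoidalClosed.uncurry_natural_left _ _).symm.trans ?_
  rw [kι_kellyDesc, MonoidalClosed.uncurry_curry]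

@[simp]
lemma kι_kellyDescLeft_assoc : type_of% (reassoc_of% @kι_kellyDescLeft) := by
  have h := reassoc_of% @kι_kellyDescLeft
  exact @h

variable {K' : Type} [Category.{0} K'] [MonoidalCategory K']
  {D' : K'ᵒᵖ ⊛⥤ V} {P' : K' ⥤ C ⊛⥤ V}

lemma kelly_ext₂ {c c' : C} {X : V}
    {f g : (kelly D P).functor.obj c ⊗ (kelly D' P').functor.obj c' ⟶ X}
    (h : ∀ k l, (kι D P k c ⊗ₘ kι D' P' l c') ≫ f = (kι D P k c ⊗ₘ kι D' P' l c') ≫ g) : f = g := by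
  apply kelly_whiskerRight_ext
  intro k
  apply kelly_whiskerLeft_ext
  intro l
  have := h k l
  rw [MonoidalCategory.tensorHom_def', Category.assoc, Category.assoc] at this
  exact this

/-- Maps out of a tensor product of two coends. -/
noncomputable def kellyDesc₂ {c c' : C} {X : V}
    (f : ∀ (k : K) (l : K'), (D.functor.obj (op k) ⊗ (P.obj k).functor.obj c) ⊗
      (D'.functor.obj (op l) ⊗ (P'.obj l).functor.obj c') ⟶ X)
    (hf : ∀ (i j : K) (g : i ⟶ j) (l : K'),
      (D.functor.map g.op ▷ (P.obj i).functor.obj c) ▷ _ ≫ f i l =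
        (D.functor.obj (op j) ◁ (P.map g).natTrans.app c) ▷ _ ≫ f j l)
    (hf' : ∀ (k : K) (i j : K') (g : i ⟶ j),
      _ ◁ (D'.functor.map g.op ▷ (P'.obj i).functor.obj c') ≫ f k i =
        _ ◁ (D'.functor.obj (op j) ◁ (P'.map g).natTrans.app c') ≫ f k j) :
    (kelly D P).functor.obj c ⊗ (kelly D' P').functor.obj c' ⟶ X :=
  (β_ _ _).hom ≫ kellyDescLeft
    (fun k => (β_ _ _).hom ≫ kellyDescLeft (fun l => f k l) (hf' k)) (fun i j g => by
      simp only [BraidedCategory.braiding_naturality_right_assoc]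
      congr 1
      apply kelly_whiskerLeft_ext
      intro l
      rw [whisker_exchange_assoc, whisker_exchange_assoc, kι_kellyDescLeft, kι_kellyDescLeft, hf])

@[simp]
lemma kι_kellyDesc₂ {c c' : C} {X : V}
    (f : ∀ (k : K) (l : K'), (D.functor.obj (op k) ⊗ (P.obj k).functor.obj c) ⊗
      (D'.functor.obj (op l) ⊗ (P'.obj l).functor.obj c') ⟶ X) (hf) (hf') (k : K) (l : K') :
    (kι D P k c ⊗ₘ kι D' P' l c') ≫ kellyDesc₂ f hf hf' = f k l := by
  unfold kellyDesc₂
  refine (BraidedCategory.braiding_naturality_assoc _ _ _).trans ?_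
  rw [MonoidalCategory.tensorHom_def]
  refine (congrArg _ (Category.assoc _ _ _)).trans ?_
  rw [kι_kellyDescLeft, BraidedCategory.braiding_naturality_left_assoc,
    SymmetricCategory.symmetry_assoc, kι_kellyDescLeft]

@[simp]
lemma kι_kellyDesc₂_assoc : type_of% (reassoc_of% @kι_kellyDesc₂) := by
  have h := reassoc_of% @kι_kellyDesc₂
  exact @h

end Coends

section
variable {V : Type u} [Category.{v} V] [MonoidalCategory V] [BraidedCategory V]

lemma tensorμ_whisker₁ {X X' : V} (f : X ⟶ X') (Y Z T : V) :
    f ▷ Y ▷ (Z ⊗ T) ≫ tensorμ X' Y Z T = tensorμ X Y Z T ≫ (f ▷ Z ⊗ₘ 𝟙 (Y ⊗ T)) := by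
  simpa using tensorμ_natural_left f (𝟙 Y) Z T

lemma tensorμ_whisker₁_assoc : type_of% (reassoc_of% @tensorμ_whisker₁) := by
  have h := reassoc_of% @tensorμ_whisker₁
  exact @h

lemma tensorμ_whisker₂ (X : V) {Y Y' : V} (f : Y ⟶ Y') (Z T : V) :
    (X ◁ f) ▷ (Z ⊗ T) ≫ tensorμ X Y' Z T = tensorμ X Y Z T ≫ (𝟙 (X ⊗ Z) ⊗ₘ f ▷ T) := by
  simpa using tensorμ_natural_left (𝟙 X) f Z T

lemma tensorμ_whisker₂_assoc : type_of% (reassoc_of% @tensorμ_whisker₂) := by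
  have h := reassoc_of% @tensorμ_whisker₂
  exact @h

lemma tensorμ_whisker₃ (X Y : V) {Z Z' : V} (f : Z ⟶ Z') (T : V) :
    (X ⊗ Y) ◁ f ▷ T ≫ tensorμ X Y Z' T = tensorμ X Y Z T ≫ (X ◁ f ⊗ₘ 𝟙 (Y ⊗ T)) := by
  simpa using tensorμ_natural_right X Y f (𝟙 T)

lemma tensorμ_whisker₃_assoc : type_of% (reassoc_of% @tensorμ_whisker₃) := by
  have h := reassoc_of% @tensorμ_whisker₃
  exact @h

lemma tensorμ_whisker₄ (X Y Z : V) {T T' : V} (f : T ⟶ T') :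
    (X ⊗ Y) ◁ Z ◁ f ≫ tensorμ X Y Z T' = tensorμ X Y Z T ≫ (𝟙 (X ⊗ Z) ⊗ₘ Y ◁ f) := by
  simpa using tensorμ_natural_right X Y (𝟙 Z) f

lemma tensorμ_whisker₄_assoc : type_of% (reassoc_of% @tensorμ_whisker₄) := by
  have h := reassoc_of% @tensorμ_whisker₄
  exact @h

end

section KellyLax

open scoped DayFunctor
open Functor.LaxMonoidal

variable {V : Type u} [Category.{v} V] [MonoidalCategory V] [SymmetricCategory V]
  [MonoidalClosed V] [HasColimits V]
  {K : Type} [Category.{0} K] [MonoidalCategory K]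
  {C : Type} [Category.{0} C] [MonoidalCategory C]
  (P : K ⥤ C ⊛⥤ V) [P.LaxMonoidal]

/-- The maps `P k c ⊗ P l c' ⟶ P (k ⊗ l) (c ⊗ c')` induced by a lax monoidal structure. -/
noncomputable def pinc (k l : K) (c c' : C) :
    (P.obj k).functor.obj c ⊗ (P.obj l).functor.obj c' ⟶ (P.obj (k ⊗ l)).functor.obj (c ⊗ c') :=
  inc _ _ c c' ≫ (μ P k l).natTrans.app (c ⊗ c')

/-- The map `I ⟶ P 𝟙 𝟙` induced by a lax monoidal structure. -/
noncomputable def pincUnit : 𝟙_ V ⟶ (P.obj (𝟙_ K)).functor.obj (𝟙_ C) :=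
  incUnit V C ≫ (ε P).natTrans.app (𝟙_ C)

lemma pinc_natural (k l : K) {c c' d d' : C} (f : c ⟶ c') (g : d ⟶ d') :
    ((P.obj k).functor.map f ⊗ₘ (P.obj l).functor.map g) ≫ pinc P k l c' d' =
      pinc P k l c d ≫ (P.obj (k ⊗ l)).functor.map (f ⊗ₘ g) := by
  simp [pinc, inc_natural_assoc]

lemma pinc_natural_left {k k' : K} (f : k ⟶ k') (l : K) (c d : C) :
    (P.map f).natTrans.app c ▷ (P.obj l).functor.obj d ≫ pinc P k' l c d =
      pinc P k l c d ≫ (P.map (f ▷ l)).natTrans.app (c ⊗ d) := by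
  rw [pinc, pinc, Category.assoc, ← NatTrans.comp_app, ← DayFunctor.comp_natTrans,
    ← μ_natural_left, DayFunctor.comp_natTrans, NatTrans.comp_app, inc_whiskerRight_assoc]

lemma pinc_natural_right (k : K) {l l' : K} (f : l ⟶ l') (c d : C) :
    (P.obj k).functor.obj c ◁ (P.map f).natTrans.app d ≫ pinc P k l' c d =
      pinc P k l c d ≫ (P.map (k ◁ f)).natTrans.app (c ⊗ d) := by
  rw [pinc, pinc, Category.assoc, ← NatTrans.comp_app, ← DayFunctor.comp_natTrans,
    ← μ_natural_right, DayFunctor.comp_natTrans, NatTrans.comp_app, inc_whiskerLeft_assoc]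

lemma pinc_assoc (k l m : K) (c d e : C) :
    pinc P k l c d ▷ (P.obj m).functor.obj e ≫ pinc P (k ⊗ l) m (c ⊗ d) e ≫
        (P.map (α_ k l m).hom).natTrans.app ((c ⊗ d) ⊗ e) =
      (α_ _ _ _).hom ≫ (P.obj k).functor.obj c ◁ pinc P l m d e ≫ pinc P k (l ⊗ m) c (d ⊗ e) ≫
        (P.obj (k ⊗ l ⊗ m)).functor.map (α_ c d e).inv := by
  have h := congrArg (fun t => DayFunctor.Hom.natTrans t |>.app ((c ⊗ d) ⊗ e))
    (associativity P k l m)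
  simp only [DayFunctor.comp_natTrans, NatTrans.comp_app] at h
  simp only [pinc, comp_whiskerRight, Category.assoc, ← inc_whiskerRight_assoc, h,
    inc_associator_assoc, MonoidalCategory.whiskerLeft_comp, ← inc_whiskerLeft_assoc,
    NatTrans.naturality, NatTrans.naturality_assoc]

lemma pinc_left_unit (k : K) (c : C) :
    pincUnit P ▷ (P.obj k).functor.obj c ≫ pinc P (𝟙_ K) k (𝟙_ C) c ≫
        (P.map (λ_ k).hom).natTrans.app (𝟙_ C ⊗ c) =
      (λ_ _).hom ≫ (P.obj k).functor.map (λ_ c).inv := by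
  have h := congrArg (fun t => DayFunctor.Hom.natTrans t |>.app (𝟙_ C ⊗ c)) (left_unitality P k)
  simp only [DayFunctor.comp_natTrans, NatTrans.comp_app] at h
  simp only [pinc, pincUnit, comp_whiskerRight, Category.assoc, ← inc_whiskerRight_assoc, ← h,
    inc_leftUnitor]

lemma pinc_right_unit (k : K) (c : C) :
    (P.obj k).functor.obj c ◁ pincUnit P ≫ pinc P k (𝟙_ K) c (𝟙_ C) ≫
        (P.map (ρ_ k).hom).natTrans.app (c ⊗ 𝟙_ C) =
      (ρ_ _).hom ≫ (P.obj k).functor.map (ρ_ c).inv := by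
  have h := congrArg (fun t => DayFunctor.Hom.natTrans t |>.app (c ⊗ 𝟙_ C)) (right_unitality P k)
  simp only [DayFunctor.comp_natTrans, NatTrans.comp_app] at h
  simp only [pinc, pincUnit, MonoidalCategory.whiskerLeft_comp, Category.assoc,
    ← inc_whiskerLeft_assoc, ← h, inc_rightUnitor]

section
variable (D D' D'' : Kᵒᵖ ⊛⥤ V)

/-- The maps `D k ⊗ D' l ⟶ (D ⊠ D') (k ⊗ l)` for contravariant functors. -/
noncomputable def dinc (k l : K) : D.functor.obj (op k) ⊗ D'.functor.obj (op l) ⟶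
    (D ⊗ D').functor.obj (op (k ⊗ l)) := inc D D' (op k) (op l)

variable (V K) in
/-- The map `I ⟶ 𝟙 (𝟙)` for contravariant functors. -/
noncomputable def dincUnit : 𝟙_ V ⟶ (𝟙_ (Kᵒᵖ ⊛⥤ V)).functor.obj (op (𝟙_ K)) := incUnit V Kᵒᵖ

lemma dinc_natural_left {k k' : K} (f : k ⟶ k') (l : K) :
    D.functor.map f.op ▷ _ ≫ dinc D D' k l = dinc D D' k' l ≫ (D ⊗ D').functor.map (f ▷ l).op :=
  inc_natural_left D D' f.op (op l)

lemma dinc_natural_right (k : K) {l l' : K} (f : l ⟶ l') :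
    _ ◁ D'.functor.map f.op ≫ dinc D D' k l = dinc D D' k l' ≫ (D ⊗ D').functor.map (k ◁ f).op :=
  inc_natural_right D D' (op k) f.op

lemma dinc_tensorHom {D₁ D₁' : Kᵒᵖ ⊛⥤ V} (f : D ⟶ D₁) (g : D' ⟶ D₁') (k l : K) :
    dinc D D' k l ≫ (f ⊗ₘ g).natTrans.app (op (k ⊗ l)) =
      (f.natTrans.app (op k) ⊗ₘ g.natTrans.app (op l)) ≫ dinc D₁ D₁' k l :=
  inc_tensorHom f g (op k) (op l)

lemma dinc_associator (k l m : K) :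
    dinc D D' k l ▷ D''.functor.obj (op m) ≫ dinc (D ⊗ D') D'' (k ⊗ l) m ≫
      (α_ D D' D'').hom.natTrans.app (op ((k ⊗ l) ⊗ m)) =
    (α_ _ _ _).hom ≫ (D.functor.obj (op k) ◁ dinc D' D'' l m) ≫ dinc D (D' ⊗ D'') k (l ⊗ m) ≫
      (D ⊗ D' ⊗ D'').functor.map (α_ k l m).hom.op :=
  inc_associator D D' D'' (op k) (op l) (op m)

lemma dinc_leftUnitor (k : K) :
    dincUnit V K ▷ D.functor.obj (op k) ≫ dinc (𝟙_ _) D (𝟙_ K) k ≫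
      (λ_ D).hom.natTrans.app (op (𝟙_ K ⊗ k)) =
        (λ_ (D.functor.obj (op k))).hom ≫ D.functor.map (λ_ k).hom.op :=
  inc_leftUnitor D (op k)

lemma dinc_rightUnitor (k : K) :
    D.functor.obj (op k) ◁ dincUnit V K ≫ dinc D (𝟙_ _) k (𝟙_ K) ≫
      (ρ_ D).hom.natTrans.app (op (k ⊗ 𝟙_ K)) =
        (ρ_ (D.functor.obj (op k))).hom ≫ D.functor.map (ρ_ k).hom.op :=
  inc_rightUnitor D (op k)

lemma dinc_hom_ext {D D' H : Kᵒᵖ ⊛⥤ V} {α β : D ⊗ D' ⟶ H}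
    (h : ∀ k l : K, dinc D D' k l ≫ α.natTrans.app (op (k ⊗ l)) =
      dinc D D' k l ≫ β.natTrans.app (op (k ⊗ l))) : α = β :=
  inc_hom_ext fun x y => h x.unop y.unop

/-- The components of `(D ⊙ P) ⊠ (D' ⊙ P) ⟶ (D ⊠ D') ⊙ P`. -/
noncomputable def kellyμComp (k l : K) (c c' : C) :
    (D.functor.obj (op k) ⊗ (P.obj k).functor.obj c) ⊗
      (D'.functor.obj (op l) ⊗ (P.obj l).functor.obj c') ⟶
    (kelly (D ⊗ D') P).functor.obj (c ⊗ c') :=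
  tensorμ _ _ _ _ ≫ (dinc D D' k l ⊗ₘ pinc P k l c c') ≫ kι (D ⊗ D') P (k ⊗ l) (c ⊗ c')

lemma kellyμ_aux (c c' : C) (i j : K) (g : i ⟶ j) (l : K) :
    (D.functor.map g.op ▷ (P.obj i).functor.obj c) ▷ _ ≫ kellyμComp P D D' i l c c' =
      (D.functor.obj (op j) ◁ (P.map g).natTrans.app c) ▷ _ ≫ kellyμComp P D D' j l c c' := by
  unfold kellyμComp
  rw [tensorμ_whisker₁_assoc, tensorμ_whisker₂_assoc,
    tensorHom_comp_tensorHom_assoc, tensorHom_comp_tensorHom_assoc, dinc_natural_left,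
    pinc_natural_left, Category.id_comp, Category.id_comp,
    ← tensorHom_comp_whiskerRight_assoc, kι_condition, tensorHom_comp_whiskerLeft_assoc]

lemma kellyμ_aux' (c c' : C) (k i j : K) (g : i ⟶ j) :
    _ ◁ (D'.functor.map g.op ▷ (P.obj i).functor.obj c') ≫ kellyμComp P D D' k i c c' =
      _ ◁ (D'.functor.obj (op j) ◁ (P.map g).natTrans.app c') ≫ kellyμComp P D D' k j c c' := by
  unfold kellyμComp
  rw [tensorμ_whisker₃_assoc, tensorμ_whisker₄_assoc,
    tensorHom_comp_tensorHom_assoc, tensorHom_comp_tensorHom_assoc, dinc_natural_right,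
    pinc_natural_right, Category.id_comp, Category.id_comp,
    ← tensorHom_comp_whiskerRight_assoc, kι_condition, tensorHom_comp_whiskerLeft_assoc]

lemma kellyμ_natural (c d c' d' : C) (f : c ⟶ d) (g : c' ⟶ d') :
    ((kelly D P).functor.map f ⊗ₘ (kelly D' P).functor.map g) ≫
        kellyDesc₂ (fun k l => kellyμComp P D D' k l d d')
          (kellyμ_aux P D D' d d') (kellyμ_aux' P D D' d d') =
      kellyDesc₂ (fun k l => kellyμComp P D D' k l c c')
          (kellyμ_aux P D D' c c') (kellyμ_aux' P D D' c c') ≫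
        (kelly (D ⊗ D') P).functor.map (f ⊗ₘ g) := by
  apply kelly_ext₂
  intro k l
  rw [kι_kellyDesc₂_assoc, tensorHom_comp_tensorHom_assoc, kι_map, kι_map,
    ← tensorHom_comp_tensorHom_assoc, kι_kellyDesc₂, kellyμComp, kellyμComp, Category.assoc,
    Category.assoc, kι_map, tensorHom_comp_whiskerLeft_assoc, ← pinc_natural, ← id_tensorHom,
    ← id_tensorHom, tensorμ_natural_assoc, tensorHom_comp_tensorHom_assoc]
  simp

/-- The canonical map `(D ⊙ P) ⊠ (D' ⊙ P) ⟶ (D ⊠ D') ⊙ P`. -/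
noncomputable def kellyμ : kelly D P ⊗ kelly D' P ⟶ kelly (D ⊗ D') P :=
  dayDesc (fun c c' => kellyDesc₂ (fun k l => kellyμComp P D D' k l c c')
      (kellyμ_aux P D D' c c') (kellyμ_aux' P D D' c c')) (kellyμ_natural P D D')

lemma kι_kellyμ (k l : K) (c c' : C) :
    (kι D P k c ⊗ₘ kι D' P l c') ≫ inc _ _ c c' ≫ (kellyμ P D D').natTrans.app (c ⊗ c') =
      tensorμ _ _ _ _ ≫ (dinc D D' k l ⊗ₘ pinc P k l c c') ≫
        kι (D ⊗ D') P (k ⊗ l) (c ⊗ c') := by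
  rw [kellyμ, inc_dayDesc, kι_kellyDesc₂, kellyμComp]

lemma kι_kellyμ_assoc : type_of% (reassoc_of% @kι_kellyμ) := by
  have h := reassoc_of% @kι_kellyμ
  exact @h

/-- The canonical map `𝟙 ⟶ 𝟙 ⊙ P`. -/
noncomputable def kellyε : 𝟙_ (C ⊛⥤ V) ⟶ kelly (𝟙_ (Kᵒᵖ ⊛⥤ V)) P :=
  unitDesc ((λ_ _).inv ≫ (dincUnit V K ⊗ₘ pincUnit P) ≫ kι _ P (𝟙_ K) (𝟙_ C))

lemma kellyε_comp : incUnit V C ≫ (kellyε P).natTrans.app (𝟙_ C) =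
    (λ_ _).inv ≫ (dincUnit V K ⊗ₘ pincUnit P) ≫ kι _ P (𝟙_ K) (𝟙_ C) := incUnit_unitDesc _

variable {P} in
lemma kelly_day_ext {D D' : Kᵒᵖ ⊛⥤ V} {X : C ⊛⥤ V} {f g : kelly D P ⊗ kelly D' P ⟶ X}
    (h : ∀ k l c c', (kι D P k c ⊗ₘ kι D' P l c') ≫ inc _ _ c c' ≫ f.natTrans.app (c ⊗ c') =
      (kι D P k c ⊗ₘ kι D' P l c') ≫ inc _ _ c c' ≫ g.natTrans.app (c ⊗ c')) : f = g :=
  inc_hom_ext fun c c' => kelly_ext₂ fun k l => h k l c c'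

variable {P} in
lemma kelly_ext₃ {D D' D'' : Kᵒᵖ ⊛⥤ V} {c c' c'' : C} {X : V}
    {f g : ((kelly D P).functor.obj c ⊗ (kelly D' P).functor.obj c') ⊗
      (kelly D'' P).functor.obj c'' ⟶ X}
    (h : ∀ k l m, ((kι D P k c ⊗ₘ kι D' P l c') ⊗ₘ kι D'' P m c'') ≫ f =
      ((kι D P k c ⊗ₘ kι D' P l c') ⊗ₘ kι D'' P m c'') ≫ g) : f = g := by
  rw [← cancel_epi (β_ _ _).hom]
  apply MonoidalClosed.curry_injective
  apply kelly_ext₂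
  intro k l
  rw [← MonoidalClosed.curry_natural_left, ← MonoidalClosed.curry_natural_left,
    BraidedCategory.braiding_naturality_right_assoc, BraidedCategory.braiding_naturality_right_assoc]
  congr 2
  apply kelly_whiskerLeft_ext
  intro m
  have := h k l m
  rwa [MonoidalCategory.tensorHom_def', Category.assoc, Category.assoc] at this

variable {P} in
lemma kelly_day_ext₃ {D D' D'' : Kᵒᵖ ⊛⥤ V} {X : C ⊛⥤ V}
    {f g : (kelly D P ⊗ kelly D' P) ⊗ kelly D'' P ⟶ X}
    (h : ∀ k l m c c' c'', ((kι D P k c ⊗ₘ kι D' P l c') ⊗ₘ kι D'' P m c'') ≫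
      inc _ _ c c' ▷ _ ≫ inc _ _ (c ⊗ c') c'' ≫ f.natTrans.app ((c ⊗ c') ⊗ c'') =
      ((kι D P k c ⊗ₘ kι D' P l c') ⊗ₘ kι D'' P m c'') ≫
      inc _ _ c c' ▷ _ ≫ inc _ _ (c ⊗ c') c'' ≫ g.natTrans.app ((c ⊗ c') ⊗ c'')) : f = g :=
  inc_hom_ext₃ fun c c' c'' => kelly_ext₃ fun k l m => h k l m c c' c''

end

lemma kι_slide {D : Kᵒᵖ ⊛⥤ V} {X Y : V} {i j : K} (h : i ⟶ j) (c : C)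
    (f : X ⟶ D.functor.obj (op j)) (g : Y ⟶ (P.obj i).functor.obj c) :
    (f ≫ D.functor.map h.op ⊗ₘ g) ≫ kι D P i c =
      (f ⊗ₘ g ≫ (P.map h).natTrans.app c) ≫ kι D P j c := by
  rw [← tensorHom_comp_whiskerRight_assoc, kι_condition, tensorHom_comp_whiskerLeft_assoc]

lemma kι_kellyMap_id {D D' : Kᵒᵖ ⊛⥤ V} (d : D ⟶ D') (k : K) (c : C) :
    kι D P k c ≫ (kellyMap d (𝟙 P)).natTrans.app c = d.natTrans.app (op k) ▷ _ ≫ kι D' P k c := by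
  rw [kι_kellyMap, ← tensorHom_id]
  rfl

lemma kι_kellyMap_id_assoc : type_of% (reassoc_of% @kι_kellyMap_id) := by
  have h := reassoc_of% @kι_kellyMap_id
  exact @h

lemma kellyμ_natural_hom {D₁ D₂ D₁' D₂' : Kᵒᵖ ⊛⥤ V} (d : D₁ ⟶ D₂) (d' : D₁' ⟶ D₂') :
    (kellyMap d (𝟙 P) ⊗ₘ kellyMap d' (𝟙 P)) ≫ kellyμ P D₂ D₂' =
      kellyμ P D₁ D₁' ≫ kellyMap (d ⊗ₘ d') (𝟙 P) := by
  apply kelly_day_ext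
  intro k l c c'
  rw [DayFunctor.comp_natTrans, NatTrans.comp_app, inc_tensorHom_assoc,
    DayFunctor.comp_natTrans, NatTrans.comp_app, kι_kellyμ_assoc,
    tensorHom_comp_tensorHom_assoc, kι_kellyMap, kι_kellyMap, ← tensorHom_comp_tensorHom_assoc,
    kι_kellyμ, kι_kellyMap, tensorHom_comp_tensorHom_assoc, dinc_tensorHom,
    tensorμ_natural_assoc, tensorHom_comp_tensorHom_assoc]
  simp

lemma kellyμ_associativity (D D' D'' : Kᵒᵖ ⊛⥤ V) :
    kellyμ P D D' ▷ kelly D'' P ≫ kellyμ P (D ⊗ D') D'' ≫ kellyMap (α_ D D' D'').hom (𝟙 P) =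
      (α_ _ _ _).hom ≫ kelly D P ◁ kellyμ P D' D'' ≫ kellyμ P D (D' ⊗ D'') := by
  apply kelly_day_ext₃
  intro k l m c c' c''
  simp only [DayFunctor.comp_natTrans, NatTrans.comp_app, inc_whiskerRight_assoc,
    inc_associator_assoc]
  rw [← comp_whiskerRight_assoc, tensorHom_comp_whiskerRight_assoc, kι_kellyμ,
    associator_naturality_assoc]
  simp only [NatTrans.naturality_assoc, NatTrans.naturality, inc_whiskerLeft_assoc]
  rw [tensorHom_comp_whiskerLeft_assoc, tensorHom_comp_whiskerLeft_assoc, Category.assoc, kι_kellyμ]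
  have e1 : (tensorμ (D.functor.obj (op k)) ((P.obj k).functor.obj c) (D'.functor.obj (op l))
      ((P.obj l).functor.obj c') ≫ (dinc D D' k l ⊗ₘ pinc P k l c c') ≫
        kι (D ⊗ D') P (k ⊗ l) (c ⊗ c')) ⊗ₘ kι D'' P m c'' =
      tensorμ _ _ _ _ ▷ _ ≫ (dinc D D' k l ⊗ₘ pinc P k l c c') ▷ _ ≫
        (kι (D ⊗ D') P (k ⊗ l) (c ⊗ c') ⊗ₘ kι D'' P m c'') := by
    simp only [whiskerRight_comp_tensorHom]
  have e2 : kι D P k c ⊗ₘ (tensorμ (D'.functor.obj (op l)) ((P.obj l).functor.obj c')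
      (D''.functor.obj (op m)) ((P.obj m).functor.obj c'') ≫
        (dinc D' D'' l m ⊗ₘ pinc P l m c' c'') ≫ kι (D' ⊗ D'') P (l ⊗ m) (c' ⊗ c'')) =
      _ ◁ tensorμ _ _ _ _ ≫ _ ◁ (dinc D' D'' l m ⊗ₘ pinc P l m c' c'') ≫
        (kι D P k c ⊗ₘ kι (D' ⊗ D'') P (l ⊗ m) (c' ⊗ c'')) := by
    simp only [whiskerLeft_comp_tensorHom]
  rw [e1, e2]
  simp only [Category.assoc]
  rw [kι_kellyμ_assoc, kι_kellyMap_id, kι_kellyμ_assoc, kι_map, tensorμ_natural_left_assoc,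
    tensorμ_natural_right_assoc, tensorHom_comp_tensorHom_assoc, tensorHom_comp_tensorHom_assoc,
    tensorHom_comp_whiskerRight_assoc, tensorHom_comp_whiskerLeft_assoc, Category.assoc,
    Category.assoc, dinc_associator, ← tensor_associativity_assoc, tensorHom_comp_tensorHom_assoc,
    ← pinc_assoc, ← Category.assoc (pinc P k l c c' ▷ _)]
  have e3 := kι_slide P (α_ k l m).hom ((c ⊗ c') ⊗ c'') ((α_ _ _ _).hom ≫
    (D.functor.obj (op k) ◁ dinc D' D'' l m) ≫ dinc D (D' ⊗ D'') k (l ⊗ m))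
    (pinc P k l c c' ▷ (P.obj m).functor.obj c'' ≫ pinc P (k ⊗ l) m (c ⊗ c') c'')
  simp only [Category.assoc] at e3 ⊢
  rw [e3]

lemma leftUnitor_inv_app (F : C ⊛⥤ V) (c : C) : (λ_ F).inv.natTrans.app c =
    (λ_ _).inv ≫ incUnit V C ▷ _ ≫ inc _ _ (𝟙_ C) c ≫ (𝟙_ _ ⊗ F).functor.map (λ_ c).hom := by
  have h1 : (λ_ F).hom.natTrans.app (𝟙_ C ⊗ c) ≫ (λ_ F).inv.natTrans.app (𝟙_ C ⊗ c) = 𝟙 _ := by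
    rw [← NatTrans.comp_app, ← DayFunctor.comp_natTrans]; simp
  have h2 := (λ_ _).inv ≫= inc_leftUnitor F c =≫ ((λ_ F).inv.natTrans.app _ ≫
    (𝟙_ _ ⊗ F).functor.map (λ_ c).hom)
  simp only [Category.assoc, reassoc_of% h1, NatTrans.naturality_assoc, ← Functor.map_comp] at h2
  simp [h2]

lemma rightUnitor_inv_app (F : C ⊛⥤ V) (c : C) : (ρ_ F).inv.natTrans.app c =
    (ρ_ _).inv ≫ _ ◁ incUnit V C ≫ inc _ _ c (𝟙_ C) ≫ (F ⊗ 𝟙_ _).functor.map (ρ_ c).hom := by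
  have h1 : (ρ_ F).hom.natTrans.app (c ⊗ 𝟙_ C) ≫ (ρ_ F).inv.natTrans.app (c ⊗ 𝟙_ C) = 𝟙 _ := by
    rw [← NatTrans.comp_app, ← DayFunctor.comp_natTrans]; simp
  have h2 := (ρ_ _).inv ≫= inc_rightUnitor F c =≫ ((ρ_ F).inv.natTrans.app _ ≫
    (F ⊗ 𝟙_ _).functor.map (ρ_ c).hom)
  simp only [Category.assoc, reassoc_of% h1, NatTrans.naturality_assoc, ← Functor.map_comp] at h2
  simp [h2]

lemma kellyμ_left_unitality (D : Kᵒᵖ ⊛⥤ V) :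
    (λ_ (kelly D P)).hom =
      kellyε P ▷ kelly D P ≫ kellyμ P (𝟙_ _) D ≫ kellyMap (λ_ D).hom (𝟙 P) := by
  rw [← cancel_epi (λ_ (kelly D P)).inv, Iso.inv_hom_id]
  apply kelly_hom_ext
  intro k c
  simp only [DayFunctor.comp_natTrans, NatTrans.comp_app, leftUnitor_inv_app, Category.assoc,
    NatTrans.naturality_assoc, NatTrans.naturality, inc_whiskerRight_assoc]
  rw [← comp_whiskerRight_assoc, kellyε_comp, leftUnitor_inv_naturality_assoc,
    whisker_exchange_assoc]
  have e : ((λ_ (𝟙_ V)).inv ≫ (dincUnit V K ⊗ₘ pincUnit P) ≫ kι (𝟙_ _) P (𝟙_ K) (𝟙_ C)) ▷ _ ≫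
      (kelly (𝟙_ _) P).functor.obj (𝟙_ C) ◁ kι D P k c =
      (λ_ (𝟙_ V)).inv ▷ _ ≫ (dincUnit V K ⊗ₘ pincUnit P) ▷ _ ≫
        (kι (𝟙_ _) P (𝟙_ K) (𝟙_ C) ⊗ₘ kι D P k c) := by
    rw [← MonoidalCategory.tensorHom_def]
    simp only [whiskerRight_comp_tensorHom]
  have e3 := kι_slide P (λ_ k).hom (𝟙_ C ⊗ c) (λ_ (D.functor.obj (op k))).hom
    (pincUnit P ▷ (P.obj k).functor.obj c ≫ pinc P (𝟙_ K) k (𝟙_ C) c)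
  simp only [Category.assoc, pinc_left_unit] at e3
  rw [reassoc_of% e, kι_kellyμ_assoc, kι_kellyMap_id_assoc, tensorμ_natural_left_assoc,
    tensorHom_comp_tensorHom_assoc, tensorHom_comp_whiskerRight_assoc,
    Category.assoc, dinc_leftUnitor, reassoc_of% e3, kι_map, tensorHom_comp_whiskerLeft_assoc,
    Category.assoc, Iso.map_inv_hom_id, Category.comp_id, ← tensor_left_unitality_assoc,
    Iso.inv_hom_id_assoc]
  exact Category.comp_id _

lemma kellyμ_right_unitality (D : Kᵒᵖ ⊛⥤ V) :
    (ρ_ (kelly D P)).hom =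
      kelly D P ◁ kellyε P ≫ kellyμ P D (𝟙_ _) ≫ kellyMap (ρ_ D).hom (𝟙 P) := by
  rw [← cancel_epi (ρ_ (kelly D P)).inv, Iso.inv_hom_id]
  apply kelly_hom_ext
  intro k c
  simp only [DayFunctor.comp_natTrans, NatTrans.comp_app, rightUnitor_inv_app, Category.assoc,
    NatTrans.naturality_assoc, NatTrans.naturality, inc_whiskerLeft_assoc]
  rw [← MonoidalCategory.whiskerLeft_comp_assoc, kellyε_comp, rightUnitor_inv_naturality_assoc,
    ← whisker_exchange_assoc]
  have e : _ ◁ ((λ_ (𝟙_ V)).inv ≫ (dincUnit V K ⊗ₘ pincUnit P) ≫ kι (𝟙_ _) P (𝟙_ K) (𝟙_ C)) ≫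
      kι D P k c ▷ (kelly (𝟙_ _) P).functor.obj (𝟙_ C) =
      _ ◁ (λ_ (𝟙_ V)).inv ≫ _ ◁ (dincUnit V K ⊗ₘ pincUnit P) ≫
        (kι D P k c ⊗ₘ kι (𝟙_ _) P (𝟙_ K) (𝟙_ C)) := by
    rw [← MonoidalCategory.tensorHom_def']
    simp only [whiskerLeft_comp_tensorHom]
  have e3 := kι_slide P (ρ_ k).hom (c ⊗ 𝟙_ C) (ρ_ (D.functor.obj (op k))).hom
    ((P.obj k).functor.obj c ◁ pincUnit P ≫ pinc P k (𝟙_ K) c (𝟙_ C))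
  simp only [Category.assoc, pinc_right_unit] at e3
  rw [reassoc_of% e, kι_kellyμ_assoc, kι_kellyMap_id_assoc, tensorμ_natural_right_assoc,
    tensorHom_comp_tensorHom_assoc, tensorHom_comp_whiskerRight_assoc,
    Category.assoc, dinc_rightUnitor, reassoc_of% e3, kι_map, tensorHom_comp_whiskerLeft_assoc,
    Category.assoc, Iso.map_inv_hom_id, Category.comp_id, ← tensor_right_unitality_assoc,
    Iso.inv_hom_id_assoc]
  exact Category.comp_id _

noncomputable instance : (kellyFunctor P).LaxMonoidal where
  ε := kellyε P
  μ D D' := kellyμ P D D'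
  μ_natural_left {D₁ D₂} d D' := by
    have := kellyμ_natural_hom P d (𝟙 D')
    rw [kellyMap_id, tensorHom_id, tensorHom_id] at this
    exact this
  μ_natural_right {D₁ D₂} D d := by
    have := kellyμ_natural_hom P (𝟙 D) d
    rw [kellyMap_id, id_tensorHom, id_tensorHom] at this
    exact this
  associativity D D' D'' := kellyμ_associativity P D D' D''
  left_unitality D := kellyμ_left_unitality P D
  right_unitality D := kellyμ_right_unitality P D

end KellyLax

section KellyBraided

open scoped DayFunctor
open Functor.LaxMonoidal

variable {V : Type u} [Category.{v} V] [MonoidalCategory V] [SymmetricCategory V]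
  [MonoidalClosed V] [HasColimits V]
  {K : Type} [Category.{0} K] [MonoidalCategory K] [SymmetricCategory K]
  {C : Type} [Category.{0} C] [MonoidalCategory C] [SymmetricCategory C]
  (P : K ⥤ C ⊛⥤ V) [P.LaxBraided]


lemma inc_braiding (F G : C ⊛⥤ V) (x y : C) :
    inc F G x y ≫ (β_ F G).hom.natTrans.app (x ⊗ y) =
      (β_ (F.functor.obj x) (G.functor.obj y)).hom ≫ inc G F y x ≫
        (G ⊗ F).functor.map (β_ y x).hom := inc_dayBraiding F G x y

lemma inc_braiding_assoc : type_of% (reassoc_of% @inc_braiding) := by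
  have h := reassoc_of% @inc_braiding
  exact @h

lemma dinc_braiding (D D' : Kᵒᵖ ⊛⥤ V) (k l : K) :
    dinc D D' k l ≫ (β_ D D').hom.natTrans.app (op (k ⊗ l)) =
      (β_ (D.functor.obj (op k)) (D'.functor.obj (op l))).hom ≫ dinc D' D l k ≫
        (D' ⊗ D).functor.map (β_ k l).hom.op := inc_dayBraiding D D' (op k) (op l)

lemma pinc_braiding (k l : K) (c c' : C) :
    pinc P k l c c' ≫ (P.map (β_ k l).hom).natTrans.app (c ⊗ c') =
      (β_ _ _).hom ≫ pinc P l k c' c ≫ (P.obj (l ⊗ k)).functor.map (β_ c' c).hom := by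
  have h := congrArg (fun t => DayFunctor.Hom.natTrans t |>.app (c ⊗ c'))
    (Functor.LaxBraided.braided (F := P) k l)
  simp only [DayFunctor.comp_natTrans, NatTrans.comp_app] at h
  simp only [pinc, Category.assoc, h, inc_braiding_assoc, NatTrans.naturality]

lemma tensorμ_braiding (X Y Z T : V) :
    tensorμ X Y Z T ≫ ((β_ X Z).hom ⊗ₘ (β_ Y T).hom) = (β_ _ _).hom ≫ tensorμ Z T X Y := by
  simp [tensorμ, SymmetricCategory.braiding_swap_eq_inv_braiding T X,
    MonoidalCategory.tensorHom_def]

noncomputable instance : (kellyFunctor P).LaxBraided where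
  braided D D' := by
    apply kelly_day_ext
    intro k l c c'
    change _ ≫ _ ≫ (kellyμ P D D' ≫ kellyMap (β_ D D').hom (𝟙 P)).natTrans.app _ =
      _ ≫ _ ≫ ((β_ (kelly D P) (kelly D' P)).hom ≫ kellyμ P D' D).natTrans.app _
    have e3 := kι_slide P (β_ k l).hom (c ⊗ c') ((β_ _ _).hom ≫ dinc D' D l k)
      (pinc P k l c c')
    simp only [Category.assoc] at e3
    rw [DayFunctor.comp_natTrans, NatTrans.comp_app, DayFunctor.comp_natTrans, NatTrans.comp_app,
      kι_kellyμ_assoc, kι_kellyMap_id, tensorHom_comp_whiskerRight_assoc, dinc_braiding, e3,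
      pinc_braiding, inc_braiding_assoc, NatTrans.naturality,
      BraidedCategory.braiding_naturality_assoc, kι_kellyμ_assoc, kι_map,
      tensorHom_comp_whiskerLeft_assoc, ← tensorHom_comp_tensorHom_assoc,
      reassoc_of% tensorμ_braiding]

end KellyBraided

namespace Pointed

variable {s : SeqKind} {W : Type u} [Category.{v} W] [MonoidalCategory W]

/-- The tensor powers of a morphism. -/
def powHom {E F : Pointed s W} (f : E ⟶ F) : (k : ℕ) → (E.pow k ⟶ F.pow k)
  | 0 => 𝟙 _
  | k + 1 => powHom f k ⊗ₘ f.hom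

lemma powHom_succ {E F : Pointed s W} (f : E ⟶ F) (k : ℕ) :
    powHom f (k + 1) = powHom f k ⊗ₘ f.hom := rfl

lemma powHom_id (E : Pointed s W) (k : ℕ) : powHom (𝟙 E) k = 𝟙 _ := by
  induction k with
  | zero => rfl
  | succ k ih => rw [powHom_succ, ih]; simp

lemma powHom_comp {E F G : Pointed s W} (f : E ⟶ F) (g : F ⟶ G) (k : ℕ) :
    powHom (f ≫ g) k = powHom f k ≫ powHom g k := by
  induction k with
  | zero => exact (Category.comp_id _).symm
  | succ k ih => rw [powHom_succ, ih, powHom_succ, powHom_succ, tensorHom_comp_tensorHom]; rfl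

variable [SymmetricCategory W]

lemma powMap_powHom {E F : Pointed s W} (f : E ⟶ F) {k l : ℕ} (g : (⟨k⟩ : Idx s) ⟶ ⟨l⟩) :
    E.powMap k l g ≫ powHom f l = powHom f k ≫ F.powMap k l g := by
  let φ : HomOver id (𝟭 W) E F := ⟨f.hom, fun hs => by simpa using f.base_hom hs⟩
  have e : ∀ k, φ.pow k = powHom f k := fun k => by
    induction k with
    | zero => rfl
    | succ k ih => rw [HomOver.pow_succ, ih, powHom_succ]; simp [φ]
  have := φ.powMap_pow k l g
  rw [e, e] at this
  exact this

/-- The tensor powers of a morphism form a natural transformation. -/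
@[simps]
noncomputable def powFunctorMap {E F : Pointed s W} (f : E ⟶ F) :
    E.powFunctor ⟶ F.powFunctor where
  app a := powHom f a.n
  naturality _ _ g := powMap_powHom f g

lemma powFunctorMap_id (E : Pointed s W) : powFunctorMap (𝟙 E) = 𝟙 _ := by
  ext a; exact E.powHom_id a.n

lemma powFunctorMap_comp {E F G : Pointed s W} (f : E ⟶ F) (g : F ⟶ G) :
    powFunctorMap (f ≫ g) = powFunctorMap f ≫ powFunctorMap g := by
  ext a; exact powHom_comp f g a.n

end Pointed

section

open scoped DayFunctor
open Functor.LaxMonoidal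

variable (s : SeqKind) (V : Type u) [Category.{v} V] [MonoidalCategory V]

/-- `Σ`-sequences (`s = sigma`) and `Λ`-objects (`s = lambda`) in `V`: functors `Σᵒᵖ ⥤ V`
and `Λᵒᵖ ⥤ V`, with the Day convolution as tensor product. -/
abbrev Seq := (Idx s)ᵒᵖ ⊛⥤ V

variable [SymmetricCategory V] [MonoidalClosed V] [HasColimits V]

/-- `Σ`-sequences (`s = sigma`) and `Λ`-sequences (`s = lambda`) in `V`. A `Λ`-sequence is a
`Λ`-object together with a map from the unit of the Day convolution, that is, a map `I ⟶ D 0`. -/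
abbrev BSeq := Pointed s (Seq s V)

variable {s V}

/-- The Kelly product `(D ⊙ E) n = ∫^k D k ⊗ E^{⊠ k} n`, where the first variable needs no base
map. -/
noncomputable def odot (D : Seq s V) (E : BSeq s V) : Seq s V := kelly D E.powFunctor

/-- Functoriality of the Kelly product. -/
noncomputable def odotMap {D D' : Seq s V} {E E' : BSeq s V} (d : D ⟶ D') (e : E ⟶ E') :
    odot D E ⟶ odot D' E' := kellyMap d (Pointed.powFunctorMap e)

lemma odotMap_id (D : Seq s V) (E : BSeq s V) : odotMap (𝟙 D) (𝟙 E) = 𝟙 _ := by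
  unfold odotMap
  rw [Pointed.powFunctorMap_id, kellyMap_id]
  rfl

lemma odotMap_comp {D D' D'' : Seq s V} {E E' E'' : BSeq s V} (d : D ⟶ D') (e : E ⟶ E')
    (d' : D' ⟶ D'') (e' : E' ⟶ E'') :
    odotMap d e ≫ odotMap d' e' = odotMap (d ≫ d') (e ≫ e') := by
  unfold odotMap
  rw [Pointed.powFunctorMap_comp]
  exact kellyMap_comp _ _ _ _

lemma odotMap_comp_assoc : type_of% (reassoc_of% @odotMap_comp) := by
  have h := reassoc_of% @odotMap_comp
  exact @h

/-- The inclusions `D k ⊗ E^{⊠ k} n ⟶ (D ⊙ E) n`. -/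
noncomputable def odotι (D : Seq s V) (E : BSeq s V) (k : Idx s) (n : (Idx s)ᵒᵖ) :
    D.functor.obj (op k) ⊗ (E.pow k.n).functor.obj n ⟶ (odot D E).functor.obj n :=
  kι D E.powFunctor k n

/-- The functor `- ⊙ E`. -/
noncomputable abbrev odotFunctor (E : BSeq s V) : Seq s V ⥤ Seq s V := kellyFunctor E.powFunctor

/-- The Kelly product of two `Λ`-sequences, with the base map `I_0 ⟶ I_0 ⊙ E ⟶ D ⊙ E`. -/
@[reducible]
noncomputable def bodot (D E : BSeq s V) : BSeq s V where
  X := odot D.X E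
  base h := ε (odotFunctor E) ≫ (odotFunctor E).map (D.base h)

/-- The canonical maps `(E ⊙ F)^{⊠ k} ⟶ E^{⊠ k} ⊙ F`. -/
noncomputable def powOdot (E F : BSeq s V) :
    Pointed.HomOver id (odotFunctor F) (bodot E F) E where
  hom := 𝟙 _
  base_hom h := Category.comp_id _

lemma powOdot_hom (E F : BSeq s V) : (powOdot E F).hom = 𝟙 _ := rfl

/-- The map `D ⊙ E ⟶ D' ⊙ E` induced by `D ⟶ D'`. -/
noncomputable def odotWhisker {D D' : Seq s V} (d : D ⟶ D') (E : BSeq s V) :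
    odot D E ⟶ odot D' E := (odotFunctor E).map d

lemma odotWhisker_eq {D D' : Seq s V} (d : D ⟶ D') (E : BSeq s V) :
    odotWhisker d E = odotMap d (𝟙 E) := by
  unfold odotMap
  rw [Pointed.powFunctorMap_id]
  rfl

/-- The canonical map `(E ⊙ F)^{⊠ k} ⟶ E^{⊠ k} ⊙ F`. -/
noncomputable def powOdotHom (E F : BSeq s V) (k : ℕ) :
    (bodot E F).pow k ⟶ odot (E.pow k) F := (powOdot E F).pow k

lemma powOdotHom_natural (E F : BSeq s V) {k l : ℕ} (g : (⟨k⟩ : Idx s) ⟶ ⟨l⟩) :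
    (bodot E F).powMap k l g ≫ powOdotHom E F l =
      powOdotHom E F k ≫ odotWhisker (E.powMap k l g) F :=
  (powOdot E F).powMap_pow k l g

section assoc

variable (D : Seq s V) (E F : BSeq s V)

lemma odotι_map (k : Idx s) {n n' : (Idx s)ᵒᵖ} (u : n ⟶ n') :
    odotι D E k n ≫ (odot D E).functor.map u =
      D.functor.obj (op k) ◁ (E.pow k.n).functor.map u ≫ odotι D E k n' :=
  kι_map (D := D) (P := E.powFunctor) k u

lemma odotι_map_assoc : type_of% (reassoc_of% @odotι_map) := by
  have h := reassoc_of% @odotι_map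
  exact @h

lemma odotι_condition {i j : Idx s} (g : i ⟶ j) (n : (Idx s)ᵒᵖ) :
    D.functor.map g.op ▷ (E.pow i.n).functor.obj n ≫ odotι D E i n =
      D.functor.obj (op j) ◁ (E.powMap i.n j.n g).natTrans.app n ≫ odotι D E j n :=
  kι_condition (D := D) (P := E.powFunctor) g n

lemma odot_ext {n : (Idx s)ᵒᵖ} {X : V} {f g : (odot D E).functor.obj n ⟶ X}
    (h : ∀ k, odotι D E k n ≫ f = odotι D E k n ≫ g) : f = g := kelly_ext h

/-- Maps out of `(D ⊙ E) n`. -/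
noncomputable def odotDesc {n : (Idx s)ᵒᵖ} {X : V}
    (f : ∀ k : Idx s, D.functor.obj (op k) ⊗ (E.pow k.n).functor.obj n ⟶ X)
    (hf : ∀ (i j : Idx s) (g : i ⟶ j), D.functor.map g.op ▷ (E.pow i.n).functor.obj n ≫ f i =
      D.functor.obj (op j) ◁ (E.powMap i.n j.n g).natTrans.app n ≫ f j) :
    (odot D E).functor.obj n ⟶ X := kellyDesc (D := D) (P := E.powFunctor) f hf

lemma odotι_odotDesc {n : (Idx s)ᵒᵖ} {X : V}
    (f : ∀ k : Idx s, D.functor.obj (op k) ⊗ (E.pow k.n).functor.obj n ⟶ X)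
    (hf : ∀ (i j : Idx s) (g : i ⟶ j), D.functor.map g.op ▷ (E.pow i.n).functor.obj n ≫ f i =
      D.functor.obj (op j) ◁ (E.powMap i.n j.n g).natTrans.app n ≫ f j) (k : Idx s) :
    odotι D E k n ≫ odotDesc D E f hf = f k := kι_kellyDesc (D := D) (P := E.powFunctor) f hf k

lemma odotι_odotDesc_assoc : type_of% (reassoc_of% @odotι_odotDesc) := by
  have h := reassoc_of% @odotι_odotDesc
  exact @h

lemma odot_whiskerLeft_ext {n : (Idx s)ᵒᵖ} {X Z : V} {f g : Z ⊗ (odot D E).functor.obj n ⟶ X}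
    (h : ∀ k, Z ◁ odotι D E k n ≫ f = Z ◁ odotι D E k n ≫ g) : f = g := kelly_whiskerLeft_ext h

lemma odotι_odotWhisker {D D' : Seq s V} (d : D ⟶ D') (E : BSeq s V) (k : Idx s)
    (n : (Idx s)ᵒᵖ) : odotι D E k n ≫ (odotWhisker d E).natTrans.app n =
      d.natTrans.app (op k) ▷ _ ≫ odotι D' E k n :=
  kι_kellyMap_id E.powFunctor d k n

lemma odotι_odotWhisker_assoc : type_of% (reassoc_of% @odotι_odotWhisker) := by
  have h := reassoc_of% @odotι_odotWhisker
  exact @h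

/-- The component of `assocComp` at `l`. -/
noncomputable def assocComp₂ (k l : Idx s) (n : (Idx s)ᵒᵖ) :
    D.functor.obj (op k) ⊗ ((E.pow k.n).functor.obj (op l) ⊗ (F.pow l.n).functor.obj n) ⟶
      (odot (odot D E) F).functor.obj n :=
  (α_ _ _ _).inv ≫ odotι D E k (op l) ▷ (F.pow l.n).functor.obj n ≫ odotι (odot D E) F l n

lemma assocComp₂_condition (k : Idx s) (n : (Idx s)ᵒᵖ) (i j : Idx s) (g : i ⟶ j) :
    D.functor.obj (op k) ◁ (E.pow k.n).functor.map g.op ▷ (F.pow i.n).functor.obj n ≫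
        assocComp₂ D E F k i n =
      D.functor.obj (op k) ◁ (E.pow k.n).functor.obj (op j) ◁ (F.powMap i.n j.n g).natTrans.app n ≫
        assocComp₂ D E F k j n := by
  have h1 := odotι_map D E k g.op
  have h2 := odotι_condition (odot D E) F g n
  unfold assocComp₂
  rw [associator_inv_naturality_middle_assoc, ← comp_whiskerRight_assoc, ← h1,
    comp_whiskerRight_assoc, h2, associator_inv_naturality_right_assoc, whisker_exchange_assoc]

/-- The map `D k ⊗ (E^{⊠ k} ⊙ F) n ⟶ ((D ⊙ E) ⊙ F) n`. -/
noncomputable def assocComp (k : Idx s) (n : (Idx s)ᵒᵖ) :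
    D.functor.obj (op k) ⊗ (odot (E.pow k.n) F).functor.obj n ⟶
      (odot (odot D E) F).functor.obj n :=
  kellyDescLeft (D := E.pow k.n) (P := F.powFunctor) (fun l => assocComp₂ D E F k l n)
    (assocComp₂_condition D E F k n)

lemma kι_assocComp (k l : Idx s) (n : (Idx s)ᵒᵖ) :
    D.functor.obj (op k) ◁ odotι (E.pow k.n) F l n ≫ assocComp D E F k n =
      assocComp₂ D E F k l n :=
  kι_kellyDescLeft (D := E.pow k.n) (P := F.powFunctor) (fun l => assocComp₂ D E F k l n)
    (assocComp₂_condition D E F k n) l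

lemma assocComp_condition {i j : Idx s} (g : i ⟶ j) (n : (Idx s)ᵒᵖ) :
    D.functor.map g.op ▷ (odot (E.pow i.n) F).functor.obj n ≫ assocComp D E F i n =
      D.functor.obj (op j) ◁ (odotWhisker (E.powMap i.n j.n g) F).natTrans.app n ≫
        assocComp D E F j n := by
  apply odot_whiskerLeft_ext
  intro l
  have h1 := odotι_condition D E g (op l)
  have h2 := odotι_odotWhisker (E.powMap i.n j.n g) F l n
  rw [whisker_exchange_assoc, kι_assocComp, ← MonoidalCategory.whiskerLeft_comp_assoc, h2,
    MonoidalCategory.whiskerLeft_comp_assoc, kι_assocComp]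
  unfold assocComp₂
  rw [associator_inv_naturality_left_assoc, ← comp_whiskerRight_assoc, h1,
    comp_whiskerRight_assoc, associator_inv_naturality_middle_assoc]

lemma assocComp_naturality (k : Idx s) {n n' : (Idx s)ᵒᵖ} (u : n ⟶ n') :
    D.functor.obj (op k) ◁ (odot (E.pow k.n) F).functor.map u ≫ assocComp D E F k n' =
      assocComp D E F k n ≫ (odot (odot D E) F).functor.map u := by
  apply odot_whiskerLeft_ext
  intro l
  have h1 := odotι_map (E.pow k.n) F l u
  have h2 := odotι_map (odot D E) F l u
  rw [reassoc_of% (kι_assocComp D E F k l n), ← MonoidalCategory.whiskerLeft_comp_assoc, h1,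
    MonoidalCategory.whiskerLeft_comp_assoc, kι_assocComp]
  unfold assocComp₂
  rw [Category.assoc, Category.assoc, h2, ← whisker_exchange_assoc,
    associator_inv_naturality_right_assoc]

/-- The component of `odotAssoc` at `k`. -/
noncomputable def odotAssocComp (n : (Idx s)ᵒᵖ) (k : Idx s) :
    D.functor.obj (op k) ⊗ ((bodot E F).pow k.n).functor.obj n ⟶
      (odot (odot D E) F).functor.obj n :=
  D.functor.obj (op k) ◁ (powOdotHom E F k.n).natTrans.app n ≫ assocComp D E F k n

lemma odotAssocComp_condition (n : (Idx s)ᵒᵖ) (i j : Idx s) (g : i ⟶ j) :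
    D.functor.map g.op ▷ ((bodot E F).pow i.n).functor.obj n ≫ odotAssocComp D E F n i =
      D.functor.obj (op j) ◁ ((bodot E F).powMap i.n j.n g).natTrans.app n ≫
        odotAssocComp D E F n j := by
  have h := congrArg (fun t => DayFunctor.Hom.natTrans t |>.app n) (powOdotHom_natural E F g)
  simp only [DayFunctor.comp_natTrans, NatTrans.comp_app] at h
  unfold odotAssocComp
  rw [← whisker_exchange_assoc, ← MonoidalCategory.whiskerLeft_comp_assoc, h,
    MonoidalCategory.whiskerLeft_comp_assoc, assocComp_condition]

lemma odotAssoc_naturality {n n' : (Idx s)ᵒᵖ} (u : n ⟶ n') :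
    (odot D (bodot E F)).functor.map u ≫
        odotDesc D (bodot E F) (odotAssocComp D E F n') (odotAssocComp_condition D E F n') =
      odotDesc D (bodot E F) (odotAssocComp D E F n) (odotAssocComp_condition D E F n) ≫
      (odot (odot D E) F).functor.map u := by
  apply odot_ext
  intro k
  have h2 := (powOdotHom E F k.n).natTrans.naturality u
  rw [odotι_map_assoc, odotι_odotDesc, odotι_odotDesc_assoc]
  unfold odotAssocComp
  rw [Category.assoc, ← assocComp_naturality, ← MonoidalCategory.whiskerLeft_comp_assoc, h2,
    MonoidalCategory.whiskerLeft_comp_assoc]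

/-- The associativity isomorphism `D ⊙ (E ⊙ F) ⟶ (D ⊙ E) ⊙ F`, given on `D k ⊗ (E ⊙ F)^{⊠ k}` by
the canonical maps `(E ⊙ F)^{⊠ k} ⟶ E^{⊠ k} ⊙ F`. -/
noncomputable def odotAssoc : odot D (bodot E F) ⟶ odot (odot D E) F where
  natTrans :=
    { app n := odotDesc D (bodot E F) (odotAssocComp D E F n) (odotAssocComp_condition D E F n)
      naturality _ _ u := odotAssoc_naturality D E F u }

lemma odotι_odotAssoc (k : Idx s) (n : (Idx s)ᵒᵖ) :
    odotι D (bodot E F) k n ≫ (odotAssoc D E F).natTrans.app n =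
      D.functor.obj (op k) ◁ (powOdotHom E F k.n).natTrans.app n ≫ assocComp D E F k n :=
  odotι_odotDesc D (bodot E F) (odotAssocComp D E F n) (odotAssocComp_condition D E F n) k

lemma odotι_odotAssoc_assoc : type_of% (reassoc_of% @odotι_odotAssoc) := by
  have h := reassoc_of% @odotι_odotAssoc
  exact @h

end assoc

end

section

open scoped DayFunctor
open Functor.LaxMonoidal

variable (s : SeqKind) (V : Type u) [Category.{v} V] [MonoidalCategory V]
  [SymmetricCategory V] [MonoidalClosed V] [HasColimits V]

/-- The sequence `n ↦ ∐_{n ⟶ 1} I`. -/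
noncomputable def unitSeq : Seq s V where
  functor :=
    { obj n := ∐ fun _ : (n.unop ⟶ (⟨1⟩ : Idx s)) => 𝟙_ V
      map u := Sigma.desc fun f => Sigma.ι (fun _ => 𝟙_ V) (u.unop ≫ f)
      map_id n := by ext f; simp
      map_comp u w := by ext f; simp }

variable {s V}

/-- The inclusion of the summand of `f : n ⟶ 1` in `unitSeq n`. -/
noncomputable def unitSeqι {n : Idx s} (f : n ⟶ ⟨1⟩) : 𝟙_ V ⟶ (unitSeq s V).functor.obj (op n) :=
  Sigma.ι (fun _ : (n ⟶ (⟨1⟩ : Idx s)) => 𝟙_ V) f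

lemma unitSeqι_map' {n m : (Idx s)ᵒᵖ} (u : n ⟶ m) (f : n.unop ⟶ ⟨1⟩) :
    unitSeqι (V := V) f ≫ (unitSeq s V).functor.map u = unitSeqι (u.unop ≫ f) :=
  Sigma.ι_desc _ _

lemma unitSeqι_map {n m : Idx s} (u : m ⟶ n) (f : n ⟶ ⟨1⟩) :
    unitSeqι (V := V) f ≫ (unitSeq s V).functor.map u.op = unitSeqι (u ≫ f) :=
  Sigma.ι_desc _ _

lemma unitSeq_ext {n : (Idx s)ᵒᵖ} {X : V} {f g : (unitSeq s V).functor.obj n ⟶ X}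
    (h : ∀ a : n.unop ⟶ ⟨1⟩, unitSeqι a ≫ f = unitSeqι a ≫ g) : f = g :=
  Sigma.hom_ext _ _ h

/-- Maps out of `unitSeq n`. -/
noncomputable def unitSeqDesc {n : Idx s} {X : V} (f : (n ⟶ (⟨1⟩ : Idx s)) → (𝟙_ V ⟶ X)) :
    (unitSeq s V).functor.obj (op n) ⟶ X := Sigma.desc f

lemma unitSeqι_desc {n : Idx s} {X : V} (f : (n ⟶ (⟨1⟩ : Idx s)) → (𝟙_ V ⟶ X)) (a) :
    unitSeqι a ≫ unitSeqDesc f = f a := Sigma.ι_desc _ _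

/-- The based injection `{0} → {0, 1}`. -/
def Idx.zeroOne (h : s = .lambda) : (⟨0⟩ : Idx s) ⟶ ⟨1⟩ :=
  ⟨Fin.elim0, fun i => i.elim0, fun h' => by rw [h] at h'; cases h'⟩

variable (V) in
/-- The base map of the unit `I_1`: the inclusion of the only summand for `n = 0`. -/
noncomputable def unitBase (h : s = .lambda) : 𝟙_ (Seq s V) ⟶ unitSeq s V :=
  unitDesc (unitSeqι (Idx.zeroOne h))

lemma incUnit_unitBase (h : s = .lambda) :
    incUnit V (Idx s)ᵒᵖ ≫ (unitBase V h).natTrans.app (op (⟨0⟩ : Idx s)) =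
      unitSeqι (Idx.zeroOne h) := incUnit_unitDesc (F := unitSeq s V) _

variable (s V) in
/-- The unit `I_1` of the Kelly product: `n ↦ ∐_{n ⟶ 1} I`, with the base map given by the
inclusion of the only summand for `n = 0`. -/
@[reducible]
noncomputable def unitB : BSeq s V where
  X := unitSeq s V
  base h := unitBase V h

/-- The left unit isomorphism `E ⟶ I_1 ⊙ E`. -/
noncomputable def odotLeft (E : BSeq s V) : E.X ⟶ odot (unitSeq s V) E where
  natTrans :=
    { app n := (λ_ _).inv ≫
        (unitSeqι (𝟙 (⟨1⟩ : Idx s)) ⊗ₘ (λ_ E.X).inv.natTrans.app n) ≫ odotι (unitSeq s V) E ⟨1⟩ n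
      naturality n n' u := by
        rw [leftUnitor_inv_naturality_assoc, Category.assoc, Category.assoc, odotι_map,
          whiskerLeft_comp_tensorHom_assoc, tensorHom_comp_whiskerLeft_assoc, NatTrans.naturality] }

lemma odotLeft_app (E : BSeq s V) (n : (Idx s)ᵒᵖ) : (odotLeft E).natTrans.app n = (λ_ _).inv ≫
    (unitSeqι (𝟙 (⟨1⟩ : Idx s)) ⊗ₘ (λ_ E.X).inv.natTrans.app n) ≫ odotι (unitSeq s V) E ⟨1⟩ n := rfl

/-- The map `I ⟶ (E^{⊠ n}) n` induced by a map `I ⟶ E 1`. -/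
noncomputable def powPt (E : BSeq s V) (x : 𝟙_ V ⟶ E.X.functor.obj (op ⟨1⟩)) :
    (n : ℕ) → (𝟙_ V ⟶ (E.pow n).functor.obj (op ⟨n⟩))
  | 0 => incUnit V (Idx s)ᵒᵖ
  | n + 1 => (λ_ _).inv ≫ (powPt E x n ⊗ₘ x) ≫ inc (E.pow n) E.X (op ⟨n⟩) (op ⟨1⟩)

lemma powPt_succ (E : BSeq s V) (x : 𝟙_ V ⟶ E.X.functor.obj (op ⟨1⟩)) (n : ℕ) :
    powPt E x (n + 1) =
      (λ_ _).inv ≫ (powPt E x n ⊗ₘ x) ≫ inc (E.pow n) E.X (op ⟨n⟩) (op ⟨1⟩) := rfl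

/-- The right unit isomorphism `D n ⟶ (D ⊙ I_1) n`. -/
noncomputable def odotRight (D : Seq s V) (n : Idx s) :
    D.functor.obj (op n) ⟶ (odot D (unitB s V)).functor.obj (op n) :=
  (ρ_ _).inv ≫ D.functor.obj (op n) ◁ powPt (unitB s V) (unitSeqι (𝟙 (⟨1⟩ : Idx s))) n.n ≫
    odotι D (unitB s V) n (op n)

variable (s V) in
/-- Monoids for the Kelly product. For `s = lambda` these are the based operads. -/
structure KellyMonoid where
  X : BSeq s V
  mul : bodot X X ⟶ X
  one : unitB s V ⟶ X
  assoc : odotAssoc X.X X X ≫ odotMap mul.hom (𝟙 X) ≫ mul.hom =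
    odotMap (𝟙 X.X) mul ≫ mul.hom
  one_mul : odotLeft X ≫ odotMap one.hom (𝟙 X) ≫ mul.hom = 𝟙 X.X
  mul_one : ∀ n : Idx s, odotRight X.X n ≫ (odotMap (𝟙 X.X) one ≫ mul.hom).natTrans.app (op n) = 𝟙 _

/-- Right modules over a monoid `C` for the Kelly product. -/
structure RightModule (C : KellyMonoid s V) where
  X : Seq s V
  act : odot X C.X ⟶ X
  assoc : odotAssoc X C.X C.X ≫ odotMap act (𝟙 C.X) ≫ act = odotMap (𝟙 X) C.mul ≫ act
  act_one : ∀ n : Idx s,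
    odotRight X n ≫ (odotMap (𝟙 X) C.one ≫ act).natTrans.app (op n) = 𝟙 _

namespace RightModule

variable {C : KellyMonoid s V}

/-- Morphisms of right modules. -/
@[ext]
structure Hom (M N : RightModule C) where
  hom : M.X ⟶ N.X
  act_hom : M.act ≫ hom = odotMap hom (𝟙 C.X) ≫ N.act

instance : Category (RightModule C) where
  Hom := Hom
  id M := ⟨𝟙 _, by rw [odotMap_id, Category.comp_id, Category.id_comp]⟩
  comp f g := ⟨f.hom ≫ g.hom, by
    rw [← Category.assoc, f.act_hom, Category.assoc, g.act_hom, odotMap_comp_assoc,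
      Category.comp_id]⟩

@[ext]
lemma hom_ext {M N : RightModule C} {f g : M ⟶ N} (h : f.hom = g.hom) : f = g := Hom.ext h

variable (C) in
/-- The underlying sequence of a right module. -/
def forget : RightModule C ⥤ Seq s V where
  obj M := M.X
  map f := f.hom

end RightModule

end

section

open scoped DayFunctor
open Functor.LaxMonoidal

variable {s' s : SeqKind} (h : s' = .lambda → s = .lambda)
  {V : Type u} [Category.{v} V] [MonoidalCategory V]

/-- The restriction of a sequence along `Σ ⟶ Λ`. -/
@[reducible]
def resObj (D : Seq s V) : Seq s' V where
  functor :=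
    { obj n := D.functor.obj (op ⟨n.unop.n⟩)
      map u := D.functor.map (Idx.inclMap h u.unop).op
      map_id n := by exact D.functor.map_id (op ⟨n.unop.n⟩)
      map_comp u w := by exact D.functor.map_comp (Idx.inclMap h u.unop).op (Idx.inclMap h w.unop).op }

/-- The restriction functor from `Λ`-objects to `Σ`-sequences. -/
@[reducible]
def res : Seq s V ⥤ Seq s' V where
  obj D := resObj h D
  map {D D'} f :=
    { natTrans :=
      { app n := f.natTrans.app (op ⟨n.unop.n⟩)
        naturality n n' u := by exact f.natTrans.naturality (Idx.inclMap h u.unop).op } }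

variable [SymmetricCategory V] [MonoidalClosed V] [HasColimits V]

lemma resμ_aux (D D' : Seq s V) (x x' y y' : (Idx s')ᵒᵖ) (a : x ⟶ x') (b : y ⟶ y') :
    ((resObj h D).functor.map a ⊗ₘ (resObj h D').functor.map b) ≫
        (inc D D' (op ⟨x'.unop.n⟩) (op ⟨y'.unop.n⟩) :
          _ ⟶ (resObj h (D ⊗ D')).functor.obj (x' ⊗ y')) =
      (inc D D' (op ⟨x.unop.n⟩) (op ⟨y.unop.n⟩) :
          _ ⟶ (resObj h (D ⊗ D')).functor.obj (x ⊗ y)) ≫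
        (resObj h (D ⊗ D')).functor.map (a ⊗ₘ b) :=
  inc_natural D D' (Idx.inclMap h a.unop).op (Idx.inclMap h b.unop).op

/-- The restriction of a Day convolution. -/
noncomputable def resμ (D D' : Seq s V) : resObj h D ⊗ resObj h D' ⟶ resObj h (D ⊗ D') :=
  dayDesc (fun x y => inc D D' (op ⟨x.unop.n⟩) (op ⟨y.unop.n⟩)) (resμ_aux h D D')

lemma inc_resμ (D D' : Seq s V) (x y : (Idx s')ᵒᵖ) :
    inc (resObj h D) (resObj h D') x y ≫ (resμ h D D').natTrans.app (x ⊗ y) =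
      inc D D' (op ⟨x.unop.n⟩) (op ⟨y.unop.n⟩) := inc_dayDesc _ _ x y

lemma inc_resμ_assoc : type_of% (reassoc_of% @inc_resμ) := by
  have h := reassoc_of% @inc_resμ
  exact @h

/-- The restriction of the unit for Day convolution. -/
noncomputable def resε : 𝟙_ (Seq s' V) ⟶ resObj h (𝟙_ (Seq s V)) :=
  unitDesc (F := resObj h (𝟙_ (Seq s V))) (incUnit V (Idx s)ᵒᵖ)

lemma incUnit_resε : incUnit V (Idx s')ᵒᵖ ≫ (resε h).natTrans.app (𝟙_ (Idx s')ᵒᵖ) =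
    incUnit V (Idx s)ᵒᵖ := incUnit_unitDesc (F := resObj h (𝟙_ (Seq s V))) _

lemma resμ_associativity (D D' D'' : Seq s V) :
    resμ h D D' ▷ resObj h D'' ≫ resμ h (D ⊗ D') D'' ≫ (res h).map (α_ D D' D'').hom =
      (α_ _ _ _).hom ≫ resObj h D ◁ resμ h D' D'' ≫ resμ h D (D' ⊗ D'') := by
  apply inc_hom_ext₃
  intro x y z
  simp only [DayFunctor.comp_natTrans, NatTrans.comp_app]
  rw [inc_whiskerRight_assoc, ← comp_whiskerRight_assoc, inc_resμ, inc_resμ_assoc,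
    inc_associator_assoc (resObj h D) (resObj h D') (resObj h D'') x y z, NatTrans.naturality_assoc, NatTrans.naturality, inc_whiskerLeft_assoc,
    ← MonoidalCategory.whiskerLeft_comp_assoc, inc_resμ, inc_resμ_assoc]
  exact inc_associator D D' D'' (op ⟨x.unop.n⟩) (op ⟨y.unop.n⟩) (op ⟨z.unop.n⟩)

lemma resμ_left_unitality (D : Seq s V) :
    (λ_ (resObj h D)).hom =
      resε h ▷ resObj h D ≫ resμ h (𝟙_ _) D ≫ (res h).map (λ_ D).hom := by
  rw [← cancel_epi (λ_ (resObj h D)).inv, Iso.inv_hom_id]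
  ext : 1
  ext c : 2
  simp only [DayFunctor.comp_natTrans, NatTrans.comp_app, leftUnitor_inv_app, Category.assoc,
    NatTrans.naturality_assoc, NatTrans.naturality]
  rw [inc_whiskerRight_assoc, ← comp_whiskerRight_assoc, incUnit_resε, inc_resμ_assoc]
  have := inc_leftUnitor_assoc D (op ⟨c.unop.n⟩) (D.functor.map (λ_ (op (⟨c.unop.n⟩ : Idx s))).hom)
  rw [← D.functor.map_comp, Iso.inv_hom_id, D.functor.map_id, Category.comp_id] at this
  refine Eq.trans ?_ (congrArg (fun t => _ ≫ t) this.symm)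
  exact (Iso.inv_hom_id _).symm

lemma resμ_right_unitality (D : Seq s V) :
    (ρ_ (resObj h D)).hom =
      resObj h D ◁ resε h ≫ resμ h D (𝟙_ _) ≫ (res h).map (ρ_ D).hom := by
  rw [← cancel_epi (ρ_ (resObj h D)).inv, Iso.inv_hom_id]
  ext : 1
  ext c : 2
  simp only [DayFunctor.comp_natTrans, NatTrans.comp_app, rightUnitor_inv_app, Category.assoc,
    NatTrans.naturality_assoc, NatTrans.naturality]
  rw [inc_whiskerLeft_assoc, ← MonoidalCategory.whiskerLeft_comp_assoc, incUnit_resε, inc_resμ_assoc]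
  have := inc_rightUnitor_assoc D (op ⟨c.unop.n⟩) (D.functor.map (ρ_ (op (⟨c.unop.n⟩ : Idx s))).hom)
  rw [← D.functor.map_comp, Iso.inv_hom_id, D.functor.map_id, Category.comp_id] at this
  refine Eq.trans ?_ (congrArg (fun t => _ ≫ t) this.symm)
  exact (Iso.inv_hom_id _).symm

lemma resμ_braided (D D' : Seq s V) :
    resμ h D D' ≫ (res h).map (β_ D D').hom = (β_ _ _).hom ≫ resμ h D' D := by
  apply inc_hom_ext
  intro x y
  simp only [DayFunctor.comp_natTrans, NatTrans.comp_app]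
  rw [inc_resμ_assoc, inc_braiding_assoc, NatTrans.naturality, inc_resμ_assoc]
  exact inc_braiding D D' _ _

noncomputable instance : (res (V := V) h).LaxMonoidal where
  ε := resε h
  μ D D' := resμ h D D'
  μ_natural_left {D₁ D₂} d D' := by
    apply inc_hom_ext
    intro x y
    simp only [DayFunctor.comp_natTrans, NatTrans.comp_app]
    rw [inc_whiskerRight_assoc, inc_resμ, inc_resμ_assoc]
    exact (inc_whiskerRight d D' _ _).symm
  μ_natural_right {D₁ D₂} D d := by
    apply inc_hom_ext
    intro x y
    simp only [DayFunctor.comp_natTrans, NatTrans.comp_app]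
    rw [inc_whiskerLeft_assoc, inc_resμ, inc_resμ_assoc]
    exact (inc_whiskerLeft D d _ _).symm
  associativity D D' D'' := resμ_associativity h D D' D''
  left_unitality D := resμ_left_unitality h D
  right_unitality D := resμ_right_unitality h D

lemma μ_res (D D' : Seq s V) : μ (res (V := V) h) D D' = resμ h D D' := rfl

lemma ε_res : ε (res (V := V) h) = resε h := rfl

noncomputable instance : (res (V := V) h).LaxBraided where
  braided D D' := resμ_braided h D D'

end

namespace Pointed.HomOver

open Functor.LaxMonoidal

variable {s' s : SeqKind} {h : s' = .lambda → s = .lambda}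
  {W : Type u} [Category.{v} W] [MonoidalCategory W] [SymmetricCategory W]
  {W' : Type u'} [Category.{v'} W'] [MonoidalCategory W'] [SymmetricCategory W']
  {Φ : W ⥤ W'} [Φ.LaxMonoidal] {E' : Pointed s' W'} {E : Pointed s W} (φ : HomOver h Φ E' E)

lemma powAdd_pow (k l : ℕ) : (E'.powAdd k l).hom ≫ φ.pow (k + l) =
    (φ.pow k ⊗ₘ φ.pow l) ≫ μ Φ _ _ ≫ Φ.map (E.powAdd k l).hom := by
  induction l with
  | zero =>
    have e : φ.pow 0 = ε Φ := rfl
    rw [powAdd_zero, powAdd_zero, e, MonoidalCategory.tensorHom_def, Category.assoc,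
      ← right_unitality]
    exact (rightUnitor_naturality _).symm
  | succ l ih =>
    have e : φ.pow (k + (l + 1)) = (φ.pow (k + l) ⊗ₘ φ.hom) ≫ μ Φ _ _ := rfl
    rw [powAdd_succ, powAdd_succ, e, pow_succ, Category.assoc, whiskerRight_comp_tensorHom_assoc,
      ih, Φ.map_comp]
    have e2 : (φ.pow k ⊗ₘ (φ.pow l ⊗ₘ φ.hom) ≫ μ Φ (E.pow l) E.X) =
      (φ.pow k ⊗ₘ (φ.pow l ⊗ₘ φ.hom)) ≫ _ ◁ μ Φ (E.pow l) E.X :=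
      (tensorHom_comp_whiskerLeft _ _ _).symm
    have e3 : ((φ.pow k ⊗ₘ φ.pow l) ≫ μ Φ (E.pow k) (E.pow l) ≫ Φ.map (E.powAdd k l).hom) ⊗ₘ
        φ.hom = ((φ.pow k ⊗ₘ φ.pow l) ⊗ₘ φ.hom) ≫ μ Φ (E.pow k) (E.pow l) ▷ _ ≫
          Φ.map (E.powAdd k l).hom ▷ _ := by
      rw [tensorHom_comp_whiskerRight_assoc, tensorHom_comp_whiskerRight, Category.assoc]
    rw [e2, e3]
    simp only [Category.assoc, associativity_inv_assoc, μ_natural_left]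
    rw [associator_inv_naturality_assoc]

end Pointed.HomOver

section

open scoped DayFunctor
open Functor.LaxMonoidal

variable {s' s : SeqKind} (h : s' = .lambda → s = .lambda)
  {V : Type u} [Category.{v} V] [MonoidalCategory V] [SymmetricCategory V] [MonoidalClosed V]
  [HasColimits V]

/-- The restriction of a sequence with its base map. -/
noncomputable def resB (E : BSeq s V) : BSeq s' V where
  X := resObj h E.X
  base hs := resε h ≫ (res h).map (E.base (h hs))

/-- The restriction of morphisms of sequences with base maps. -/
noncomputable def resBMap {E F : BSeq s V} (f : E ⟶ F) : resB h E ⟶ resB h F where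
  hom := (res h).map f.hom
  base_hom hs := by
    have := congrArg (res h).map (f.base_hom (h hs))
    rw [Functor.map_comp] at this
    exact (Category.assoc _ _ _).trans (congrArg (_ ≫ ·) this)

/-- The identity, as a morphism from the restriction of `E` to `E`. -/
noncomputable def resHom (E : BSeq s V) : Pointed.HomOver h (res h) (resB h E) E where
  hom := 𝟙 _
  base_hom hs := Category.comp_id _

/-- The canonical maps from the tensor powers of a restriction to the restriction of the tensor
powers. -/
noncomputable def resPow (E : BSeq s V) (k : ℕ) : (resB h E).pow k ⟶ resObj h (E.pow k) :=
  (resHom h E).pow k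

lemma resPow_zero (E : BSeq s V) : resPow h E 0 = resε h := rfl

lemma resPow_succ (E : BSeq s V) (k : ℕ) : resPow h E (k + 1) =
    (resPow h E k) ▷ resObj h E.X ≫ resμ h (E.pow k) E.X := by
  refine ((resHom h E).pow_succ k).trans ?_
  rw [← tensorHom_id]
  rfl

lemma resPow_natural (E : BSeq s V) {k l : ℕ} (f : (⟨k⟩ : Idx s') ⟶ ⟨l⟩) :
    (resB h E).powMap k l f ≫ resPow h E l =
      resPow h E k ≫ (res h).map (E.powMap k l (Idx.inclMap h f)) :=
  (resHom h E).powMap_pow k l f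

lemma resPow_powAdd (E : BSeq s V) (k l : ℕ) : ((resB h E).powAdd k l).hom ≫ resPow h E (k + l) =
    (resPow h E k ⊗ₘ resPow h E l) ≫ resμ h _ _ ≫ (res h).map (E.powAdd k l).hom :=
  (resHom h E).powAdd_pow k l

lemma resPow_powHom {E F : BSeq s V} (f : E ⟶ F) (k : ℕ) :
    Pointed.powHom (resBMap h f) k ≫ resPow h F k =
      resPow h E k ≫ (res h).map (Pointed.powHom f k) := by
  induction k with
  | zero =>
    change 𝟙 _ ≫ _ = _ ≫ (res h).map (𝟙 _)
    rw [CategoryTheory.Functor.map_id, Category.id_comp]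
    exact (Category.comp_id _).symm
  | succ k ih =>
    have e := Functor.LaxMonoidal.μ_natural (res h) (Pointed.powHom f k) f.hom
    rw [Pointed.powHom_succ, Pointed.powHom_succ, resPow_succ, resPow_succ]
    refine Eq.trans ?_ (Category.assoc _ _ _).symm
    refine Eq.trans ?_ (congrArg (_ ≫ ·) e)
    refine (tensorHom_comp_whiskerRight_assoc _ _ _ _).trans ?_
    rw [ih]
    exact (whiskerRight_comp_tensorHom_assoc _ _ _ _).symm

variable (D : Seq s V) (E : BSeq s V)

/-- The component of `resOdot` at `k`. -/
noncomputable def resOdotComp (n : (Idx s')ᵒᵖ) (k : Idx s') :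
    (resObj h D).functor.obj (op k) ⊗ ((resB h E).pow k.n).functor.obj n ⟶
      (resObj h (odot D E)).functor.obj n :=
  D.functor.obj (op ⟨k.n⟩) ◁ (resPow h E k.n).natTrans.app n ≫ odotι D E ⟨k.n⟩ (op ⟨n.unop.n⟩)

lemma resOdotComp_condition (n : (Idx s')ᵒᵖ) (i j : Idx s') (g : i ⟶ j) :
    (resObj h D).functor.map g.op ▷ ((resB h E).pow i.n).functor.obj n ≫ resOdotComp h D E n i =
      (resObj h D).functor.obj (op j) ◁ ((resB h E).powMap i.n j.n g).natTrans.app n ≫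
        resOdotComp h D E n j := by
  have e1 := congrArg (fun t => DayFunctor.Hom.natTrans t |>.app n) (resPow_natural h E g)
  simp only [DayFunctor.comp_natTrans, NatTrans.comp_app] at e1
  have e2 := odotι_condition D E (Idx.inclMap h g) (op ⟨n.unop.n⟩)
  unfold resOdotComp
  rw [← whisker_exchange_assoc, ← MonoidalCategory.whiskerLeft_comp_assoc, e1,
    MonoidalCategory.whiskerLeft_comp_assoc]
  exact congrArg _ e2

lemma resOdot_naturality {n n' : (Idx s')ᵒᵖ} (u : n ⟶ n') :
    (odot (resObj h D) (resB h E)).functor.map u ≫ odotDesc (resObj h D) (resB h E)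
        (resOdotComp h D E n') (resOdotComp_condition h D E n') =
      odotDesc (resObj h D) (resB h E) (resOdotComp h D E n) (resOdotComp_condition h D E n) ≫
        (resObj h (odot D E)).functor.map u := by
  apply odot_ext
  intro k
  rw [odotι_map_assoc, odotι_odotDesc, odotι_odotDesc_assoc]
  have e1 := odotι_map D E ⟨k.n⟩ (Idx.inclMap h u.unop).op
  have e2 := (resPow h E k.n).natTrans.naturality u
  unfold resOdotComp
  refine Eq.trans ?_ (Category.assoc _ _ _).symm
  refine Eq.trans ?_ (congrArg (_ ≫ ·) e1.symm)
  refine (MonoidalCategory.whiskerLeft_comp_assoc _ _ _ _).symm.trans ?_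
  refine Eq.trans ?_ (MonoidalCategory.whiskerLeft_comp_assoc _ _ _ _)
  exact congrArg (fun t => _ ◁ t ≫ _) e2

/-- The canonical map from the Kelly product of the restrictions to the restriction of the Kelly
product. For the inclusion of `Σ` in `Λ` this is the quotient map `D ⊙_Σ E ⟶ D ⊙_Λ E`. -/
noncomputable def resOdot : odot (resObj h D) (resB h E) ⟶ resObj h (odot D E) where
  natTrans :=
    { app n := odotDesc (resObj h D) (resB h E) (resOdotComp h D E n)
        (resOdotComp_condition h D E n)
      naturality _ _ u := resOdot_naturality h D E u }

lemma odotι_resOdot (k : Idx s') (n : (Idx s')ᵒᵖ) :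
    odotι (resObj h D) (resB h E) k n ≫ (resOdot h D E).natTrans.app n =
      D.functor.obj (op ⟨k.n⟩) ◁ (resPow h E k.n).natTrans.app n ≫
        odotι D E ⟨k.n⟩ (op ⟨n.unop.n⟩) :=
  odotι_odotDesc (resObj h D) (resB h E) (resOdotComp h D E n) (resOdotComp_condition h D E n) k

lemma odotι_resOdot_assoc : type_of% (reassoc_of% @odotι_resOdot) := by
  have h := reassoc_of% @odotι_resOdot
  exact @h

lemma odotι_odotMap {s : SeqKind} {D D' : Seq s V} {E E' : BSeq s V} (d : D ⟶ D') (e : E ⟶ E')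
    (k : Idx s) (n : (Idx s)ᵒᵖ) : odotι D E k n ≫ (odotMap d e).natTrans.app n =
      (d.natTrans.app (op k) ⊗ₘ (Pointed.powHom e k.n).natTrans.app n) ≫ odotι D' E' k n :=
  kι_kellyMap d (Pointed.powFunctorMap e) k n

lemma odot_hom_ext {s : SeqKind} {D X : Seq s V} {E : BSeq s V} {f g : odot D E ⟶ X}
    (h : ∀ k n, odotι D E k n ≫ f.natTrans.app n = odotι D E k n ≫ g.natTrans.app n) : f = g :=
  kelly_hom_ext h

lemma resOdot_natural {D D' : Seq s V} {E E' : BSeq s V} (d : D ⟶ D') (e : E ⟶ E') :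
    odotMap ((res h).map d) (resBMap h e) ≫ resOdot h D' E' =
      resOdot h D E ≫ (res h).map (odotMap d e) := by
  apply odot_hom_ext
  intro k n
  have e1 := congrArg (fun t => DayFunctor.Hom.natTrans t |>.app n) (resPow_powHom h e k.n)
  simp only [DayFunctor.comp_natTrans, NatTrans.comp_app] at e1
  have e2 := odotι_odotMap d e ⟨k.n⟩ (op ⟨n.unop.n⟩)
  simp only [DayFunctor.comp_natTrans, NatTrans.comp_app]
  rw [reassoc_of% (odotι_odotMap ((res h).map d) (resBMap h e) k n), odotι_resOdot,
    odotι_resOdot_assoc]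
  refine Eq.trans ?_ (congrArg (_ ≫ ·) e2.symm)
  refine (tensorHom_comp_whiskerLeft_assoc _ _ _ _).trans ?_
  rw [e1]
  exact (whiskerLeft_comp_tensorHom_assoc _ _ _ _).symm

end

section

open scoped DayFunctor
open Functor.LaxMonoidal

variable {s' s : SeqKind} (h : s' = .lambda → s = .lambda)
  {V : Type u} [Category.{v} V] [MonoidalCategory V] [SymmetricCategory V] [MonoidalClosed V]
  [HasColimits V]

/-- The lax monoidal structure of `- ⊙ F`. -/
noncomputable def odotμ {s : SeqKind} (D D' : Seq s V) (F : BSeq s V) :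
    odot D F ⊗ odot D' F ⟶ odot (D ⊗ D') F := kellyμ F.powFunctor D D'

/-- The unit part of the lax monoidal structure of `- ⊙ F`. -/
noncomputable def odotε {s : SeqKind} (F : BSeq s V) :
    𝟙_ (Seq s V) ⟶ odot (𝟙_ (Seq s V)) F := kellyε F.powFunctor

lemma μ_odot {s : SeqKind} (D D' : Seq s V) (F : BSeq s V) :
    μ (odotFunctor F) D D' = odotμ D D' F := rfl

/-- The maps `(F^{⊠ k}) c ⊗ (F^{⊠ l}) c' ⟶ (F^{⊠ (k + l)}) (c + c')`. -/
noncomputable def powInc {s : SeqKind} (F : BSeq s V) (k l : ℕ) (c c' : (Idx s)ᵒᵖ) :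
    (F.pow k).functor.obj c ⊗ (F.pow l).functor.obj c' ⟶ (F.pow (k + l)).functor.obj (c ⊗ c') :=
  inc _ _ c c' ≫ (F.powAdd k l).hom.natTrans.app (c ⊗ c')

lemma odotι_odotμ {s : SeqKind} (D D' : Seq s V) (F : BSeq s V) (k l : Idx s)
    (c c' : (Idx s)ᵒᵖ) :
    (odotι D F k c ⊗ₘ odotι D' F l c') ≫ inc _ _ c c' ≫ (odotμ D D' F).natTrans.app (c ⊗ c') =
      tensorμ _ _ _ _ ≫ (inc D D' (op k) (op l) ⊗ₘ powInc F k.n l.n c c') ≫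
        odotι (D ⊗ D') F ⟨k.n + l.n⟩ (c ⊗ c') :=
  kι_kellyμ F.powFunctor D D' k l c c'

lemma odotι_odotμ_assoc : type_of% (reassoc_of% @odotι_odotμ) := by
  have h := reassoc_of% @odotι_odotμ
  exact @h

lemma odotε_comp {s : SeqKind} (F : BSeq s V) :
    incUnit V (Idx s)ᵒᵖ ≫ (odotε F).natTrans.app (𝟙_ (Idx s)ᵒᵖ) =
      (λ_ _).inv ≫ (incUnit V (Idx s)ᵒᵖ ⊗ₘ incUnit V (Idx s)ᵒᵖ) ≫
        odotι (𝟙_ (Seq s V)) F ⟨0⟩ (𝟙_ (Idx s)ᵒᵖ) := by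
  have e : pincUnit F.powFunctor = incUnit V (Idx s)ᵒᵖ := Category.comp_id _
  have := kellyε_comp (V := V) F.powFunctor
  rw [e] at this
  exact this

lemma odotε_comp_assoc : type_of% (reassoc_of% @odotε_comp) := by
  have h := reassoc_of% @odotε_comp
  exact @h

lemma odot_day_ext {s : SeqKind} {D D' X : Seq s V} {F : BSeq s V} {f g : odot D F ⊗ odot D' F ⟶ X}
    (h : ∀ k l c c', (odotι D F k c ⊗ₘ odotι D' F l c') ≫ inc _ _ c c' ≫ f.natTrans.app (c ⊗ c') =
      (odotι D F k c ⊗ₘ odotι D' F l c') ≫ inc _ _ c c' ≫ g.natTrans.app (c ⊗ c')) : f = g :=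
  kelly_day_ext h

lemma powInc_resPow (F : BSeq s V) (k l : ℕ) (c c' : (Idx s')ᵒᵖ) :
    powInc (resB h F) k l c c' ≫ (resPow h F (k + l)).natTrans.app (c ⊗ c') =
      ((resPow h F k).natTrans.app c ⊗ₘ (resPow h F l).natTrans.app c') ≫
        powInc F k l (op ⟨c.unop.n⟩) (op ⟨c'.unop.n⟩) := by
  have e1 := congrArg (fun t => DayFunctor.Hom.natTrans t |>.app (c ⊗ c')) (resPow_powAdd h F k l)
  simp only [DayFunctor.comp_natTrans, NatTrans.comp_app] at e1
  unfold powInc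
  rw [Category.assoc, e1, inc_tensorHom_assoc, inc_resμ_assoc]
  rfl

/-- The quotient maps are compatible with tensor products. -/
lemma resOdot_μ (D D' : Seq s V) (F : BSeq s V) :
    odotμ (resObj h D) (resObj h D') (resB h F) ≫ odotWhisker (resμ h D D') (resB h F) ≫
        resOdot h (D ⊗ D') F =
      (resOdot h D F ⊗ₘ resOdot h D' F) ≫ resμ h _ _ ≫ (res h).map (odotμ D D' F) := by
  apply odot_day_ext
  intro k l c c'
  simp only [DayFunctor.comp_natTrans, NatTrans.comp_app]
  rw [odotι_odotμ_assoc, odotι_odotWhisker_assoc, odotι_resOdot h (D ⊗ D') F ⟨k.n + l.n⟩ (c ⊗ c'),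
    inc_tensorHom_assoc, inc_resμ_assoc, tensorHom_comp_tensorHom_assoc, odotι_resOdot,
    odotι_resOdot]
  have e1 := odotι_odotμ D D' F ⟨k.n⟩ ⟨l.n⟩ (op ⟨c.unop.n⟩) (op ⟨c'.unop.n⟩)
  rw [← tensorHom_comp_tensorHom_assoc]
  refine Eq.trans ?_ (congrArg (_ ≫ ·) e1.symm)
  have e2 := powInc_resPow h F k.n l.n c c'
  have e3 : inc (resObj h D) (resObj h D') (op k) (op l) ≫
      (resμ h D D').natTrans.app (op (⟨k.n + l.n⟩ : Idx s')) = inc D D' (op ⟨k.n⟩) (op ⟨l.n⟩) :=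
    inc_resμ h D D' (op k) (op l)
  have e4 := tensorμ_natural (𝟙 (D.functor.obj (op ⟨k.n⟩))) ((resPow h F k.n).natTrans.app c)
    (𝟙 (D'.functor.obj (op ⟨l.n⟩))) ((resPow h F l.n).natTrans.app c')
  rw [id_tensorHom, id_tensorHom, id_tensorHom_id, id_tensorHom] at e4
  rw [tensorHom_comp_whiskerRight_assoc, e3, reassoc_of% e4, tensorHom_comp_whiskerLeft_assoc, e2]
  exact congrArg (_ ≫ ·) (whiskerLeft_comp_tensorHom_assoc _ _ _ _).symm

end

section

open scoped DayFunctor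
open Functor.LaxMonoidal

variable {s' s : SeqKind} (h : s' = .lambda → s = .lambda)
  {V : Type u} [Category.{v} V] [MonoidalCategory V] [SymmetricCategory V] [MonoidalClosed V]
  [HasColimits V]

/-- The quotient maps are compatible with units. -/
lemma resOdot_ε (F : BSeq s V) :
    odotε (resB h F) ≫ odotWhisker (resε h) (resB h F) ≫ resOdot h (𝟙_ _) F =
      resε h ≫ (res h).map (odotε F) := by
  apply incUnit_hom_ext
  simp only [DayFunctor.comp_natTrans, NatTrans.comp_app]
  rw [odotε_comp_assoc, odotι_odotWhisker_assoc, odotι_resOdot h _ F ⟨0⟩]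
  have e1 := odotε_comp F
  have e2 : incUnit V (Idx s')ᵒᵖ ≫ (resε h).natTrans.app (op (⟨0⟩ : Idx s')) =
    incUnit V (Idx s)ᵒᵖ := incUnit_resε h
  have e3 : incUnit V (Idx s')ᵒᵖ ≫ (resPow h F 0).natTrans.app (𝟙_ (Idx s')ᵒᵖ) =
    incUnit V (Idx s)ᵒᵖ := incUnit_resε h
  rw [tensorHom_comp_whiskerRight_assoc, e2, tensorHom_comp_whiskerLeft_assoc, e3]
  refine e1.symm.trans ?_
  rw [← Category.assoc, incUnit_resε]
  rfl

/-- The quotient map, as a morphism of sequences with base maps. -/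
noncomputable def resOdotB (E F : BSeq s V) : bodot (resB h E) (resB h F) ⟶ resB h (bodot E F) where
  hom := resOdot h E.X F
  base_hom hs := by
    have e1 := resOdot_ε h F
    have e2 := resOdot_natural h (E.base (h hs)) (𝟙 F)
    have e3 : resBMap h (𝟙 F) = 𝟙 _ := Pointed.hom_ext ((res h).map_id _)
    rw [e3, ← odotWhisker_eq, ← odotWhisker_eq] at e2
    change (odotε (resB h F) ≫ odotWhisker (resε h ≫ (res h).map (E.base (h hs))) (resB h F)) ≫
      resOdot h E.X F = resε h ≫ (res h).map (odotε F ≫ odotWhisker (E.base (h hs)) F)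
    have e4 : odotWhisker (resε h ≫ (res h).map (E.base (h hs))) (resB h F) =
      odotWhisker (resε h) (resB h F) ≫ odotWhisker ((res h).map (E.base (h hs))) (resB h F) :=
      (odotFunctor (resB h F)).map_comp _ _
    rw [e4, Category.assoc, Category.assoc, e2, reassoc_of% e1, Functor.map_comp]

lemma powOdotHom_succ {s : SeqKind} (E F : BSeq s V) (k : ℕ) : powOdotHom E F (k + 1) =
    powOdotHom E F k ▷ odot E.X F ≫ odotμ (E.pow k) E.X F := by
  refine ((powOdot E F).pow_succ k).trans ?_
  rw [← tensorHom_id]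
  rfl

lemma powOdotHom_zero {s : SeqKind} (E F : BSeq s V) : powOdotHom E F 0 = odotε F := rfl

lemma odotWhisker_comp {s : SeqKind} {D D' D'' : Seq s V} (d : D ⟶ D') (d' : D' ⟶ D'')
    (F : BSeq s V) : odotWhisker (d ≫ d') F = odotWhisker d F ≫ odotWhisker d' F :=
  (odotFunctor F).map_comp _ _

lemma powOdotHom_resOdot (E F : BSeq s V) (k : ℕ) :
    powOdotHom (resB h E) (resB h F) k ≫ odotWhisker (resPow h E k) (resB h F) ≫
        resOdot h (E.pow k) F =
      Pointed.powHom (resOdotB h E F) k ≫ resPow h (bodot E F) k ≫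
        (res h).map (powOdotHom E F k) := by
  induction k with
  | zero => exact (resOdot_ε h F).trans (Category.id_comp _).symm
  | succ k ih =>
    have e1 := resOdot_μ h (E.pow k) E.X F
    have e2 := μ_natural_left (odotFunctor (resB h F)) (resPow h E k) (resObj h E.X)
    have e2' : odotWhisker (resPow h E k) (resB h F) ▷ odot (resObj h E.X) (resB h F) ≫
      odotμ (resObj h (E.pow k)) (resObj h E.X) (resB h F) =
        odotμ ((resB h E).pow k) (resObj h E.X) (resB h F) ≫
          odotWhisker (resPow h E k ▷ resObj h E.X) (resB h F) := e2
    have e3 : (res h).map (powOdotHom E F (k + 1)) =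
        (res h).map (powOdotHom E F k ▷ odot E.X F) ≫ (res h).map (odotμ (E.pow k) E.X F) :=
      (congrArg _ (powOdotHom_succ E F k)).trans ((res h).map_comp _ _)
    have e4 := μ_natural_left (res (V := V) h) (powOdotHom E F k) (odot E.X F)
    have e4' : (res h).map (powOdotHom E F k) ▷ resObj h (odot E.X F) ≫
      resμ h (odot (E.pow k) F) (odot E.X F) = resμ h ((bodot E F).pow k) (odot E.X F) ≫
        (res h).map (powOdotHom E F k ▷ odot E.X F) := e4
    calc
      _ = (powOdotHom (resB h E) (resB h F) k ▷ odot (resObj h E.X) (resB h F) ≫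
            odotμ ((resB h E).pow k) (resObj h E.X) (resB h F)) ≫
          (odotWhisker (resPow h E k ▷ resObj h E.X) (resB h F) ≫
            odotWhisker (resμ h (E.pow k) E.X) (resB h F)) ≫ resOdot h (E.pow k ⊗ E.X) F := by
        rw [← odotWhisker_comp, ← resPow_succ]
        exact congrArg (· ≫ _) (powOdotHom_succ _ _ _)
      _ = powOdotHom (resB h E) (resB h F) k ▷ odot (resObj h E.X) (resB h F) ≫
            (odotWhisker (resPow h E k) (resB h F) ▷ odot (resObj h E.X) (resB h F) ≫
            odotμ (resObj h (E.pow k)) (resObj h E.X) (resB h F)) ≫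
            odotWhisker (resμ h (E.pow k) E.X) (resB h F) ≫ resOdot h (E.pow k ⊗ E.X) F := by
        rw [e2']; simp only [Category.assoc]
      _ = (((powOdotHom (resB h E) (resB h F) k ≫ odotWhisker (resPow h E k) (resB h F)) ≫
          resOdot h (E.pow k) F) ⊗ₘ resOdot h E.X F) ≫ resμ h _ _ ≫
            (res h).map (odotμ (E.pow k) E.X F) := by
        simp only [Category.assoc]
        rw [e1, whiskerRight_comp_tensorHom_assoc, whiskerRight_comp_tensorHom_assoc]
      _ = (Pointed.powHom (resOdotB h E F) k ⊗ₘ resOdot h E.X F) ≫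
          resPow h (bodot E F) k ▷ resObj h (odot E.X F) ≫
          ((res h).map (powOdotHom E F k) ▷ resObj h (odot E.X F) ≫ resμ h _ _) ≫
            (res h).map (odotμ (E.pow k) E.X F) := by
        rw [Category.assoc (powOdotHom _ _ _), ih]
        simp only [Category.assoc]
        rw [tensorHom_comp_whiskerRight_assoc, tensorHom_comp_whiskerRight_assoc, Category.assoc]
      _ = _ := by
        rw [e4', e3]
        simp only [Category.assoc]
        refine congrArg (_ ≫ ·) ?_
        exact (Category.assoc _ _ _).symm.trans
          (congrArg (· ≫ _) (resPow_succ h (bodot E F) k).symm)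

end

section

open scoped DayFunctor
open Functor.LaxMonoidal

variable {s' s : SeqKind} (h : s' = .lambda → s = .lambda)
  {V : Type u} [Category.{v} V] [MonoidalCategory V] [SymmetricCategory V] [MonoidalClosed V]
  [HasColimits V]

lemma assocComp_resOdot (D : Seq s V) (E F : BSeq s V) (k : Idx s') (n : (Idx s')ᵒᵖ) :
    assocComp (resObj h D) (resB h E) (resB h F) k n ≫
        (odotWhisker (resOdot h D E) (resB h F)).natTrans.app n ≫
          (resOdot h (odot D E) F).natTrans.app n =
      D.functor.obj (op ⟨k.n⟩) ◁
          (odotWhisker (resPow h E k.n) (resB h F) ≫ resOdot h (E.pow k.n) F).natTrans.app n ≫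
        assocComp D E F ⟨k.n⟩ (op ⟨n.unop.n⟩) := by
  apply odot_whiskerLeft_ext
  intro l
  have e1 := kι_assocComp D E F ⟨k.n⟩ ⟨l.n⟩ (op ⟨n.unop.n⟩)
  rw [reassoc_of% (kι_assocComp (resObj h D) (resB h E) (resB h F) k l n)]
  simp only [DayFunctor.comp_natTrans, NatTrans.comp_app]
  rw [← MonoidalCategory.whiskerLeft_comp_assoc, odotι_odotWhisker_assoc, odotι_resOdot,
    MonoidalCategory.whiskerLeft_comp_assoc, MonoidalCategory.whiskerLeft_comp_assoc]
  refine Eq.trans ?_ (congrArg (fun t => _ ≫ _ ≫ t) e1.symm)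
  unfold assocComp₂
  simp only [Category.assoc]
  rw [odotι_odotWhisker_assoc, odotι_resOdot, ← comp_whiskerRight_assoc, odotι_resOdot,
    comp_whiskerRight, Category.assoc, ← associator_inv_naturality_middle_assoc,
    associator_inv_naturality_right_assoc, whisker_exchange_assoc]

/-- The quotient maps are compatible with the associativity isomorphisms. -/
lemma resOdot_assoc (D : Seq s V) (E F : BSeq s V) :
    odotAssoc (resObj h D) (resB h E) (resB h F) ≫ odotMap (resOdot h D E) (𝟙 (resB h F)) ≫
        resOdot h (odot D E) F =
      odotMap (𝟙 (resObj h D)) (resOdotB h E F) ≫ resOdot h D (bodot E F) ≫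
        (res h).map (odotAssoc D E F) := by
  rw [← odotWhisker_eq]
  apply odot_hom_ext
  intro k n
  have e1 := congrArg (fun t => DayFunctor.Hom.natTrans t |>.app n) (powOdotHom_resOdot h E F k.n)
  have e2 := odotι_odotAssoc D E F ⟨k.n⟩ (op ⟨n.unop.n⟩)
  simp only [DayFunctor.comp_natTrans, NatTrans.comp_app] at e1 ⊢
  rw [odotι_odotAssoc_assoc, assocComp_resOdot]
  rw [reassoc_of% (odotι_odotMap (𝟙 (resObj h D)) (resOdotB h E F) k n), odotι_resOdot_assoc]
  refine Eq.trans ?_ (congrArg (fun t => _ ≫ _ ≫ t) e2.symm)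
  have e3 := congrArg (fun t => D.functor.obj (op ⟨k.n⟩) ◁ t ≫
    assocComp D E F ⟨k.n⟩ (op ⟨n.unop.n⟩)) e1
  simp only [MonoidalCategory.whiskerLeft_comp, Category.assoc] at e3
  simp only [DayFunctor.comp_natTrans, NatTrans.comp_app, MonoidalCategory.whiskerLeft_comp,
    Category.assoc]
  refine e3.trans ?_
  exact congrArg (· ≫ _) (id_tensorHom _ _).symm

variable (V) in
/-- The canonical map from the unit `I_1` to the restriction of the unit `I_1`. -/
noncomputable def resUnitHom : unitSeq s' V ⟶ resObj h (unitSeq s V) where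
  natTrans :=
    { app n := unitSeqDesc (n := n.unop) fun f => unitSeqι (Idx.inclMap h f)
      naturality n m u := by
        apply unitSeq_ext
        intro a
        have e1 := unitSeqι_map (V := V) (Idx.inclMap h u.unop) (Idx.inclMap h a)
        rw [reassoc_of% (unitSeqι_map' (V := V) u a), unitSeqι_desc]
        refine Eq.trans e1.symm ?_
        exact ((Category.assoc _ _ _).symm.trans
          (congrArg (· ≫ _) (unitSeqι_desc (V := V)
            (fun f => unitSeqι (V := V) (Idx.inclMap h f)) a))).symm }

lemma unitSeqι_resUnitHom {n : Idx s'} (f : n ⟶ ⟨1⟩) :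
    unitSeqι (V := V) f ≫ (resUnitHom h V).natTrans.app (op n) = unitSeqι (Idx.inclMap h f) :=
  unitSeqι_desc (V := V) (fun f => unitSeqι (V := V) (Idx.inclMap h f)) f

variable (V) in
/-- The canonical map from the unit `I_1` to the restriction of the unit `I_1`. -/
noncomputable def resUnit : unitB s' V ⟶ resB h (unitB s V) where
  hom := resUnitHom h V
  base_hom hs := by
    apply incUnit_hom_ext
    have e1 := incUnit_unitBase (V := V) hs
    have e2 := incUnit_unitBase (V := V) (h hs)
    have e3 : incUnit V (Idx s')ᵒᵖ ≫ (resε h).natTrans.app (op (⟨0⟩ : Idx s')) =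
      incUnit V (Idx s)ᵒᵖ := incUnit_resε h
    change incUnit V (Idx s')ᵒᵖ ≫ (unitBase V hs).natTrans.app (op (⟨0⟩ : Idx s')) ≫
        (resUnitHom h V).natTrans.app (op (⟨0⟩ : Idx s')) =
      incUnit V (Idx s')ᵒᵖ ≫ (resε h).natTrans.app (op (⟨0⟩ : Idx s')) ≫
        (unitBase V (h hs)).natTrans.app (op (⟨0⟩ : Idx s))
    rw [reassoc_of% e1, reassoc_of% e3, e2]
    exact unitSeqι_resUnitHom h _

/-- The quotient maps are compatible with the left unit isomorphisms. -/
lemma resOdot_left (E : BSeq s V) :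
    odotLeft (resB h E) ≫ odotMap (resUnitHom h V) (𝟙 (resB h E)) ≫
      resOdot h (unitSeq s V) E = (res h).map (odotLeft E) := by
  rw [← odotWhisker_eq]
  ext : 1
  ext n : 2
  simp only [DayFunctor.comp_natTrans, NatTrans.comp_app]
  have e1 : (λ_ E.X).inv.natTrans.app (op ⟨n.unop.n⟩) =
      (λ_ (resObj h E.X)).inv.natTrans.app n ≫ (resPow h E 1).natTrans.app n := by
    have := Functor.LaxMonoidal.left_unitality_inv (res (V := V) h) E.X
    have := congrArg (fun t => DayFunctor.Hom.natTrans t |>.app n) this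
    simp only [DayFunctor.comp_natTrans, NatTrans.comp_app] at this
    refine this.symm.trans ?_
    rw [resPow_succ, DayFunctor.comp_natTrans, NatTrans.comp_app]
    rfl
  have e2 := odotLeft_app E (op ⟨n.unop.n⟩)
  refine Eq.trans ?_ e2.symm
  rw [odotLeft_app, e1]
  simp only [Category.assoc]
  rw [odotι_odotWhisker_assoc, odotι_resOdot h (unitSeq s V) E ⟨1⟩ n,
    tensorHom_comp_whiskerRight_assoc]
  have e3 : unitSeqι (V := V) (𝟙 (⟨1⟩ : Idx s')) ≫
    (resUnitHom h V).natTrans.app (op (⟨1⟩ : Idx s')) = unitSeqι (𝟙 (⟨1⟩ : Idx s)) :=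
      unitSeqι_resUnitHom h (𝟙 _)
  rw [e3, tensorHom_comp_whiskerLeft_assoc]
  rfl

lemma powPt_res (n : ℕ) :
    powPt (unitB s' V) (unitSeqι (𝟙 (⟨1⟩ : Idx s'))) n ≫
      (Pointed.powHom (resUnit h V) n).natTrans.app (op ⟨n⟩) ≫
        (resPow h (unitB s V) n).natTrans.app (op ⟨n⟩) =
    powPt (unitB s V) (unitSeqι (𝟙 (⟨1⟩ : Idx s))) n := by
  induction n with
  | zero =>
    have e3 : incUnit V (Idx s')ᵒᵖ ≫ (resε h).natTrans.app (op (⟨0⟩ : Idx s')) =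
      incUnit V (Idx s)ᵒᵖ := incUnit_resε h
    exact (congrArg (_ ≫ ·) (Category.id_comp _)).trans e3
  | succ n ih =>
    have e1 := inc_tensorHom (Pointed.powHom (resUnit h V) n) (resUnitHom h V) (op ⟨n⟩) (op ⟨1⟩)
    have e2 := inc_whiskerRight (resPow h (unitB s V) n) (resObj h (unitSeq s V)) (op ⟨n⟩) (op ⟨1⟩)
    have e3 := inc_resμ h ((unitB s V).pow n) (unitSeq s V) (op ⟨n⟩) (op ⟨1⟩)
    have e4 : (resPow h (unitB s V) (n + 1)).natTrans.app (op ⟨n + 1⟩) =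
        (resPow h (unitB s V) n ▷ resObj h (unitSeq s V)).natTrans.app (op ⟨n⟩ ⊗ op ⟨1⟩) ≫
          (resμ h ((unitB s V).pow n) (unitSeq s V)).natTrans.app (op ⟨n⟩ ⊗ op ⟨1⟩) :=
      congrArg (fun t => DayFunctor.Hom.natTrans t |>.app (op (⟨n + 1⟩ : Idx s')))
        (resPow_succ h (unitB s V) n)
    have e5 : unitSeqι (V := V) (𝟙 (⟨1⟩ : Idx s')) ≫
      (resUnitHom h V).natTrans.app (op (⟨1⟩ : Idx s')) = unitSeqι (𝟙 (⟨1⟩ : Idx s)) :=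
        unitSeqι_resUnitHom h (𝟙 _)
    have key : ((λ_ (𝟙_ V)).inv ≫ (powPt (unitB s' V) (unitSeqι (𝟙 (⟨1⟩ : Idx s'))) n ⊗ₘ
        unitSeqι (𝟙 (⟨1⟩ : Idx s'))) ≫ inc ((unitB s' V).pow n) (unitSeq s' V) (op ⟨n⟩) (op ⟨1⟩)) ≫
        (Pointed.powHom (resUnit h V) n ⊗ₘ resUnitHom h V).natTrans.app (op ⟨n⟩ ⊗ op ⟨1⟩) ≫
        (resPow h (unitB s V) n ▷ resObj h (unitSeq s V)).natTrans.app (op ⟨n⟩ ⊗ op ⟨1⟩) ≫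
          (resμ h ((unitB s V).pow n) (unitSeq s V)).natTrans.app (op ⟨n⟩ ⊗ op ⟨1⟩) =
        (λ_ (𝟙_ V)).inv ≫ (powPt (unitB s V) (unitSeqι (𝟙 (⟨1⟩ : Idx s))) n ⊗ₘ
          unitSeqι (𝟙 (⟨1⟩ : Idx s))) ≫ inc ((unitB s V).pow n) (unitSeq s V) (op ⟨n⟩) (op ⟨1⟩) := by
      simp only [Category.assoc]
      rw [reassoc_of% e1, reassoc_of% e2, e3, tensorHom_comp_tensorHom_assoc,
        tensorHom_comp_whiskerRight_assoc, Category.assoc, ih, e5]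
    refine Eq.trans ?_ key
    rw [e4]
    rfl

/-- The quotient maps are compatible with the right unit isomorphisms. -/
lemma resOdot_right (D : Seq s V) (n : Idx s') :
    odotRight (resObj h D) n ≫ (odotMap (𝟙 (resObj h D)) (resUnit h V) ≫
      resOdot h D (unitB s V)).natTrans.app (op n) = odotRight D ⟨n.n⟩ := by
  have e1 := powPt_res h (V := V) n.n
  simp only [DayFunctor.comp_natTrans, NatTrans.comp_app]
  unfold odotRight
  simp only [Category.assoc]
  rw [reassoc_of% (odotι_odotMap (𝟙 (resObj h D)) (resUnit h V) n (op n)), odotι_resOdot]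
  have e2 : (𝟙 (resObj h D) : resObj h D ⟶ _).natTrans.app (op n) = 𝟙 _ := rfl
  rw [e2, id_tensorHom, ← e1]
  simp only [MonoidalCategory.whiskerLeft_comp, Category.assoc]

end

section

open scoped DayFunctor
open Functor.LaxMonoidal

variable {s' s : SeqKind} (h : s' = .lambda → s = .lambda)
  {V : Type u} [Category.{v} V] [MonoidalCategory V] [SymmetricCategory V] [MonoidalClosed V]
  [HasColimits V]

lemma odotMap_res_left {D D' : Seq s V} (d : D ⟶ D') (E : BSeq s V) :
    odotMap ((res h).map d) (𝟙 (resB h E)) ≫ resOdot h D' E =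
      resOdot h D E ≫ (res h).map (odotMap d (𝟙 E)) := by
  have e := resOdot_natural h d (𝟙 E)
  have e3 : resBMap h (𝟙 E) = 𝟙 _ := Pointed.hom_ext ((res h).map_id _)
  rwa [e3] at e

lemma odotMap_res_right (D : Seq s V) {E E' : BSeq s V} (e : E ⟶ E') :
    odotMap (𝟙 (resObj h D)) (resBMap h e) ≫ resOdot h D E' =
      resOdot h D E ≫ (res h).map (odotMap (𝟙 D) e) := resOdot_natural h (𝟙 D) e

lemma odotMap_comp_left {s : SeqKind} {D D' D'' : Seq s V} (d : D ⟶ D') (d' : D' ⟶ D'')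
    (E : BSeq s V) : odotMap (d ≫ d') (𝟙 E) = odotMap d (𝟙 E) ≫ odotMap d' (𝟙 E) := by
  rw [odotMap_comp, Category.comp_id]

lemma odotMap_comp_right {s : SeqKind} (D : Seq s V) {E E' E'' : BSeq s V} (e : E ⟶ E')
    (e' : E' ⟶ E'') : odotMap (𝟙 D) (e ≫ e') = odotMap (𝟙 D) e ≫ odotMap (𝟙 D) e' := by
  rw [odotMap_comp, Category.comp_id]

lemma res_act_assoc {M : Seq s V} {C : BSeq s V} {mul : bodot C C ⟶ C} {act : odot M C ⟶ M}
    (H : odotAssoc M C C ≫ odotMap act (𝟙 C) ≫ act = odotMap (𝟙 M) mul ≫ act) :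
    odotAssoc (resObj h M) (resB h C) (resB h C) ≫
        odotMap (resOdot h M C ≫ (res h).map act) (𝟙 (resB h C)) ≫
          resOdot h M C ≫ (res h).map act =
      odotMap (𝟙 (resObj h M)) (resOdotB h C C ≫ resBMap h mul) ≫
        resOdot h M C ≫ (res h).map act := by
  have H' := congrArg (res h).map H
  rw [Functor.map_comp, Functor.map_comp, Functor.map_comp] at H'
  rw [odotMap_comp_left, Category.assoc, reassoc_of% (odotMap_res_left h act C),
    reassoc_of% (resOdot_assoc h M C C), odotMap_comp_right, Category.assoc,
    reassoc_of% (odotMap_res_right h M mul)]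
  exact congrArg (fun t => _ ≫ _ ≫ t) H'

lemma res_act_one {M : Seq s V} {C : BSeq s V} {one : unitB s V ⟶ C} {act : odot M C ⟶ M}
    (H : ∀ n : Idx s, odotRight M n ≫ (odotMap (𝟙 M) one ≫ act).natTrans.app (op n) = 𝟙 _)
    (n : Idx s') :
    odotRight (resObj h M) n ≫ (odotMap (𝟙 (resObj h M)) (resUnit h V ≫ resBMap h one) ≫
      resOdot h M C ≫ (res h).map act).natTrans.app (op n) = 𝟙 _ := by
  have e1 := resOdot_right h M n
  rw [odotMap_comp_right, Category.assoc, reassoc_of% (odotMap_res_right h M one),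
    ← Category.assoc, DayFunctor.comp_natTrans, NatTrans.comp_app, reassoc_of% e1]
  exact H ⟨n.n⟩

namespace KellyMonoid

/-- The restriction of a monoid for the Kelly product along `Σ ⟶ Λ`. -/
noncomputable def restrict (C : KellyMonoid s V) : KellyMonoid s' V where
  X := resB h C.X
  mul := resOdotB h C.X C.X ≫ resBMap h C.mul
  one := resUnit h V ≫ resBMap h C.one
  assoc := res_act_assoc h C.assoc
  one_mul := by
    obtain ⟨u, hu⟩ : ∃ u : unitSeq s V ⟶ C.X.X, u = C.one.hom := ⟨_, rfl⟩
    obtain ⟨m, hm⟩ : ∃ m : odot C.X.X C.X ⟶ C.X.X, m = C.mul.hom := ⟨_, rfl⟩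
    have H : odotLeft C.X ≫ odotMap u (𝟙 C.X) ≫ m = 𝟙 C.X.X := by
      rw [hu, hm]; exact C.one_mul
    have e := congrArg (res h).map H
    change odotLeft (resB h C.X) ≫ odotMap (resUnitHom h V ≫ (res h).map C.one.hom)
      (𝟙 (resB h C.X)) ≫ resOdot h C.X.X C.X ≫ (res h).map C.mul.hom = 𝟙 _
    rw [← hu, ← hm]
    rw [Functor.map_comp, Functor.map_comp, ← resOdot_left] at e
    rw [odotMap_comp_left, Category.assoc, reassoc_of% (odotMap_res_left h u C.X)]
    exact (congrArg (_ ≫ ·) (Category.assoc _ _ _)).symm.trans ((Category.assoc _ _ _).symm.trans e)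
  mul_one := res_act_one h C.mul_one

end KellyMonoid

namespace RightModule

/-- The forgetful functor from right `C`-modules in `Λ`-objects to right modules in `Σ`-sequences
over the restriction of `C`. The action on the restriction of `M` is the composite of the quotient
map `M ⊙_Σ C ⟶ M ⊙_Λ C` with the action `M ⊙_Λ C ⟶ M`. -/
noncomputable def restrict (C : KellyMonoid s V) :
    RightModule C ⥤ RightModule (C.restrict h) where
  obj M :=
    { X := (res h).obj M.X
      act := resOdot h M.X C.X ≫ (res h).map M.act
      assoc := res_act_assoc h M.assoc
      act_one := res_act_one h M.act_one }
  map {M N} f :=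
    { hom := (res h).map f.hom
      act_hom := by
        have e := congrArg (res h).map f.act_hom
        rw [Functor.map_comp, Functor.map_comp] at e
        refine (Category.assoc _ _ _).trans ?_
        rw [e]
        exact (reassoc_of% (odotMap_res_left h f.hom C.X)) ((res h).map N.act) |>.symm }

end RightModule

end

section

open scoped DayFunctor
open Functor.LaxMonoidal

variable {s : SeqKind}
  {V : Type u} [Category.{v} V] [MonoidalCategory V] [SymmetricCategory V] [MonoidalClosed V]
  [HasColimits V]

lemma unitSeq_whiskerRight_ext {k : Idx s} {X Z : V}
    {f g : (unitSeq s V).functor.obj (op k) ⊗ Z ⟶ X}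
    (h : ∀ a : k ⟶ ⟨1⟩, unitSeqι a ▷ Z ≫ f = unitSeqι a ▷ Z ≫ g) : f = g := by
  rw [← cancel_epi (β_ _ _).hom]
  apply MonoidalClosed.curry_injective
  apply unitSeq_ext
  intro a
  have := h a
  rw [← MonoidalClosed.curry_natural_left, ← MonoidalClosed.curry_natural_left,
    BraidedCategory.braiding_naturality_right_assoc, BraidedCategory.braiding_naturality_right_assoc,
    this]

/-- The map `unitSeq k ⊗ Z ⟶ X` given by `f a` on the summand of `a`. -/
noncomputable def unitSeqDesc₂ {k : Idx s} {X Z : V} (f : (k ⟶ (⟨1⟩ : Idx s)) → (Z ⟶ X)) :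
    (unitSeq s V).functor.obj (op k) ⊗ Z ⟶ X :=
  (β_ _ _).hom ≫ MonoidalClosed.uncurry (unitSeqDesc fun a =>
    MonoidalClosed.curry ((ρ_ Z).hom ≫ f a))

lemma unitSeqι_desc₂ {k : Idx s} {X Z : V} (f : (k ⟶ (⟨1⟩ : Idx s)) → (Z ⟶ X)) (a) :
    unitSeqι a ▷ Z ≫ unitSeqDesc₂ f = (λ_ Z).hom ≫ f a := by
  unfold unitSeqDesc₂
  rw [BraidedCategory.braiding_naturality_left_assoc, ← MonoidalClosed.uncurry_natural_left,
    unitSeqι_desc, MonoidalClosed.uncurry_curry]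
  simp

variable (E : BSeq s V)

/-- The component of the inverse of `odotLeft` at `k`. -/
noncomputable def leftComp (n : (Idx s)ᵒᵖ) (k : Idx s) :
    (unitSeq s V).functor.obj (op k) ⊗ (E.pow k.n).functor.obj n ⟶ E.X.functor.obj n :=
  unitSeqDesc₂ fun a => (E.powMap k.n 1 a).natTrans.app n ≫ (λ_ E.X).hom.natTrans.app n

lemma unitSeqι_leftComp (n : (Idx s)ᵒᵖ) {k : Idx s} (a : k ⟶ ⟨1⟩) :
    unitSeqι a ▷ (E.pow k.n).functor.obj n ≫ leftComp E n k = (λ_ _).hom ≫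
      (E.powMap k.n 1 a).natTrans.app n ≫ (λ_ E.X).hom.natTrans.app n :=
  unitSeqι_desc₂ _ a

lemma unitSeqι_leftComp_assoc : type_of% (reassoc_of% @unitSeqι_leftComp) := by
  have h := reassoc_of% @unitSeqι_leftComp
  exact @h

lemma leftComp_condition (n : (Idx s)ᵒᵖ) (i j : Idx s) (g : i ⟶ j) :
    (unitSeq s V).functor.map g.op ▷ (E.pow i.n).functor.obj n ≫ leftComp E n i =
      (unitSeq s V).functor.obj (op j) ◁ (E.powMap i.n j.n g).natTrans.app n ≫ leftComp E n j := by
  apply unitSeq_whiskerRight_ext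
  intro a
  have e := E.powMap_comp i.n j.n 1 g a
  rw [← comp_whiskerRight_assoc, unitSeqι_map, unitSeqι_leftComp, ← whisker_exchange_assoc,
    unitSeqι_leftComp, leftUnitor_naturality_assoc]
  refine congrArg (_ ≫ ·) ?_
  refine (congrArg (fun t => t.natTrans.app n ≫ (λ_ E.X).hom.natTrans.app n) e).trans ?_
  rw [DayFunctor.comp_natTrans, NatTrans.comp_app, Category.assoc]

lemma leftComp_naturality {n n' : (Idx s)ᵒᵖ} (u : n ⟶ n') (k : Idx s) :
    (unitSeq s V).functor.obj (op k) ◁ (E.pow k.n).functor.map u ≫ leftComp E n' k =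
      leftComp E n k ≫ E.X.functor.map u := by
  apply unitSeq_whiskerRight_ext
  intro a
  rw [← whisker_exchange_assoc, unitSeqι_leftComp, unitSeqι_leftComp_assoc,
    leftUnitor_naturality_assoc]
  simp only [NatTrans.naturality, NatTrans.naturality_assoc]

/-- The inverse `I_1 ⊙ E ⟶ E` of `odotLeft`. -/
noncomputable def odotLeftInv : odot (unitSeq s V) E ⟶ E.X where
  natTrans :=
    { app n := odotDesc (unitSeq s V) E (leftComp E n) (leftComp_condition E n)
      naturality n n' u := by
        apply odot_ext
        intro k
        rw [odotι_map_assoc, odotι_odotDesc, odotι_odotDesc_assoc, leftComp_naturality] }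

lemma odotι_odotLeftInv (k : Idx s) (n : (Idx s)ᵒᵖ) :
    odotι (unitSeq s V) E k n ≫ (odotLeftInv E).natTrans.app n = leftComp E n k :=
  odotι_odotDesc (unitSeq s V) E (leftComp E n) (leftComp_condition E n) k

lemma odotι_odotLeftInv_assoc : type_of% (reassoc_of% @odotι_odotLeftInv) := by
  have h := reassoc_of% @odotι_odotLeftInv
  exact @h

lemma odotLeft_odotLeftInv : odotLeft E ≫ odotLeftInv E = 𝟙 _ := by
  ext : 1
  ext n : 2
  rw [DayFunctor.comp_natTrans, NatTrans.comp_app, odotLeft_app, Category.assoc, Category.assoc,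
    odotι_odotLeftInv, MonoidalCategory.tensorHom_def', Category.assoc]
  have e := unitSeqι_leftComp E n (𝟙 (⟨1⟩ : Idx s))
  have e2 : E.powMap 1 1 (𝟙 _) = 𝟙 _ := E.powMap_id 1
  have e3 : (λ_ E.X).inv.natTrans.app n ≫ (λ_ E.X).hom.natTrans.app n = 𝟙 _ := by
    rw [← NatTrans.comp_app, ← DayFunctor.comp_natTrans]; simp
  have e4 : (E.powMap 1 1 (𝟙 _)).natTrans.app n ≫ (λ_ E.X).hom.natTrans.app n =
    (λ_ E.X).hom.natTrans.app n := by rw [e2]; exact Category.id_comp _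
  rw [e, e4, leftUnitor_naturality_assoc, Iso.inv_hom_id_assoc, e3]
  rfl

lemma odotLeftInv_odotLeft : odotLeftInv E ≫ odotLeft E = 𝟙 _ := by
  apply odot_hom_ext
  intro k n
  rw [DayFunctor.comp_natTrans, NatTrans.comp_app, odotι_odotLeftInv_assoc]
  apply unitSeq_whiskerRight_ext
  intro a
  have e3 : (λ_ E.X).hom.natTrans.app n ≫ (λ_ E.X).inv.natTrans.app n = 𝟙 _ := by
    rw [← NatTrans.comp_app, ← DayFunctor.comp_natTrans]; simp
  have e4 := odotι_condition (unitSeq s V) E a n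
  have e5 := unitSeqι_map (V := V) a (𝟙 (⟨1⟩ : Idx s))
  rw [Category.comp_id] at e5
  rw [unitSeqι_leftComp_assoc, odotLeft_app, leftUnitor_inv_naturality_assoc, ← id_tensorHom,
    tensorHom_comp_tensorHom_assoc, Category.id_comp, e3, tensorHom_id]
  have key : (λ_ ((E.pow k.n).functor.obj n)).hom ≫ (E.powMap k.n 1 a).natTrans.app n ≫
      (λ_ ((E.pow 1).functor.obj n)).inv ≫ unitSeqι (𝟙 (⟨1⟩ : Idx s)) ▷ (E.pow 1).functor.obj n ≫
        odotι (unitSeq s V) E ⟨1⟩ n =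
      unitSeqι a ▷ (E.pow k.n).functor.obj n ≫ odotι (unitSeq s V) E k n := by
    rw [leftUnitor_inv_naturality_assoc, Iso.hom_inv_id_assoc, whisker_exchange_assoc, ← e4,
      ← comp_whiskerRight_assoc, e5]
  exact key.trans (congrArg (_ ≫ ·) (Category.comp_id _).symm)

lemma odotLeftInv_odotLeft_assoc : type_of% (reassoc_of% @odotLeftInv_odotLeft) := by
  have h := reassoc_of% @odotLeftInv_odotLeft
  exact @h

lemma odotLeft_natural {E F : BSeq s V} (f : E ⟶ F) :
    f.hom ≫ odotLeft F = odotLeft E ≫ odotMap (𝟙 (unitSeq s V)) f := by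
  ext : 1
  ext n : 2
  have e1 := congrArg (fun t => DayFunctor.Hom.natTrans t |>.app n) (leftUnitor_inv_naturality f.hom)
  simp only [DayFunctor.comp_natTrans, NatTrans.comp_app] at e1
  have e2 : Pointed.powHom f 1 = 𝟙_ (Seq s V) ◁ f.hom := id_tensorHom _ _
  simp only [DayFunctor.comp_natTrans, NatTrans.comp_app, odotLeft_app, Category.assoc]
  rw [odotι_odotMap, tensorHom_comp_tensorHom_assoc, e2, ← e1, leftUnitor_inv_naturality_assoc,
    whiskerLeft_comp_tensorHom_assoc]
  exact congrArg (fun t => _ ≫ (t ⊗ₘ _) ≫ _) (Category.comp_id _).symm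

lemma odotLeftInv_natural {E F : BSeq s V} (f : E ⟶ F) :
    odotMap (𝟙 (unitSeq s V)) f ≫ odotLeftInv F = odotLeftInv E ≫ f.hom := by
  have e := odotLeftInv E ≫= odotLeft_natural f =≫ odotLeftInv F
  simp only [Category.assoc, odotLeft_odotLeftInv, odotLeftInv_odotLeft_assoc] at e
  rw [← e, Category.comp_id]

lemma leftUnitor_aux {A B C : V} (f : 𝟙_ V ⟶ A) (g : B ⟶ C) (Z : V) :
    (λ_ (B ⊗ Z)).inv ≫ (f ⊗ₘ g ▷ Z) ≫ (α_ A C Z).inv = (λ_ B).inv ▷ Z ≫ (f ⊗ₘ g) ▷ Z := by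
  rw [← tensorHom_id, associator_inv_naturality, tensorHom_id]
  simp

lemma leftUnitor_aux_assoc : type_of% (reassoc_of% @leftUnitor_aux) := by
  have h := reassoc_of% @leftUnitor_aux
  exact @h

lemma odotLeft_odotAssoc (E F : BSeq s V) :
    odotLeft (bodot E F) ≫ odotAssoc (unitSeq s V) E F = odotMap (odotLeft E) (𝟙 F) := by
  rw [← odotWhisker_eq]
  apply odot_hom_ext
  intro k n
  rw [odotι_odotWhisker, DayFunctor.comp_natTrans, NatTrans.comp_app, odotLeft_app,
    Category.assoc, Category.assoc, odotι_odotAssoc, tensorHom_comp_whiskerLeft_assoc]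
  have e1 := left_unitality_inv (odotFunctor F) E.X
  have e2 : (λ_ (odot E.X F)).inv ≫ powOdotHom E F 1 = odotWhisker (λ_ E.X).inv F := by
    refine Eq.trans ?_ e1
    rw [powOdotHom_succ]
    rfl
  have e4 : (λ_ (bodot E F).X).inv.natTrans.app n ≫ (powOdotHom E F 1).natTrans.app n =
    (odotWhisker (λ_ E.X).inv F).natTrans.app n :=
    congrArg (fun t => DayFunctor.Hom.natTrans t |>.app n) e2
  rw [e4]
  have e5 := kι_assocComp (unitSeq s V) E F ⟨1⟩ k n
  have key : odotι E.X F k n ≫ (λ_ ((odot E.X F).functor.obj n)).inv ≫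
      (unitSeqι (𝟙 (⟨1⟩ : Idx s)) ⊗ₘ (odotWhisker (λ_ E.X).inv F).natTrans.app n) ≫
        assocComp (unitSeq s V) E F ⟨1⟩ n =
      (odotLeft E).natTrans.app (op k) ▷ (F.pow k.n).functor.obj n ≫
        odotι (odot (unitSeq s V) E) F k n := by
    rw [leftUnitor_inv_naturality_assoc, whiskerLeft_comp_tensorHom_assoc, odotι_odotWhisker,
      ← tensorHom_comp_whiskerLeft_assoc, e5]
    unfold assocComp₂
    rw [odotLeft_app, leftUnitor_aux_assoc]
    simp only [comp_whiskerRight, Category.assoc]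
  exact key

lemma odotAssoc_odotLeftInv (E F : BSeq s V) :
    odotAssoc (unitSeq s V) E F ≫ odotMap (odotLeftInv E) (𝟙 F) = odotLeftInv (bodot E F) := by
  have e := odotLeftInv (bodot E F) ≫= odotLeft_odotAssoc E F =≫ odotMap (odotLeftInv E) (𝟙 F)
  rw [Category.assoc, odotLeftInv_odotLeft_assoc, ← odotMap_comp_left,
    odotLeft_odotLeftInv, odotMap_id] at e
  exact e.trans (Category.comp_id _)

lemma powMap_zeroOne (E : BSeq s V) (h : s = .lambda) :
    E.powMap 0 1 (Idx.zeroOne h) ≫ (λ_ E.X).hom = E.base h := by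
  have e : E.powMap 0 1 (Idx.zeroOne h) = 𝟙 _ ≫ (ρ_ _).inv ≫ _ ◁ E.base h := rfl
  rw [e, Category.id_comp, Category.assoc, leftUnitor_naturality, unitors_equal]
  simp

/-- The inverse of `odotLeft`, as a morphism of sequences with base maps. -/
noncomputable def odotLeftInvB (E : BSeq s V) : bodot (unitB s V) E ⟶ E where
  hom := odotLeftInv E
  base_hom h := by
    apply incUnit_hom_ext
    change incUnit V (Idx s)ᵒᵖ ≫ ((odotε E ≫ odotWhisker (unitBase V h) E) ≫
      odotLeftInv E).natTrans.app (𝟙_ (Idx s)ᵒᵖ) = _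
    simp only [DayFunctor.comp_natTrans, NatTrans.comp_app]
    rw [Category.assoc, odotε_comp_assoc, odotι_odotWhisker_assoc, odotι_odotLeftInv,
      tensorHom_comp_whiskerRight_assoc, incUnit_unitBase, MonoidalCategory.tensorHom_def',
      Category.assoc]
    have e1 := unitSeqι_leftComp E (𝟙_ (Idx s)ᵒᵖ) (Idx.zeroOne h)
    have e2 : (E.powMap 0 1 (Idx.zeroOne h)).natTrans.app (𝟙_ (Idx s)ᵒᵖ) ≫
      (λ_ E.X).hom.natTrans.app (𝟙_ (Idx s)ᵒᵖ) = (E.base h).natTrans.app (𝟙_ (Idx s)ᵒᵖ) :=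
        congrArg (fun t => DayFunctor.Hom.natTrans t |>.app (𝟙_ (Idx s)ᵒᵖ)) (powMap_zeroOne E h)
    rw [e1, e2, leftUnitor_naturality_assoc, Iso.inv_hom_id_assoc]

lemma powPt_powMap (n : Idx s) (a : n ⟶ ⟨1⟩) :
    powPt (unitB s V) (unitSeqι (𝟙 (⟨1⟩ : Idx s))) n.n ≫
      ((unitB s V).powMap n.n 1 a).natTrans.app (op n) ≫
        (λ_ (unitSeq s V)).hom.natTrans.app (op n) = unitSeqι a := by
  obtain ⟨n⟩ := n
  match n, a with
  | 0, a =>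
    have hs : s = .lambda := (Idx.hom_zero_left a).resolve_left one_ne_zero
    obtain rfl : a = Idx.zeroOne hs := Idx.hom_ext fun i => i.elim0
    have e2 : ((unitB s V).powMap 0 1 (Idx.zeroOne hs)).natTrans.app (op ⟨0⟩) ≫
      (λ_ (unitSeq s V)).hom.natTrans.app (op ⟨0⟩) = (unitBase V hs).natTrans.app (op ⟨0⟩) :=
        congrArg (fun t => DayFunctor.Hom.natTrans t |>.app (op (⟨0⟩ : Idx s)))
          (powMap_zeroOne (unitB s V) hs)
    exact (congrArg (_ ≫ ·) e2).trans (incUnit_unitBase hs)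
  | 1, a =>
    obtain rfl : a = 𝟙 _ := Idx.hom_ext fun i => Subsingleton.elim (α := Fin 1) _ _
    have e1 : ((unitB s V).powMap 1 1 (𝟙 _)).natTrans.app (op ⟨1⟩) ≫
      (λ_ (unitSeq s V)).hom.natTrans.app (op ⟨1⟩) =
        (λ_ (unitSeq s V)).hom.natTrans.app (op ⟨1⟩) := by
      rw [Pointed.powMap_id]; exact Category.id_comp _
    have e2 := inc_leftUnitor (unitSeq s V) (op (⟨1⟩ : Idx s))
    have e3 : (unitSeq s V).functor.map (λ_ (op (⟨1⟩ : Idx s))).inv = 𝟙 _ := by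
      have : (λ_ (op (⟨1⟩ : Idx s))).inv = 𝟙 _ :=
        Quiver.Hom.unop_inj (Idx.hom_ext fun i => Subsingleton.elim (α := Fin 1) _ _)
      rw [this]; exact (unitSeq s V).functor.map_id _
    rw [e3] at e2
    refine (congrArg (_ ≫ ·) e1).trans ?_
    have e4 : powPt (unitB s V) (unitSeqι (𝟙 (⟨1⟩ : Idx s))) 1 = (λ_ (𝟙_ V)).inv ≫
      𝟙_ V ◁ (unitSeqι (𝟙 (⟨1⟩ : Idx s))) ≫ incUnit V (Idx s)ᵒᵖ ▷ _ ≫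
        inc (𝟙_ _) (unitSeq s V) (op ⟨0⟩) (op ⟨1⟩) := by
      refine (powPt_succ (unitB s V) (unitSeqι (𝟙 (⟨1⟩ : Idx s))) 0).trans ?_
      rw [MonoidalCategory.tensorHom_def', Category.assoc]
      rfl
    have key : ((λ_ (𝟙_ V)).inv ≫
      𝟙_ V ◁ (unitSeqι (𝟙 (⟨1⟩ : Idx s))) ≫ incUnit V (Idx s)ᵒᵖ ▷ _ ≫
        inc (𝟙_ _) (unitSeq s V) (op ⟨0⟩) (op ⟨1⟩)) ≫
      (λ_ (unitSeq s V)).hom.natTrans.app (𝟙_ (Idx s)ᵒᵖ ⊗ op ⟨1⟩) = unitSeqι (𝟙 (⟨1⟩ : Idx s)) := by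
      simp only [Category.assoc]
      refine (congrArg (fun t => _ ≫ _ ≫ t) e2).trans ?_
      rw [leftUnitor_naturality_assoc, Iso.inv_hom_id_assoc, Category.comp_id]
    exact (congrArg (· ≫ _) e4).trans key
  | n + 2, a =>
    exact absurd (a.inj (a₁ := 0) (a₂ := 1) (Subsingleton.elim (α := Fin 1) _ _)) (by simp)

variable (s V) in
/-- The unit `I_1` as a monoid for the Kelly product. -/
noncomputable def unitMonoid : KellyMonoid s V where
  X := unitB s V
  mul := odotLeftInvB (unitB s V)
  one := 𝟙 _
  assoc := by
    have e := odotLeftInv_natural (odotLeftInvB (unitB s V))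
    refine Eq.trans ?_ e.symm
    exact (Category.assoc _ _ _).symm.trans
      (congrArg (· ≫ _) (odotAssoc_odotLeftInv (unitB s V) (unitB s V)))
  one_mul := by
    refine (congrArg (_ ≫ ·) ((congrArg (· ≫ _) (odotMap_id _ _)).trans (Category.id_comp _))).trans ?_
    exact odotLeft_odotLeftInv (unitB s V)
  mul_one n := by
    have e1 : odotMap (𝟙 (unitSeq s V)) (𝟙 (unitB s V)) ≫ odotLeftInv (unitB s V) =
      odotLeftInv (unitB s V) := (congrArg (· ≫ _) (odotMap_id _ _)).trans (Category.id_comp _)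
    change odotRight (unitSeq s V) n ≫ (odotMap (𝟙 (unitSeq s V)) (𝟙 (unitB s V)) ≫
      odotLeftInv (unitB s V)).natTrans.app (op n) = _
    rw [e1]
    apply unitSeq_ext
    intro a
    unfold odotRight
    rw [Category.assoc, Category.assoc, odotι_odotLeftInv, rightUnitor_inv_naturality_assoc,
      ← whisker_exchange_assoc, unitSeqι_leftComp, leftUnitor_naturality_assoc]
    have e2 := powPt_powMap (V := V) n a
    rw [e2, unitors_equal, Iso.inv_hom_id_assoc]
    exact (Category.comp_id _).symm

end

/-- A functor is an isomorphism of categories if it has a strict two-sided inverse. -/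
def IsIsoOfCategories {A : Type u} [Category.{v} A] {B : Type u'} [Category.{v'} B]
    (F : A ⥤ B) : Prop :=
  ∃ G : B ⥤ A, F ⋙ G = 𝟭 A ∧ G ⋙ F = 𝟭 B

section

variable (V : Type u) [Category.{v} V] [MonoidalCategory V] [SymmetricCategory V]
  [MonoidalClosed V] [HasColimits V]

/-- `Λ`-objects in `V`. -/
abbrev LambdaObj := Seq .lambda V

/-- `Σ`-objects (`Σ`-sequences) in `V`. -/
abbrev SigmaObj := Seq .sigma V

/-- Based operads in `V`: monoids in `Λ`-sequences for the Kelly product `⊙_Λ`. -/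
abbrev BasedOperad := KellyMonoid .lambda V

/-- Operads in `V`: monoids in `Σ`-sequences for the Kelly product `⊙_Σ`. -/
abbrev Operad := KellyMonoid .sigma V

/-- The forgetful functor from `Λ`-objects to `Σ`-objects. -/
abbrev LambdaObj.toSigma : LambdaObj V ⥤ SigmaObj V := res fun _ => rfl

variable {V}

/-- The operad underlying a based operad. -/
noncomputable abbrev BasedOperad.toOperad (C : BasedOperad V) : Operad V :=
  KellyMonoid.restrict (fun _ => rfl) C

/-- The forgetful functor from right `C`-modules in `Λ`-objects to right `C`-modules in
`Σ`-objects. -/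
noncomputable abbrev BasedOperad.modulesToSigma (C : BasedOperad V) :
    RightModule C ⥤ RightModule C.toOperad := RightModule.restrict (fun _ => rfl) C

variable (V) in
/-- The based operad `I_1`, the unit for `⊙_Λ`. -/
noncomputable abbrev unitOperad : BasedOperad V := unitMonoid .lambda V

end

end Kelly

/-!
A right module over a monoid `C` for the Kelly product amounts to objects `M n` with associative
and unital action maps `M k ⊗ C^{⊠ k} n ⟶ M n`; functoriality of `M` need not be imposed. Indeed
the unit of `C` and, if there is one, its base map give for every morphism `f : m ⟶ n` of the
indexing category a point `1_f` of `C^{⊠ n} m` (`KellyMonoid.ptMap`), and unitality says that the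
action of `1_f` on `M n` is the map `M f` (`RightModule.actι_ptMap`). Conversely, composition with
`1_f` on either side is the functoriality of `C^{⊠ k} n` in `n` and in `k`
(`KellyMonoid.comp_ptMap`, `KellyMonoid.ptMap_comp`), so associative and unital action maps define
a functor `M`, and they are then natural and factor through the coend (`ActionMaps.toModule`).
Likewise a family of maps that commutes with the action maps is natural
(`RightModule.homOfActι`). The associativity axiom becomes a condition on action maps
(`KellyMonoid.act_assoc_iff`) because `- ⊙ C` preserves Day convolution (`isIso_kellyμ`,
`isIso_kellyε`), so that `(C ⊙ C)^{⊠ k}` is isomorphic to `C^{⊠ k} ⊙ C` and `C` composes with its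
tensor powers.

This description is the same over `Λ` and over `Σ`, since restriction to `Σ` commutes with Day
convolution (`isIso_resμ`, `isIso_resPow`): a based injection `n ⟶ a ∨ b` is a bijection
`n ⟶ a' ∨ b'` followed by a wedge of injections, uniquely up to bijections of `a'` and `b'`. Hence
the action maps of a module in `Σ`-sequences are those of a unique module in `Λ`-objects
(`RightModule.extend`), and the forgetful functor is fully faithful.

For `C = I_1` the object `I_1^{⊠ k} n` is the coproduct of copies of the unit object indexed by the
morphisms `f : n ⟶ k`, with inclusions the points `1_f`. By `RightModule.actι_ptMap` an action of
`I_1` is thus determined by the underlying functor (`unitPow_ext`), and every functor has one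
(`unitActionMaps`).

An isomorphism of categories demands equality of objects. It is obtained from fully faithfulness
and bijectivity on objects (`IsIsoOfCategories.of_fullyFaithful`), where two modules are equal as
soon as some morphism between them has identities as components (`RightModule.eq_of_hom`).
-/

namespace Kelly

/-! ### Isomorphisms of categories -/

section

variable {A : Type u} [Category.{v} A] {B : Type u'} [Category.{v'} B]
  {A' : Type*} [Category A']

/-- A fully faithful functor that is bijective on objects is an isomorphism of categories. -/
lemma IsIsoOfCategories.of_fullyFaithful (F : A ⥤ B) [F.Full] [F.Faithful]
    (hF : Function.Bijective F.obj) : IsIsoOfCategories F := by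
  let e := Equiv.ofBijective F.obj hF
  have he (b : B) : F.obj (e.symm b) = b := e.apply_symm_apply b
  have he' (a : A) : e.symm (F.obj a) = a := e.symm_apply_apply a
  let G : B ⥤ A :=
    { obj := e.symm
      map {b b'} f := F.preimage (eqToHom (he b) ≫ f ≫ eqToHom (he b').symm)
      map_id b := F.map_injective (by simp)
      map_comp f g := F.map_injective (by simp) }
  refine ⟨G, CategoryTheory.Functor.ext he' fun a a' f => ?_,
    CategoryTheory.Functor.ext he fun b b' f => ?_⟩
  · apply F.map_injective
    simp [G, eqToHom_map]
  · simp [G]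

lemma IsIsoOfCategories.comp {F : A ⥤ B} {G : B ⥤ A'} (hF : IsIsoOfCategories F)
    (hG : IsIsoOfCategories G) : IsIsoOfCategories (F ⋙ G) := by
  obtain ⟨F', h1, h2⟩ := hF
  obtain ⟨G', h3, h4⟩ := hG
  refine ⟨G' ⋙ F', ?_, ?_⟩
  · rw [CategoryTheory.Functor.assoc, ← CategoryTheory.Functor.assoc G, h3, Functor.id_comp, h1]
  · rw [CategoryTheory.Functor.assoc, ← CategoryTheory.Functor.assoc F', h2, Functor.id_comp, h4]

end

section

open scoped DayFunctor

variable {s : SeqKind} {V : Type u} [Category.{v} V] [MonoidalCategory V] [SymmetricCategory V]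
  [MonoidalClosed V] [HasColimits V]

/-- Two right modules are equal if there is a morphism between them all of whose components are
identities. -/
lemma RightModule.eq_of_hom {C : KellyMonoid s V} {M N : RightModule C} (φ : M ⟶ N)
    (hobj : ∀ n, M.X.functor.obj n = N.X.functor.obj n)
    (hφ : ∀ n, φ.hom.natTrans.app n = eqToHom (hobj n)) : M = N := by
  have key : ∀ (D D' : Seq s V) (f : D ⟶ D') (hobj : ∀ n, D.functor.obj n = D'.functor.obj n)
      (hf : ∀ n, f.natTrans.app n = eqToHom (hobj n)), ∃ e : D = D', f = eqToHom e := by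
    rintro ⟨D⟩ ⟨D'⟩ f hobj hf
    have e : D = D' := CategoryTheory.Functor.ext hobj fun n m u => by
      have := f.natTrans.naturality u
      rw [hf, hf] at this
      exact ((comp_eqToHom_iff _ _ _).1 this).trans (Category.assoc _ _ _)
    subst e
    refine ⟨rfl, ?_⟩
    ext : 1
    ext n : 2
    exact hf n
  obtain ⟨X, act, assoc, act_one⟩ := M
  obtain ⟨X', act', assoc', act_one'⟩ := N
  obtain ⟨e, hf⟩ := key X X' φ.hom hobj hφ
  subst e
  have h := φ.act_hom
  rw [hf] at h
  have h : act = act' := by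
    refine (Category.comp_id _).symm.trans (h.trans ?_)
    exact (congrArg (· ≫ act') (odotMap_id X C.X)).trans (Category.id_comp _)
  subst h
  rfl

end

/-! ### Factorization of based injections -/

lemma exists_equiv_of_range_eq {A B X : Type*} {f : A → X} {g : B → X}
    (hf : Function.Injective f) (hg : Function.Injective g) (h : Set.range f = Set.range g) :
    ∃ e : A ≃ B, ∀ a, g (e a) = f a := by
  refine ⟨(Equiv.ofInjective f hf).trans ((Equiv.setCongr h).trans (Equiv.ofInjective g hg).symm),
    fun a => ?_⟩
  exact Equiv.apply_ofInjective_symm hg _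

namespace Idx

/-- A bijection, as a morphism of `Σ` or of `Λ`. -/
def homOfEquiv {s : SeqKind} {k l : ℕ} (e : Fin k ≃ Fin l) : (⟨k⟩ : Idx s) ⟶ ⟨l⟩ :=
  ⟨e, e.injective, fun _ => e.bijective⟩

/-- The condition under which `inclMap`, `incl` and `res` are defined, for the inclusion
`Σ ⟶ Λ`. -/
abbrev sigmaToLambda : SeqKind.sigma = .lambda → SeqKind.lambda = .lambda := fun _ => rfl

lemma wedge_castAdd_mem_range {s : SeqKind} {a a' b b' : Idx s} (f : a ⟶ a') (g : b ⟶ b')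
    (i : Fin a'.n) : Fin.castAdd b'.n i ∈ Set.range (wedge f g).toFun ↔ i ∈ Set.range f.toFun := by
  constructor
  · rintro ⟨j, hj⟩
    induction j using Fin.addCases with
    | left j => exact ⟨j, by rw [wedge_castAdd] at hj; exact Fin.castAdd_injective _ _ hj⟩
    | right j =>
      rw [wedge_natAdd] at hj
      have := congrArg Fin.val hj
      simp only [Fin.val_natAdd, Fin.val_castAdd] at this
      omega
  · rintro ⟨j, rfl⟩
    exact ⟨Fin.castAdd _ j, wedge_castAdd _ _ _⟩

lemma wedge_natAdd_mem_range {s : SeqKind} {a a' b b' : Idx s} (f : a ⟶ a') (g : b ⟶ b')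
    (i : Fin b'.n) : Fin.natAdd a'.n i ∈ Set.range (wedge f g).toFun ↔ i ∈ Set.range g.toFun := by
  constructor
  · rintro ⟨j, hj⟩
    induction j using Fin.addCases with
    | right j => exact ⟨j, by rw [wedge_natAdd] at hj; exact Fin.natAdd_injective _ _ hj⟩
    | left j =>
      rw [wedge_castAdd] at hj
      have := congrArg Fin.val hj
      simp only [Fin.val_natAdd, Fin.val_castAdd] at this
      omega
  · rintro ⟨j, rfl⟩
    exact ⟨Fin.natAdd _ j, wedge_natAdd _ _ _⟩

lemma range_comp_of_surjective {s : SeqKind} {a b c : Idx s} (f : a ⟶ b) (g : b ⟶ c)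
    (hf : Function.Surjective f.toFun) : Set.range (f ≫ g).toFun = Set.range g.toFun :=
  hf.range_comp g.toFun

/-- Every based injection `n ⟶ a ∨ b` is a bijection `n ⟶ a' ∨ b'` followed by a wedge of
injections. -/
lemma exists_wedge_factorization {n a b : ℕ} (g : (⟨n⟩ : Idx .lambda) ⟶ ⟨a + b⟩) :
    ∃ (a' b' : ℕ) (β : (⟨n⟩ : Idx .sigma) ⟶ ⟨a' + b'⟩) (u : (⟨a'⟩ : Idx .lambda) ⟶ ⟨a⟩)
      (v : (⟨b'⟩ : Idx .lambda) ⟶ ⟨b⟩), inclMap sigmaToLambda β ≫ wedge u v = g := by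
  classical
  have key : ∀ (m : ℕ) (S : Set (Fin m)), ∃ (m' : ℕ) (u : (⟨m'⟩ : Idx .lambda) ⟶ ⟨m⟩),
      Set.range u.toFun = S := by
    intro m S
    refine ⟨Fintype.card S, ⟨fun i => ((Fintype.equivFin S).symm i).1,
      Subtype.val_injective.comp (Equiv.injective _), fun h => by cases h⟩, ?_⟩
    change Set.range (Subtype.val ∘ (Fintype.equivFin S).symm) = S
    rw [(Fintype.equivFin S).symm.surjective.range_comp, Subtype.range_val]
  -- The two injections enumerate the parts of the image of `g` that lie in `a` and in `b`.
  obtain ⟨a', u, hu⟩ := key a {i | Fin.castAdd b i ∈ Set.range g.toFun}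
  obtain ⟨b', v, hv⟩ := key b {i | Fin.natAdd a i ∈ Set.range g.toFun}
  have hr : Set.range g.toFun = Set.range (wedge u v).toFun := by
    ext (i : Fin (a + b))
    induction i using Fin.addCases with
    | left i => exact (Set.ext_iff.1 hu i).symm.trans (wedge_castAdd_mem_range u v i).symm
    | right i => exact (Set.ext_iff.1 hv i).symm.trans (wedge_natAdd_mem_range u v i).symm
  obtain ⟨e, he⟩ := exists_equiv_of_range_eq g.inj (wedge u v).inj hr
  exact ⟨a', b', homOfEquiv e, u, v, hom_ext he⟩

/-- The factorization of `exists_wedge_factorization` is unique up to a pair of bijections. -/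
lemma wedge_factorization_unique {n a b a₁ b₁ a₂ b₂ : ℕ}
    (β₁ : (⟨n⟩ : Idx .sigma) ⟶ ⟨a₁ + b₁⟩) (u₁ : (⟨a₁⟩ : Idx .lambda) ⟶ ⟨a⟩)
    (v₁ : (⟨b₁⟩ : Idx .lambda) ⟶ ⟨b⟩)
    (β₂ : (⟨n⟩ : Idx .sigma) ⟶ ⟨a₂ + b₂⟩) (u₂ : (⟨a₂⟩ : Idx .lambda) ⟶ ⟨a⟩)
    (v₂ : (⟨b₂⟩ : Idx .lambda) ⟶ ⟨b⟩)
    (h : inclMap sigmaToLambda β₁ ≫ wedge u₁ v₁ = inclMap sigmaToLambda β₂ ≫ wedge u₂ v₂) :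
    ∃ (p : (⟨a₂⟩ : Idx .sigma) ⟶ ⟨a₁⟩) (q : (⟨b₂⟩ : Idx .sigma) ⟶ ⟨b₁⟩),
      inclMap sigmaToLambda p ≫ u₁ = u₂ ∧ inclMap sigmaToLambda q ≫ v₁ = v₂ ∧
        β₂ ≫ wedge p q = β₁ := by
  have hr : Set.range (wedge u₂ v₂).toFun = Set.range (wedge u₁ v₁).toFun := by
    have h1 := range_comp_of_surjective (inclMap sigmaToLambda β₁) (wedge u₁ v₁) (β₁.bij rfl).2
    have h2 := range_comp_of_surjective (inclMap sigmaToLambda β₂) (wedge u₂ v₂) (β₂.bij rfl).2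
    rw [← h1, ← h2, h]
  obtain ⟨p, hp⟩ := exists_equiv_of_range_eq u₂.inj u₁.inj (Set.ext fun i => by
    rw [← wedge_castAdd_mem_range u₂ v₂, ← wedge_castAdd_mem_range u₁ v₁, hr])
  obtain ⟨q, hq⟩ := exists_equiv_of_range_eq v₂.inj v₁.inj (Set.ext fun i => by
    rw [← wedge_natAdd_mem_range u₂ v₂, ← wedge_natAdd_mem_range u₁ v₁, hr])
  have hp' : inclMap sigmaToLambda (homOfEquiv p) ≫ u₁ = u₂ := hom_ext hp
  have hq' : inclMap sigmaToLambda (homOfEquiv q) ≫ v₁ = v₂ := hom_ext hq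
  -- The equation on bijections may be checked after composition with the injection `u₁ ∨ v₁`.
  refine ⟨homOfEquiv p, homOfEquiv q, hp', hq', hom_ext fun i => (wedge u₁ v₁).inj ?_⟩
  have e1 : wedge (inclMap sigmaToLambda (homOfEquiv p) ≫ u₁)
      (inclMap sigmaToLambda (homOfEquiv q) ≫ v₁) =
      inclMap sigmaToLambda (wedge (homOfEquiv p) (homOfEquiv q)) ≫ wedge u₁ v₁ :=
    (tensorHom_comp_tensorHom (inclMap sigmaToLambda (homOfEquiv p))
      (inclMap sigmaToLambda (homOfEquiv q)) u₁ v₁).symm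
  rw [hp', hq'] at e1
  have e2 := congrArg (fun t : (⟨n⟩ : Idx .lambda) ⟶ ⟨a + b⟩ => Hom.toFun t i) h
  rw [e1] at e2
  exact e2.symm

end Idx

/-! ### Restriction to `Σ` commutes with Day convolution -/

section

open CategoryTheory.Functor
open scoped DayFunctor ExternalProduct

/-- The square expressing that the inclusion `Σ ⟶ Λ` preserves wedges. -/
def wedgeSquare : TwoSquare
    ((Idx.incl Idx.sigmaToLambda).op.prod (Idx.incl Idx.sigmaToLambda).op)
    (tensor (Idx .sigma)ᵒᵖ) (tensor (Idx .lambda)ᵒᵖ) (Idx.incl Idx.sigmaToLambda).op where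
  app X := 𝟙 (op (⟨X.1.unop.n + X.2.unop.n⟩ : Idx .lambda))
  naturality X Y f := by
    refine (Category.comp_id _).trans (Eq.trans ?_ (Category.id_comp _).symm)
    apply Quiver.Hom.unop_inj
    rfl

/-- The square expressing that the inclusion `Σ ⟶ Λ` preserves the unit of the wedge. -/
def unitSquare : TwoSquare (𝟭 (Discrete PUnit.{1}))
    (Functor.fromPUnit.{0} (𝟙_ (Idx .sigma)ᵒᵖ)) (Functor.fromPUnit.{0} (𝟙_ (Idx .lambda)ᵒᵖ))
    (Idx.incl Idx.sigmaToLambda).op where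
  app X := 𝟙 (op (⟨0⟩ : Idx .lambda))

open TwoSquare in
/-- Exactness says that the categories of factorizations of based injections `n ⟶ a ∨ b` are
connected. -/
instance : wedgeSquare.GuitartExact := by
  rw [guitartExact_iff_isConnected_rightwards]
  rintro ⟨⟨⟨a⟩⟩, ⟨⟨b⟩⟩⟩ ⟨⟨n⟩⟩ g
  obtain ⟨g', hg⟩ : ∃ g' : (⟨n⟩ : Idx .lambda) ⟶ ⟨a + b⟩, g' = g.unop := ⟨g.unop, rfl⟩
  have : Nonempty (wedgeSquare.StructuredArrowRightwards g) := by
    obtain ⟨a', b', β, u, v, h⟩ := Idx.exists_wedge_factorization g'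
    refine ⟨StructuredArrowRightwards.mk wedgeSquare g (op ⟨a'⟩, op ⟨b'⟩) (u.op, v.op) β.op ?_⟩
    apply Quiver.Hom.unop_inj
    exact h.trans hg
  apply zigzag_isConnected
  intro X Y
  obtain ⟨⟨⟨⟨a₁⟩⟩, ⟨⟨b₁⟩⟩⟩, ⟨u₁, v₁⟩, β₁, h₁, rfl⟩ := StructuredArrowRightwards.mk_surjective X
  obtain ⟨⟨⟨⟨a₂⟩⟩, ⟨⟨b₂⟩⟩⟩, ⟨u₂, v₂⟩, β₂, h₂, rfl⟩ := StructuredArrowRightwards.mk_surjective Y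
  have h₁' : Idx.inclMap Idx.sigmaToLambda β₁.unop ≫ Idx.wedge u₁.unop v₁.unop = g' :=
    (congrArg Quiver.Hom.unop h₁).trans hg.symm
  have h₂' : Idx.inclMap Idx.sigmaToLambda β₂.unop ≫ Idx.wedge u₂.unop v₂.unop = g' :=
    (congrArg Quiver.Hom.unop h₂).trans hg.symm
  obtain ⟨p, q, hp, hq, hpq⟩ := Idx.wedge_factorization_unique _ _ _ _ _ _ (h₁'.trans h₂'.symm)
  refine Zigzag.of_hom (StructuredArrow.homMk (CostructuredArrow.homMk (p.op, q.op) ?_) ?_)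
  · apply Quiver.Hom.unop_inj
    exact hpq
  · ext : 1
    exact Prod.ext (Quiver.Hom.unop_inj hp) (Quiver.Hom.unop_inj hq)

open TwoSquare in
instance : unitSquare.GuitartExact := by
  rw [guitartExact_iff_isConnected_rightwards]
  rintro ⟨⟨⟩⟩ ⟨⟨n⟩⟩ g
  obtain rfl : n = 0 := by
    rcases n with _ | n
    · rfl
    · exact (Idx.hom_zero_right (s := .lambda) g.unop).elim
  have : Nonempty (unitSquare.StructuredArrowRightwards g) := by
    refine ⟨StructuredArrowRightwards.mk unitSquare g ⟨⟨⟩⟩ (𝟙 _)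
      (𝟙 (⟨0⟩ : Idx .sigma)).op ?_⟩
    apply Quiver.Hom.unop_inj
    exact Idx.hom_ext fun i => i.elim0
  apply zigzag_isConnected
  intro X Y
  obtain ⟨⟨⟨⟩⟩, u₁, β₁, h₁, rfl⟩ := StructuredArrowRightwards.mk_surjective X
  obtain ⟨⟨⟨⟩⟩, u₂, β₂, h₂, rfl⟩ := StructuredArrowRightwards.mk_surjective Y
  refine Zigzag.of_hom (StructuredArrow.homMk (CostructuredArrow.homMk (𝟙 _) ?_) ?_)
  · apply Quiver.Hom.unop_inj
    exact Idx.hom_ext fun i => i.elim0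
  · ext : 1
    exact Subsingleton.elim _ _

/-- A morphism between two left Kan extensions that respects their units is an isomorphism. -/
lemma isIso_of_comp_isLeftKanExtension {C D H : Type*} [Category C] [Category D] [Category H]
    {L : C ⥤ D} {F : C ⥤ H} {G G' : D ⥤ H} (α : F ⟶ L ⋙ G) (β : F ⟶ L ⋙ G')
    [G.IsLeftKanExtension α] [G'.IsLeftKanExtension β] (t : G ⟶ G')
    (ht : α ≫ whiskerLeft L t = β) : IsIso t := by
  have e : t = (G.leftKanExtensionUnique α G' β).hom := by
    apply G.hom_ext_of_isLeftKanExtension α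
    rw [ht]
    simp
  rw [e]
  infer_instance

end

section

open CategoryTheory.Functor
open scoped DayFunctor ExternalProduct
open LawfulDayConvolutionMonoidalCategoryStruct

variable {V : Type u} [Category.{v} V] [MonoidalCategory V] [SymmetricCategory V]
  [MonoidalClosed V] [HasColimits V]

lemma isIso_of_isIso_natTrans {C : Type*} [Category C] [MonoidalCategory C] {F G : C ⊛⥤ V}
    (f : F ⟶ G) [IsIso f.natTrans] : IsIso f :=
  ⟨⟨inv f.natTrans⟩, by ext : 1; exact IsIso.hom_inv_id f.natTrans,
    by ext : 1; exact IsIso.inv_hom_id f.natTrans⟩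

instance {C : Type*} [Category C] [MonoidalCategory C] {F G : C ⊛⥤ V}
    (f : F ⟶ G) [IsIso f] : IsIso f.natTrans :=
  ⟨⟨(inv f).natTrans, congrArg DayFunctor.Hom.natTrans (IsIso.hom_inv_id f),
    congrArg DayFunctor.Hom.natTrans (IsIso.inv_hom_id f)⟩⟩

/-- Restriction to `Σ` commutes with Day convolution. -/
instance isIso_resμ (D D' : Seq .lambda V) : IsIso (resμ Idx.sigmaToLambda D D') := by
  let E := LeftExtension.mk (D ⊗ D').functor (DayFunctor.η D D')
  have hE : E.IsPointwiseLeftKanExtension :=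
    isPointwiseLeftKanExtensionConvolutionExtensionUnit D D'
  -- Composition with an exact square turns pointwise Kan extensions into Kan extensions.
  have hE' := (hE.compTwoSquare wedgeSquare).isLeftKanExtension
  have : IsIso (resμ Idx.sigmaToLambda D D').natTrans := by
    let β : (resObj Idx.sigmaToLambda D).functor ⊠ (resObj Idx.sigmaToLambda D').functor ⟶
        tensor (Idx .sigma)ᵒᵖ ⋙ (resObj Idx.sigmaToLambda (D ⊗ D')).functor :=
      (E.compTwoSquare wedgeSquare).hom
    have : (resObj Idx.sigmaToLambda (D ⊗ D')).functor.IsLeftKanExtension β := hE'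
    refine isIso_of_comp_isLeftKanExtension (DayFunctor.η _ _) β _ ?_
    ext ⟨x, y⟩
    refine (inc_resμ Idx.sigmaToLambda D D' x y).trans ?_
    refine (Category.comp_id _).symm.trans (congrArg (_ ≫ ·) ?_)
    exact ((Category.id_comp _).trans ((Category.comp_id _).trans
      ((D ⊗ D').functor.map_id (op (⟨x.unop.n + y.unop.n⟩ : Idx .lambda))))).symm
  exact isIso_of_isIso_natTrans _

instance isIso_resε : IsIso (resε (V := V) Idx.sigmaToLambda) := by
  let E := LeftExtension.mk (𝟙_ (Seq .lambda V)).functor (DayFunctor.νNatTrans (Idx .lambda)ᵒᵖ V)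
  have hE : E.IsPointwiseLeftKanExtension :=
    isPointwiseLeftKanExtensionUnitUnit (Idx .lambda)ᵒᵖ V (Seq .lambda V)
  have hE' := (hE.compTwoSquare unitSquare).isLeftKanExtension
  have : IsIso (resε (V := V) Idx.sigmaToLambda).natTrans := by
    let β : Functor.fromPUnit.{0} (𝟙_ V) ⟶ Functor.fromPUnit.{0} (𝟙_ (Idx .sigma)ᵒᵖ) ⋙
        (resObj Idx.sigmaToLambda (𝟙_ (Seq .lambda V))).functor :=
      (E.compTwoSquare unitSquare).hom
    have : (resObj Idx.sigmaToLambda (𝟙_ (Seq .lambda V))).functor.IsLeftKanExtension β := hE'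
    refine isIso_of_comp_isLeftKanExtension (DayFunctor.νNatTrans _ _) β _ ?_
    ext
    refine (incUnit_resε Idx.sigmaToLambda).trans ?_
    refine (Category.comp_id _).symm.trans (congrArg (_ ≫ ·) ?_)
    exact ((Category.id_comp _).trans ((Category.comp_id _).trans
      ((𝟙_ (Seq .lambda V)).functor.map_id (op (⟨0⟩ : Idx .lambda))))).symm
  exact isIso_of_isIso_natTrans _

/-- The restriction to `Σ` of `E^{⊠ k}` is the `k`-th tensor power of the restriction of `E`. -/
instance isIso_resPow (E : BSeq .lambda V) (k : ℕ) : IsIso (resPow Idx.sigmaToLambda E k) := by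
  induction k with
  | zero => exact isIso_resε
  | succ k ih =>
    rw [resPow_succ]
    have : IsIso (resPow Idx.sigmaToLambda E k ▷ resObj Idx.sigmaToLambda E.X) := inferInstance
    exact IsIso.comp_isIso' this (isIso_resμ (E.pow k) E.X)

end

/-! ### The functors `- ⊙ P` preserve Day convolution -/

section

open scoped DayFunctor
open Functor.LaxMonoidal

variable {V : Type u} [Category.{v} V] [MonoidalCategory V] [SymmetricCategory V]
  [MonoidalClosed V] [HasColimits V]
  {K : Type} [Category.{0} K] [MonoidalCategory K]
  {C : Type} [Category.{0} C] [MonoidalCategory C]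

/-- The functor `c ↦ [Z, G c]`. -/
noncomputable def ihomDay (Z : V) (G : C ⊛⥤ V) : C ⊛⥤ V where
  functor := G.functor ⋙ ihom Z

/-- Maps `Z ⊗ (F ⊠ F') c ⟶ G c`, natural in `c`, induced by a natural family of maps
`Z ⊗ (F x ⊗ F' y) ⟶ G (x ⊗ y)`. -/
noncomputable def dayDescLeft {F F' G : C ⊛⥤ V} {Z : V}
    (f : ∀ x y : C, Z ⊗ (F.functor.obj x ⊗ F'.functor.obj y) ⟶ G.functor.obj (x ⊗ y))
    (hf : ∀ (x x' y y' : C) (a : x ⟶ x') (b : y ⟶ y'),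
      Z ◁ (F.functor.map a ⊗ₘ F'.functor.map b) ≫ f x' y' = f x y ≫ G.functor.map (a ⊗ₘ b))
    (c : C) : Z ⊗ (F ⊗ F').functor.obj c ⟶ G.functor.obj c :=
  MonoidalClosed.uncurry ((dayDesc (H := ihomDay Z G) (fun x y => MonoidalClosed.curry (f x y))
    (fun x x' y y' a b => by
      refine (MonoidalClosed.curry_natural_left _ _).symm.trans ?_
      rw [hf]
      exact MonoidalClosed.curry_natural_right _ _)).natTrans.app c)

section

variable {F F' G : C ⊛⥤ V} {Z : V}
    (f : ∀ x y : C, Z ⊗ (F.functor.obj x ⊗ F'.functor.obj y) ⟶ G.functor.obj (x ⊗ y))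
    (hf : ∀ (x x' y y' : C) (a : x ⟶ x') (b : y ⟶ y'),
      Z ◁ (F.functor.map a ⊗ₘ F'.functor.map b) ≫ f x' y' = f x y ≫ G.functor.map (a ⊗ₘ b))

lemma inc_dayDescLeft (x y : C) : Z ◁ inc F F' x y ≫ dayDescLeft f hf (x ⊗ y) = f x y := by
  refine (MonoidalClosed.uncurry_natural_left _ _).symm.trans ?_
  refine (congrArg MonoidalClosed.uncurry (inc_dayDesc (H := ihomDay Z G) _ _ x y)).trans ?_
  exact MonoidalClosed.uncurry_curry _

lemma dayDescLeft_naturality {c c' : C} (u : c ⟶ c') :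
    Z ◁ (F ⊗ F').functor.map u ≫ dayDescLeft f hf c' = dayDescLeft f hf c ≫ G.functor.map u := by
  refine (MonoidalClosed.uncurry_natural_left _ _).symm.trans ?_
  exact (congrArg (MonoidalClosed.uncurry (A := Z)) (NatTrans.naturality (DayFunctor.Hom.natTrans
    (dayDesc (H := ihomDay Z G) _ _)) u)).trans (MonoidalClosed.uncurry_natural_right _ _)

end

/-- The contravariant functor `k ↦ [P k c, X]`. -/
noncomputable def ihomSeq (P : K ⥤ C ⊛⥤ V) (c : C) (X : V) : Kᵒᵖ ⊛⥤ V where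
  functor :=
    { obj k := (ihom ((P.obj k.unop).functor.obj c)).obj X
      map u := (MonoidalClosed.pre ((P.map u.unop).natTrans.app c)).app X
      map_id k := by
        have : (P.map (𝟙 k.unop)).natTrans.app c = 𝟙 _ := by rw [P.map_id]; rfl
        rw [unop_id, this, MonoidalClosed.pre_id]; rfl
      map_comp u w := by
        have : (P.map (w.unop ≫ u.unop)).natTrans.app c =
          (P.map w.unop).natTrans.app c ≫ (P.map u.unop).natTrans.app c := by rw [P.map_comp]; rfl
        rw [unop_comp, this, MonoidalClosed.pre_map]; rfl }

/-- Maps `(D ⊙ P) c ⟶ X` correspond to natural transformations from `D` to `k ↦ [P k c, X]`. -/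
noncomputable def kellyDescHom {D : Kᵒᵖ ⊛⥤ V} {P : K ⥤ C ⊛⥤ V} {c : C} {X : V}
    (φ : D ⟶ ihomSeq P c X) : (kelly D P).functor.obj c ⟶ X :=
  kellyDesc (fun k => (β_ _ _).hom ≫ MonoidalClosed.uncurry (φ.natTrans.app (op k)))
    (fun i j g => by
      have e := congrArg MonoidalClosed.uncurry (φ.natTrans.naturality g.op)
      have e1 := (MonoidalClosed.uncurry_natural_left (D.functor.map g.op)
        (φ.natTrans.app (op i))).symm.trans e
      have e2 : MonoidalClosed.uncurry (φ.natTrans.app (op j) ≫ (ihomSeq P c X).functor.map g.op) =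
          (P.map g).natTrans.app c ▷ _ ≫ MonoidalClosed.uncurry (φ.natTrans.app (op j)) :=
        MonoidalClosed.uncurry_pre_app _ _ _
      rw [BraidedCategory.braiding_naturality_left_assoc,
        BraidedCategory.braiding_naturality_right_assoc]
      exact congrArg (_ ≫ ·) (e1.trans e2))

lemma kι_kellyDescHom {D : Kᵒᵖ ⊛⥤ V} {P : K ⥤ C ⊛⥤ V} {c : C} {X : V}
    (φ : D ⟶ ihomSeq P c X) (k : K) : kι D P k c ≫ kellyDescHom φ =
      (β_ _ _).hom ≫ MonoidalClosed.uncurry (φ.natTrans.app (op k)) := kι_kellyDesc _ _ k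

section

variable {D D' : Kᵒᵖ ⊛⥤ V} {P : K ⥤ C ⊛⥤ V} {c : C} {X : V}

/-- A map out of `((D ⊠ D') ⊙ P) c` is determined by its composites with the maps out of
`(D a ⊗ D' b) ⊗ P (a ⊗ b) c`. -/
lemma dayKelly_ext {f g : (kelly (D ⊗ D') P).functor.obj c ⟶ X}
    (h : ∀ a b : K, dinc D D' a b ▷ (P.obj (a ⊗ b)).functor.obj c ≫ kι (D ⊗ D') P (a ⊗ b) c ≫ f =
      dinc D D' a b ▷ (P.obj (a ⊗ b)).functor.obj c ≫ kι (D ⊗ D') P (a ⊗ b) c ≫ g) : f = g := by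
  apply kelly_ext
  intro k
  apply inc_whiskerRight_ext_at
  intro a b u
  have e := kι_condition (D := D ⊗ D') (P := P) (i := k) (j := a.unop ⊗ b.unop) u.unop c
  have h' := h a.unop b.unop
  have key (t : (kelly (D ⊗ D') P).functor.obj c ⟶ X) :
      inc D D' a b ▷ _ ≫ (D ⊗ D').functor.map u ▷ (P.obj k).functor.obj c ≫
        kι (D ⊗ D') P k c ≫ t = _ ◁ (P.map u.unop).natTrans.app c ≫
          dinc D D' a.unop b.unop ▷ (P.obj (a.unop ⊗ b.unop)).functor.obj c ≫
            kι (D ⊗ D') P (a.unop ⊗ b.unop) c ≫ t := by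
    refine Eq.trans ?_ (whisker_exchange_assoc _ _ _).symm
    exact congrArg (_ ≫ ·) ((reassoc_of% e) t)
  rw [key, key, h']

lemma dayKellyDesc_condition
    (t : ∀ a b : K, (D.functor.obj (op a) ⊗ D'.functor.obj (op b)) ⊗
      (P.obj (a ⊗ b)).functor.obj c ⟶ X)
    (ht : ∀ (a a' b b' : K) (f : a ⟶ a') (g : b ⟶ b'),
      (D.functor.map f.op ⊗ₘ D'.functor.map g.op) ▷ (P.obj (a ⊗ b)).functor.obj c ≫ t a b =
        _ ◁ (P.map (f ⊗ₘ g)).natTrans.app c ≫ t a' b')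
    (x x' y y' : Kᵒᵖ) (a : x ⟶ x') (b : y ⟶ y') :
    (D.functor.map a ⊗ₘ D'.functor.map b) ≫
        MonoidalClosed.curry ((β_ _ _).hom ≫ t x'.unop y'.unop) =
      MonoidalClosed.curry ((β_ _ _).hom ≫ t x.unop y.unop) ≫
        (ihomSeq P c X).functor.map (a ⊗ₘ b) := by
  refine (MonoidalClosed.curry_natural_left _ _).symm.trans ?_
  refine Eq.trans ?_ (MonoidalClosed.curry_pre_app _ _).symm
  refine congrArg MonoidalClosed.curry ?_
  refine (BraidedCategory.braiding_naturality_right_assoc _ _ _).trans ?_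
  refine Eq.trans ?_ (BraidedCategory.braiding_naturality_left_assoc _ _ _).symm
  exact congrArg (_ ≫ ·) (ht _ _ _ _ a.unop b.unop)

/-- Maps out of `((D ⊠ D') ⊙ P) c`. -/
noncomputable def dayKellyDesc
    (t : ∀ a b : K, (D.functor.obj (op a) ⊗ D'.functor.obj (op b)) ⊗
      (P.obj (a ⊗ b)).functor.obj c ⟶ X)
    (ht : ∀ (a a' b b' : K) (f : a ⟶ a') (g : b ⟶ b'),
      (D.functor.map f.op ⊗ₘ D'.functor.map g.op) ▷ (P.obj (a ⊗ b)).functor.obj c ≫ t a b =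
        _ ◁ (P.map (f ⊗ₘ g)).natTrans.app c ≫ t a' b') :
    (kelly (D ⊗ D') P).functor.obj c ⟶ X :=
  kellyDescHom (dayDesc (H := ihomSeq P c X)
    (fun a b => MonoidalClosed.curry ((β_ _ _).hom ≫ t a.unop b.unop))
    (dayKellyDesc_condition t ht))

lemma kι_dayKellyDesc
    (t : ∀ a b : K, (D.functor.obj (op a) ⊗ D'.functor.obj (op b)) ⊗
      (P.obj (a ⊗ b)).functor.obj c ⟶ X)
    (ht : ∀ (a a' b b' : K) (f : a ⟶ a') (g : b ⟶ b'),
      (D.functor.map f.op ⊗ₘ D'.functor.map g.op) ▷ (P.obj (a ⊗ b)).functor.obj c ≫ t a b =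
        _ ◁ (P.map (f ⊗ₘ g)).natTrans.app c ≫ t a' b') (a b : K) :
    dinc D D' a b ▷ (P.obj (a ⊗ b)).functor.obj c ≫ kι (D ⊗ D') P (a ⊗ b) c ≫
      dayKellyDesc t ht = t a b := by
  unfold dayKellyDesc
  rw [kι_kellyDescHom, BraidedCategory.braiding_naturality_left_assoc]
  have e := inc_dayDesc (F := D) (G := D') (H := ihomSeq P c X)
    (fun a b => MonoidalClosed.curry ((β_ _ _).hom ≫ t a.unop b.unop))
    (dayKellyDesc_condition t ht) (op a) (op b)
  have e' := congrArg MonoidalClosed.uncurry e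
  rw [MonoidalClosed.uncurry_curry] at e'
  refine (congrArg (_ ≫ ·) ((MonoidalClosed.uncurry_natural_left _ _).symm.trans e')).trans ?_
  exact SymmetricCategory.symmetry_assoc _ _ _

end

end

section

open scoped DayFunctor
open Functor.LaxMonoidal

variable {V : Type u} [Category.{v} V] [MonoidalCategory V] [SymmetricCategory V]

/-- The interchange of the two middle factors is an involution, as `V` is symmetric. -/
lemma tensorμ_tensorμ (X₁ X₂ Y₁ Y₂ : V) :
    tensorμ X₁ X₂ Y₁ Y₂ ≫ tensorμ X₁ Y₁ X₂ Y₂ = 𝟙 _ := by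
  have h := tensorμ_tensorδ X₁ X₂ Y₁ Y₂
  have e : tensorδ X₁ X₂ Y₁ Y₂ = tensorμ X₁ Y₁ X₂ Y₂ := by
    unfold tensorδ tensorμ
    rw [← SymmetricCategory.braiding_swap_eq_inv_braiding]
  rwa [e] at h

variable [MonoidalClosed V] [HasColimits V]
  {K : Type} [Category.{0} K] [MonoidalCategory K]
  {C : Type} [Category.{0} C] [MonoidalCategory C]

instance {F G : C ⊛⥤ V} (f : F ⟶ G) [IsIso f] (c : C) : IsIso (f.natTrans.app c) :=
  inferInstance

lemma inv_app_comp_app {F G : C ⊛⥤ V} (f : F ⟶ G) [IsIso f] (c : C) :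
    (inv f).natTrans.app c ≫ f.natTrans.app c = 𝟙 _ := by
  rw [← NatTrans.comp_app, ← DayFunctor.comp_natTrans, IsIso.inv_hom_id]
  rfl

lemma app_comp_inv_app {F G : C ⊛⥤ V} (f : F ⟶ G) [IsIso f] (c : C) :
    f.natTrans.app c ≫ (inv f).natTrans.app c = 𝟙 _ := by
  rw [← NatTrans.comp_app, ← DayFunctor.comp_natTrans, IsIso.hom_inv_id]
  rfl

/-- A map out of a value of the unit of the Day convolution is determined by its composites with
the images of the generator. -/
lemma incUnit_ext_at {c : C} {X : V} {f g : (𝟙_ (C ⊛⥤ V)).functor.obj c ⟶ X}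
    (h : ∀ w : 𝟙_ C ⟶ c, incUnit V C ≫ (𝟙_ (C ⊛⥤ V)).functor.map w ≫ f =
      incUnit V C ≫ (𝟙_ (C ⊛⥤ V)).functor.map w ≫ g) : f = g := by
  have hE : (Functor.LeftExtension.mk (𝟙_ (C ⊛⥤ V)).functor
      (DayFunctor.νNatTrans C V)).IsPointwiseLeftKanExtension :=
    LawfulDayConvolutionMonoidalCategoryStruct.isPointwiseLeftKanExtensionUnitUnit C V (C ⊛⥤ V)
  refine (hE c).hom_ext fun j => ?_
  exact (Category.assoc _ _ _).trans ((h j.hom).trans (Category.assoc _ _ _).symm)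

lemma incUnit_whiskerRight_ext_at {c : C} {X Z : V}
    {f g : (𝟙_ (C ⊛⥤ V)).functor.obj c ⊗ Z ⟶ X}
    (h : ∀ w : 𝟙_ C ⟶ c, incUnit V C ▷ Z ≫ (𝟙_ (C ⊛⥤ V)).functor.map w ▷ Z ≫ f =
      incUnit V C ▷ Z ≫ (𝟙_ (C ⊛⥤ V)).functor.map w ▷ Z ≫ g) : f = g := by
  rw [← cancel_epi (β_ _ _).hom]
  apply MonoidalClosed.curry_injective
  apply incUnit_ext_at
  intro w
  simp only [← MonoidalClosed.curry_natural_left, BraidedCategory.braiding_naturality_right_assoc,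
    h]

section

variable (P : K ⥤ C ⊛⥤ V) (D D' : Kᵒᵖ ⊛⥤ V)

lemma kellyμInv_aux (a b : K) (x x' y y' : C) (u : x ⟶ x') (w : y ⟶ y') :
    (D.functor.obj (op a) ⊗ D'.functor.obj (op b)) ◁
        ((P.obj a).functor.map u ⊗ₘ (P.obj b).functor.map w) ≫
        tensorμ _ _ _ _ ≫ (kι D P a x' ⊗ₘ kι D' P b y') ≫ inc (kelly D P) (kelly D' P) x' y' =
      (tensorμ _ _ _ _ ≫ (kι D P a x ⊗ₘ kι D' P b y) ≫ inc (kelly D P) (kelly D' P) x y) ≫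
        (kelly D P ⊗ kelly D' P).functor.map (u ⊗ₘ w) := by
  rw [tensorμ_natural_right_assoc, tensorHom_comp_tensorHom_assoc, ← kι_map, ← kι_map,
    ← tensorHom_comp_tensorHom_assoc, inc_natural, Category.assoc, Category.assoc]

/-- The maps `(D a ⊗ D' b) ⊗ (P a ⊠ P b) c ⟶ ((D ⊙ P) ⊠ (D' ⊙ P)) c`. -/
noncomputable def kellyμInv₂ (a b : K) (c : C) :
    (D.functor.obj (op a) ⊗ D'.functor.obj (op b)) ⊗ (P.obj a ⊗ P.obj b).functor.obj c ⟶
      (kelly D P ⊗ kelly D' P).functor.obj c :=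
  dayDescLeft (fun x y => tensorμ _ _ _ _ ≫ (kι D P a x ⊗ₘ kι D' P b y) ≫
    inc (kelly D P) (kelly D' P) x y) (kellyμInv_aux P D D' a b) c

lemma inc_kellyμInv₂ (a b : K) (x y : C) :
    _ ◁ inc (P.obj a) (P.obj b) x y ≫ kellyμInv₂ P D D' a b (x ⊗ y) =
      tensorμ _ _ _ _ ≫ (kι D P a x ⊗ₘ kι D' P b y) ≫ inc (kelly D P) (kelly D' P) x y :=
  inc_dayDescLeft _ _ x y

lemma kellyμInv₂_naturality (a b : K) {c c' : C} (w : c ⟶ c') :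
    _ ◁ (P.obj a ⊗ P.obj b).functor.map w ≫ kellyμInv₂ P D D' a b c' =
      kellyμInv₂ P D D' a b c ≫ (kelly D P ⊗ kelly D' P).functor.map w :=
  dayDescLeft_naturality _ _ w

lemma kellyμInv₂_condition {a a' b b' : K} (f : a ⟶ a') (g : b ⟶ b') (c : C) :
    (D.functor.map f.op ⊗ₘ D'.functor.map g.op) ▷ (P.obj a ⊗ P.obj b).functor.obj c ≫
        kellyμInv₂ P D D' a b c =
      _ ◁ (P.map f ⊗ₘ P.map g).natTrans.app c ≫ kellyμInv₂ P D D' a' b' c := by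
  apply inc_whiskerLeft_ext_at
  intro x y w
  have e := inc_tensorHom (P.map f) (P.map g) x y
  have e' := congrArg ((D.functor.obj (op a') ⊗ D'.functor.obj (op b')) ◁ ·) e
  simp only [MonoidalCategory.whiskerLeft_comp] at e'
  have n := (P.map f ⊗ₘ P.map g).natTrans.naturality w
  rw [← MonoidalCategory.whiskerLeft_comp_assoc (Y := (P.obj a ⊗ P.obj b).functor.obj c), n,
    MonoidalCategory.whiskerLeft_comp_assoc, kellyμInv₂_naturality, reassoc_of% e',
    reassoc_of% (inc_kellyμInv₂ P D D' a' b' x y), whisker_exchange_assoc, kellyμInv₂_naturality,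
    whisker_exchange_assoc, reassoc_of% (inc_kellyμInv₂ P D D' a b x y),
    tensorμ_natural_left_assoc, tensorμ_natural_right_assoc,
    tensorHom_comp_tensorHom_assoc, tensorHom_comp_tensorHom_assoc, kι_condition, kι_condition]

variable [P.LaxMonoidal] [∀ a b, IsIso (μ P a b)]

lemma kellyμInv_condition (c : C) (a a' b b' : K) (f : a ⟶ a') (g : b ⟶ b') :
    (D.functor.map f.op ⊗ₘ D'.functor.map g.op) ▷ (P.obj (a ⊗ b)).functor.obj c ≫
        _ ◁ (inv (μ P a b)).natTrans.app c ≫ kellyμInv₂ P D D' a b c =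
      _ ◁ (P.map (f ⊗ₘ g)).natTrans.app c ≫
        _ ◁ (inv (μ P a' b')).natTrans.app c ≫ kellyμInv₂ P D D' a' b' c := by
  have e : P.map (f ⊗ₘ g) ≫ inv (μ P a' b') = inv (μ P a b) ≫ (P.map f ⊗ₘ P.map g) := by
    rw [IsIso.comp_inv_eq, Category.assoc, IsIso.eq_inv_comp, μ_natural]
  have e' : (P.map (f ⊗ₘ g)).natTrans.app c ≫ (inv (μ P a' b')).natTrans.app c =
      (inv (μ P a b)).natTrans.app c ≫ (P.map f ⊗ₘ P.map g).natTrans.app c :=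
    congrArg (fun t => (DayFunctor.Hom.natTrans t).app c) e
  rw [← whisker_exchange_assoc, kellyμInv₂_condition, ← MonoidalCategory.whiskerLeft_comp_assoc,
    ← MonoidalCategory.whiskerLeft_comp_assoc, e']

/-- The inverse of `kellyμ`. -/
noncomputable def kellyμInv (c : C) :
    (kelly (D ⊗ D') P).functor.obj c ⟶ (kelly D P ⊗ kelly D' P).functor.obj c :=
  dayKellyDesc (fun a b => _ ◁ (inv (μ P a b)).natTrans.app c ≫ kellyμInv₂ P D D' a b c)
    (kellyμInv_condition P D D' c)

lemma kι_kellyμInv (a b : K) (c : C) :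
    dinc D D' a b ▷ (P.obj (a ⊗ b)).functor.obj c ≫ kι (D ⊗ D') P (a ⊗ b) c ≫
      kellyμInv P D D' c = _ ◁ (inv (μ P a b)).natTrans.app c ≫ kellyμInv₂ P D D' a b c :=
  kι_dayKellyDesc _ _ a b

lemma kellyμInv_naturality {c c' : C} (w : c ⟶ c') :
    (kelly (D ⊗ D') P).functor.map w ≫ kellyμInv P D D' c' =
      kellyμInv P D D' c ≫ (kelly D P ⊗ kelly D' P).functor.map w := by
  apply dayKelly_ext
  intro a b
  have n := (inv (μ P a b)).natTrans.naturality w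
  rw [reassoc_of% (kι_kellyμInv P D D' a b c), ← kellyμInv₂_naturality,
    ← MonoidalCategory.whiskerLeft_comp_assoc, ← n, MonoidalCategory.whiskerLeft_comp_assoc,
    ← kι_kellyμInv, kι_map_assoc, whisker_exchange_assoc]

/-- The inverse of `kellyμ`, as a map of functors. -/
noncomputable def kellyμInvHom : kelly (D ⊗ D') P ⟶ kelly D P ⊗ kelly D' P where
  natTrans :=
    { app := kellyμInv P D D'
      naturality _ _ w := kellyμInv_naturality P D D' w }

lemma kellyμ_kellyμInvHom : kellyμ P D D' ≫ kellyμInvHom P D D' = 𝟙 _ := by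
  apply kelly_day_ext
  intro k l x y
  refine (kι_kellyμ_assoc P D D' k l x y (kellyμInv P D D' (x ⊗ y))).trans ?_
  have e' : pinc P k l x y ≫ (inv (μ P k l)).natTrans.app (x ⊗ y) = inc _ _ x y := by
    unfold pinc
    rw [Category.assoc, app_comp_inv_app, Category.comp_id]
  rw [tensorHom_def'_assoc, kι_kellyμInv, ← MonoidalCategory.whiskerLeft_comp_assoc, e',
    inc_kellyμInv₂, reassoc_of% (tensorμ_tensorμ)]
  exact congrArg (_ ≫ ·) (Category.comp_id _).symm

lemma kellyμInvHom_kellyμ : kellyμInvHom P D D' ≫ kellyμ P D D' = 𝟙 _ := by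
  ext c
  apply dayKelly_ext
  intro a b
  change _ ≫ _ ≫ kellyμInv P D D' c ≫ _ = _ ≫ _ ≫ 𝟙 _
  rw [reassoc_of% (kι_kellyμInv P D D' a b c), Category.comp_id]
  have key : kellyμInv₂ P D D' a b c ≫ (kellyμ P D D').natTrans.app c =
      _ ◁ (μ P a b).natTrans.app c ≫ dinc D D' a b ▷ _ ≫ kι (D ⊗ D') P (a ⊗ b) c := by
    apply inc_whiskerLeft_ext_at
    intro x y w
    have n := (kellyμ P D D').natTrans.naturality w
    have n' := (μ P a b).natTrans.naturality w
    rw [reassoc_of% (kellyμInv₂_naturality P D D' a b w), n,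
      reassoc_of% (inc_kellyμInv₂ P D D' a b x y), kι_kellyμ_assoc,
      reassoc_of% (tensorμ_tensorμ), kι_map,
      ← MonoidalCategory.whiskerLeft_comp_assoc (Y := (P.obj a ⊗ P.obj b).functor.obj c), n',
      MonoidalCategory.whiskerLeft_comp_assoc, tensorHom_def'_assoc,
      ← whisker_exchange_assoc]
    unfold pinc
    rw [MonoidalCategory.whiskerLeft_comp_assoc]
  rw [key, ← MonoidalCategory.whiskerLeft_comp_assoc, inv_app_comp_app]
  exact (congrArg (· ≫ _) (MonoidalCategory.whiskerLeft_id _ _)).trans (Category.id_comp _)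

/-- The functor `- ⊙ P` preserves Day convolution if `P` is strong monoidal. -/
instance isIso_kellyμ : IsIso (kellyμ P D D') :=
  ⟨kellyμInvHom P D D', kellyμ_kellyμInvHom P D D', kellyμInvHom_kellyμ P D D'⟩

end

section

variable (P : K ⥤ C ⊛⥤ V) [P.LaxMonoidal] [IsIso (ε P)]

/-- The inverse of `kellyε`. -/
noncomputable def kellyεInv (c : C) :
    (kelly (𝟙_ (Kᵒᵖ ⊛⥤ V)) P).functor.obj c ⟶ (𝟙_ (C ⊛⥤ V)).functor.obj c :=
  kellyDescHom (unitDesc (F := ihomSeq P c _)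
    (MonoidalClosed.curry ((ρ_ _).hom ≫ (inv (ε P)).natTrans.app c)))

lemma kι_kellyεInv (c : C) :
    dincUnit V K ▷ (P.obj (𝟙_ K)).functor.obj c ≫ kι (𝟙_ (Kᵒᵖ ⊛⥤ V)) P (𝟙_ K) c ≫
      kellyεInv P c = (λ_ _).hom ≫ (inv (ε P)).natTrans.app c := by
  unfold kellyεInv
  rw [kι_kellyDescHom, BraidedCategory.braiding_naturality_left_assoc]
  have e := incUnit_unitDesc (F := ihomSeq P c _)
    (MonoidalClosed.curry ((ρ_ _).hom ≫ (inv (ε P)).natTrans.app c))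
  have e' := congrArg MonoidalClosed.uncurry e
  rw [MonoidalClosed.uncurry_curry] at e'
  refine (congrArg (_ ≫ ·) ((MonoidalClosed.uncurry_natural_left _ _).symm.trans e')).trans ?_
  exact (reassoc_of% (braiding_rightUnitor ((P.obj (𝟙_ K)).functor.obj c))) _

/-- A map out of `(I_0 ⊙ P) c` is determined by its composite with the map out of `P 𝟙 c`. -/
lemma unitKelly_ext {c : C} {X : V} {f g : (kelly (𝟙_ (Kᵒᵖ ⊛⥤ V)) P).functor.obj c ⟶ X}
    (h : dincUnit V K ▷ (P.obj (𝟙_ K)).functor.obj c ≫ kι (𝟙_ (Kᵒᵖ ⊛⥤ V)) P (𝟙_ K) c ≫ f =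
      dincUnit V K ▷ (P.obj (𝟙_ K)).functor.obj c ≫ kι (𝟙_ (Kᵒᵖ ⊛⥤ V)) P (𝟙_ K) c ≫ g) :
    f = g := by
  apply kelly_ext
  intro k
  apply incUnit_whiskerRight_ext_at
  intro w
  have e := kι_condition (D := 𝟙_ (Kᵒᵖ ⊛⥤ V)) (P := P) (i := k) (j := 𝟙_ K) w.unop c
  have key (t : (kelly (𝟙_ (Kᵒᵖ ⊛⥤ V)) P).functor.obj c ⟶ X) :
      incUnit V Kᵒᵖ ▷ _ ≫ (𝟙_ (Kᵒᵖ ⊛⥤ V)).functor.map w ▷ (P.obj k).functor.obj c ≫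
        kι (𝟙_ (Kᵒᵖ ⊛⥤ V)) P k c ≫ t = _ ◁ (P.map w.unop).natTrans.app c ≫
          dincUnit V K ▷ (P.obj (𝟙_ K)).functor.obj c ≫ kι (𝟙_ (Kᵒᵖ ⊛⥤ V)) P (𝟙_ K) c ≫ t := by
    refine Eq.trans ?_ (whisker_exchange_assoc _ _ _).symm
    exact congrArg (_ ≫ ·) ((reassoc_of% e) t)
  exact (key f).trans ((congrArg (_ ≫ ·) h).trans (key g).symm)

lemma kellyεInv_naturality {c c' : C} (w : c ⟶ c') :
    (kelly (𝟙_ (Kᵒᵖ ⊛⥤ V)) P).functor.map w ≫ kellyεInv P c' =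
      kellyεInv P c ≫ (𝟙_ (C ⊛⥤ V)).functor.map w := by
  apply unitKelly_ext
  have n := (inv (ε P)).natTrans.naturality w
  rw [reassoc_of% (kι_kellyεInv P c), ← n, kι_map_assoc, ← whisker_exchange_assoc, kι_kellyεInv,
    leftUnitor_naturality_assoc]

/-- The inverse of `kellyε`, as a map of functors. -/
noncomputable def kellyεInvHom : kelly (𝟙_ (Kᵒᵖ ⊛⥤ V)) P ⟶ 𝟙_ (C ⊛⥤ V) where
  natTrans :=
    { app := kellyεInv P
      naturality _ _ w := kellyεInv_naturality P w }

lemma kellyε_kellyεInvHom : kellyε P ≫ kellyεInvHom P = 𝟙 _ := by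
  apply incUnit_hom_ext
  have e := kellyε_comp P
  refine ((reassoc_of% e) (kellyεInv P (𝟙_ C))).trans ?_
  rw [tensorHom_def'_assoc, kι_kellyεInv, leftUnitor_naturality_assoc, Iso.inv_hom_id_assoc]
  unfold pincUnit
  rw [Category.assoc, app_comp_inv_app]
  rfl

lemma kellyεInvHom_kellyε : kellyεInvHom P ≫ kellyε P = 𝟙 _ := by
  ext c
  apply unitKelly_ext
  change _ ≫ _ ≫ kellyεInv P c ≫ _ = _ ≫ _ ≫ 𝟙 _
  rw [reassoc_of% (kι_kellyεInv P c), Category.comp_id]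
  have key : (kellyε P).natTrans.app c =
      (λ_ _).inv ≫ _ ◁ (ε P).natTrans.app c ≫ dincUnit V K ▷ _ ≫
        kι (𝟙_ (Kᵒᵖ ⊛⥤ V)) P (𝟙_ K) c := by
    apply incUnit_ext_at
    intro w
    have n := (kellyε P).natTrans.naturality w
    have n' := (ε P).natTrans.naturality w
    have e := kellyε_comp P
    rw [n, reassoc_of% e, kι_map, leftUnitor_inv_naturality_assoc,
      leftUnitor_inv_naturality_assoc,
      ← MonoidalCategory.whiskerLeft_comp_assoc _ _ ((ε P).natTrans.app c), n',
      ← MonoidalCategory.whiskerLeft_comp_assoc, tensorHom_def'_assoc,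
      ← whisker_exchange_assoc]
    unfold pincUnit
    simp only [MonoidalCategory.whiskerLeft_comp, Category.assoc]
  rw [key, leftUnitor_inv_naturality_assoc, ← MonoidalCategory.whiskerLeft_comp_assoc,
    inv_app_comp_app, Iso.hom_inv_id_assoc]
  exact (congrArg (· ≫ _) (MonoidalCategory.whiskerLeft_id _ _)).trans (Category.id_comp _)

/-- The functor `- ⊙ P` preserves the unit for Day convolution if `P` does. -/
instance isIso_kellyε : IsIso (kellyε P) :=
  ⟨kellyεInvHom P, kellyε_kellyεInvHom P, kellyεInvHom_kellyε P⟩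

end

end

/-! ### Points of tensor powers -/

section

open scoped DayFunctor
open Functor.LaxMonoidal

variable {V : Type u} [Category.{v} V] [MonoidalCategory V] [SymmetricCategory V]
  [MonoidalClosed V] [HasColimits V]

section

variable {C : Type} [Category.{0} C] [MonoidalCategory C] {F G H : C ⊛⥤ V}

/-- The product in `(F ⊠ G) (c ⊗ d)` of a point of `F c` and a point of `G d`. -/
noncomputable def tensorPt {c d : C} (a : 𝟙_ V ⟶ F.functor.obj c) (b : 𝟙_ V ⟶ G.functor.obj d) :
    𝟙_ V ⟶ (F ⊗ G).functor.obj (c ⊗ d) := (λ_ _).inv ≫ (a ⊗ₘ b) ≫ inc F G c d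

lemma tensorPt_map {c d c' d' : C} (a : 𝟙_ V ⟶ F.functor.obj c) (b : 𝟙_ V ⟶ G.functor.obj d)
    (f : c ⟶ c') (g : d ⟶ d') : tensorPt a b ≫ (F ⊗ G).functor.map (f ⊗ₘ g) =
      tensorPt (a ≫ F.functor.map f) (b ≫ G.functor.map g) := by
  unfold tensorPt
  rw [Category.assoc, Category.assoc, ← inc_natural, tensorHom_comp_tensorHom_assoc]

lemma tensorPt_tensorHom {F' G' : C ⊛⥤ V} {c d : C} (a : 𝟙_ V ⟶ F.functor.obj c)
    (b : 𝟙_ V ⟶ G.functor.obj d) (f : F ⟶ F') (g : G ⟶ G') :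
    tensorPt a b ≫ (f ⊗ₘ g).natTrans.app (c ⊗ d) =
      tensorPt (a ≫ f.natTrans.app c) (b ≫ g.natTrans.app d) := by
  unfold tensorPt
  rw [Category.assoc, Category.assoc, inc_tensorHom, tensorHom_comp_tensorHom_assoc]

lemma tensorPt_whiskerRight {F' : C ⊛⥤ V} {c d : C} (a : 𝟙_ V ⟶ F.functor.obj c)
    (b : 𝟙_ V ⟶ G.functor.obj d) (f : F ⟶ F') :
    tensorPt a b ≫ (f ▷ G).natTrans.app (c ⊗ d) = tensorPt (a ≫ f.natTrans.app c) b := by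
  unfold tensorPt
  rw [Category.assoc, Category.assoc, inc_whiskerRight, tensorHom_comp_whiskerRight_assoc]

lemma tensorPt_whiskerLeft {G' : C ⊛⥤ V} {c d : C} (a : 𝟙_ V ⟶ F.functor.obj c)
    (b : 𝟙_ V ⟶ G.functor.obj d) (g : G ⟶ G') :
    tensorPt a b ≫ (F ◁ g).natTrans.app (c ⊗ d) = tensorPt a (b ≫ g.natTrans.app d) := by
  unfold tensorPt
  rw [Category.assoc, Category.assoc, inc_whiskerLeft, tensorHom_comp_whiskerLeft_assoc]

lemma tensorPt_associator {c d e : C} (x : 𝟙_ V ⟶ F.functor.obj c) (y : 𝟙_ V ⟶ G.functor.obj d)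
    (z : 𝟙_ V ⟶ H.functor.obj e) :
    tensorPt (tensorPt x y) z ≫ (α_ F G H).hom.natTrans.app ((c ⊗ d) ⊗ e) =
      tensorPt x (tensorPt y z) ≫ (F ⊗ G ⊗ H).functor.map (α_ c d e).inv := by
  unfold tensorPt
  have e1 := inc_associator F G H c d e
  have l : ((λ_ (𝟙_ V)).inv ≫ (x ⊗ₘ y) ≫ inc F G c d ⊗ₘ z) =
    (λ_ (𝟙_ V)).inv ▷ _ ≫ ((x ⊗ₘ y) ⊗ₘ z) ≫ inc F G c d ▷ _ := by
    rw [← tensorHom_id, ← tensorHom_id, tensorHom_comp_tensorHom, tensorHom_comp_tensorHom,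
      Category.id_comp, Category.comp_id]
  have r : (x ⊗ₘ (λ_ (𝟙_ V)).inv ≫ (y ⊗ₘ z) ≫ inc G H d e) =
    _ ◁ (λ_ (𝟙_ V)).inv ≫ (x ⊗ₘ (y ⊗ₘ z)) ≫ _ ◁ inc G H d e := by
    rw [← id_tensorHom, ← id_tensorHom, tensorHom_comp_tensorHom, tensorHom_comp_tensorHom,
      Category.id_comp, Category.comp_id]
  rw [l, r]
  simp only [Category.assoc]
  rw [e1, associator_naturality_assoc]
  have c : (λ_ (𝟙_ V)).inv ≫ (λ_ (𝟙_ V)).inv ▷ 𝟙_ V ≫ (α_ _ _ _).hom =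
    (λ_ (𝟙_ V)).inv ≫ 𝟙_ V ◁ (λ_ (𝟙_ V)).inv := by monoidal
  rw [reassoc_of% c]

lemma tensorPt_associator_inv {c d e : C} (x : 𝟙_ V ⟶ F.functor.obj c)
    (y : 𝟙_ V ⟶ G.functor.obj d) (z : 𝟙_ V ⟶ H.functor.obj e) :
    tensorPt x (tensorPt y z) ≫ (α_ F G H).inv.natTrans.app (c ⊗ (d ⊗ e)) =
      tensorPt (tensorPt x y) z ≫ ((F ⊗ G) ⊗ H).functor.map (α_ c d e).hom := by
  have h := tensorPt_associator x y z
  have n := (α_ F G H).inv.natTrans.naturality (α_ c d e).inv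
  have i : (α_ F G H).hom.natTrans.app ((c ⊗ d) ⊗ e) ≫ (α_ F G H).inv.natTrans.app ((c ⊗ d) ⊗ e) =
    𝟙 _ := congrArg (fun t => (DayFunctor.Hom.natTrans t).app ((c ⊗ d) ⊗ e))
      (α_ F G H).hom_inv_id
  have j : ((F ⊗ G) ⊗ H).functor.map (α_ c d e).inv ≫ ((F ⊗ G) ⊗ H).functor.map (α_ c d e).hom =
    𝟙 _ := by rw [← CategoryTheory.Functor.map_comp, Iso.inv_hom_id, CategoryTheory.Functor.map_id]
  have h' := h =≫ (α_ F G H).inv.natTrans.app ((c ⊗ d) ⊗ e)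
  rw [Category.assoc, Category.assoc, i, n, Category.comp_id] at h'
  rw [h', Category.assoc, Category.assoc, j, Category.comp_id]

lemma tensorPt_braiding [SymmetricCategory C] {c d : C} (x : 𝟙_ V ⟶ F.functor.obj c)
    (y : 𝟙_ V ⟶ G.functor.obj d) :
    tensorPt x y ≫ (β_ F G).hom.natTrans.app (c ⊗ d) =
      tensorPt y x ≫ (G ⊗ F).functor.map (β_ d c).hom := by
  unfold tensorPt
  rw [Category.assoc, Category.assoc, inc_braiding, BraidedCategory.braiding_naturality_assoc]
  simp [unitors_inv_equal]

lemma tensorPt_rightUnitor {c : C} (x : 𝟙_ V ⟶ F.functor.obj c) :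
    tensorPt x (incUnit V C) ≫ (ρ_ F).hom.natTrans.app (c ⊗ 𝟙_ C) =
      x ≫ F.functor.map (ρ_ c).inv := by
  unfold tensorPt
  rw [MonoidalCategory.tensorHom_def]
  simp only [Category.assoc]
  rw [inc_rightUnitor, rightUnitor_naturality_assoc, ← unitors_equal, Iso.inv_hom_id_assoc]

lemma comp_rightUnitor_inv {c : C} (x : 𝟙_ V ⟶ F.functor.obj c) :
    x ≫ (ρ_ F).inv.natTrans.app c =
      tensorPt x (incUnit V C) ≫ (F ⊗ 𝟙_ _).functor.map (ρ_ c).hom := by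
  rw [rightUnitor_inv_app]
  unfold tensorPt
  rw [MonoidalCategory.tensorHom_def, Category.assoc, unitors_inv_equal]
  simp only [Category.assoc]
  rw [rightUnitor_inv_naturality_assoc]

end

section

variable {s : SeqKind}

/-- The permutation that moves the last point to position `j` and keeps the order of the others. -/
def Idx.cycle {l : ℕ} (j : Fin (l + 1)) : (⟨l + 1⟩ : Idx s) ⟶ ⟨l + 1⟩ :=
  have inj : Function.Injective (Fin.lastCases (motive := fun _ => Fin (l + 1)) j j.succAbove) := by
    intro a b
    refine Fin.lastCases ?_ (fun a => ?_) a <;> refine Fin.lastCases ?_ (fun b => ?_) b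
    · simp
    · simp [(Fin.succAbove_ne j b).symm]
    · simp [Fin.succAbove_ne j a]
    · simp
  ⟨Fin.lastCases (motive := fun _ => Fin (l + 1)) j j.succAbove, inj,
    fun _ => Finite.injective_iff_bijective.1 inj⟩

@[simp]
lemma Idx.cycle_last {l : ℕ} (j : Fin (l + 1)) :
    (Idx.cycle (s := s) j).toFun (Fin.last l) = j := by simp [Idx.cycle]

@[simp]
lemma Idx.cycle_castSucc {l : ℕ} (j : Fin (l + 1)) (i : Fin l) :
    (Idx.cycle (s := s) j).toFun i.castSucc = j.succAbove i := by simp [Idx.cycle]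

lemma Idx.cycle_eq_id (l : ℕ) : Idx.cycle (s := s) (Fin.last l) = 𝟙 _ := by
  refine Idx.hom_ext fun i => ?_
  refine Fin.lastCases ?_ (fun i => ?_) i <;> simp

lemma Idx.wedge_one_last {k l : ℕ} (f : (⟨k⟩ : Idx s) ⟶ ⟨l⟩) :
    (Idx.wedge f (𝟙 (⟨1⟩ : Idx s))).toFun (Fin.last k) = Fin.last l :=
  Idx.wedge_natAdd f (𝟙 (⟨1⟩ : Idx s)) (0 : Fin 1)

lemma Idx.wedge_one_castSucc {k l : ℕ} (f : (⟨k⟩ : Idx s) ⟶ ⟨l⟩) (i : Fin k) :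
    (Idx.wedge f (𝟙 (⟨1⟩ : Idx s))).toFun i.castSucc = (f.toFun i).castSucc :=
  Idx.wedge_castAdd f (𝟙 (⟨1⟩ : Idx s)) i

/-- The decomposition of an injection along which `powMap` is defined recursively. -/
lemma Idx.eq_wedge_comp_cycle {k l : ℕ} (f : (⟨k + 1⟩ : Idx s) ⟶ ⟨l + 1⟩) :
    f = Idx.wedge (Idx.remove f (Fin.last k)) (𝟙 (⟨1⟩ : Idx s)) ≫
      Idx.cycle (f.toFun (Fin.last k)) := by
  refine Idx.hom_ext fun i => ?_
  rw [Idx.comp_toFun]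
  refine Fin.lastCases ?_ (fun i => ?_) i
  · refine Eq.trans ?_ (congrArg _ (Idx.wedge_one_last (Idx.remove f (Fin.last k))).symm)
    exact (Idx.cycle_last _).symm
  · refine Eq.trans ?_ (congrArg _ (Idx.wedge_one_castSucc (Idx.remove f (Fin.last k)) i).symm)
    refine Eq.trans ?_ (Idx.cycle_castSucc _ _).symm
    rw [Idx.succAbove_remove, Fin.succAbove_last]

lemma Idx.cycle_castSucc_eq {l : ℕ} (j : Fin (l + 1)) : Idx.cycle (s := s) j.castSucc =
    Idx.cycle (Fin.last l).castSucc ≫ Idx.wedge (Idx.cycle j) (𝟙 (⟨1⟩ : Idx s)) := by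
  refine Idx.hom_ext fun i => ?_
  rw [Idx.comp_toFun]
  refine Fin.lastCases ?_ (fun i => Fin.lastCases ?_ (fun i => ?_) i) i
  · rw [Idx.cycle_last, Idx.cycle_last]
    exact (Idx.wedge_one_castSucc _ _).trans (congrArg _ (Idx.cycle_last _)) |>.symm
  · rw [Idx.cycle_castSucc, Idx.cycle_castSucc]
    have e : (Fin.last l).castSucc.succAbove (Fin.last l) = Fin.last (l + 1) := by
      ext; simp [Fin.succAbove]
    rw [e]
    refine Eq.trans ?_ (Idx.wedge_one_last _).symm
    ext; simp [Fin.succAbove, Fin.lt_def, Nat.not_lt.2 (Nat.lt_succ_iff.1 j.2)]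
  · rw [Idx.cycle_castSucc, Idx.cycle_castSucc]
    have e : (Fin.last l).castSucc.succAbove i.castSucc = i.castSucc.castSucc := by
      ext; simp [Fin.succAbove, Fin.lt_def]
    rw [e]
    refine Eq.trans ?_ (Idx.wedge_one_castSucc _ _).symm
    rw [Idx.cycle_castSucc]
    exact Fin.castSucc_succAbove_castSucc

lemma Idx.cycle_castSucc_last (l : ℕ) : Idx.cycle (s := s) (Fin.last l).castSucc =
    (α_ (⟨l⟩ : Idx s) (⟨1⟩ : Idx s) (⟨1⟩ : Idx s)).hom ≫
      (⟨l⟩ : Idx s) ◁ (β_ (⟨1⟩ : Idx s) (⟨1⟩ : Idx s)).hom ≫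
        (α_ (⟨l⟩ : Idx s) (⟨1⟩ : Idx s) (⟨1⟩ : Idx s)).inv := by
  refine Idx.hom_ext fun i => Fin.ext ?_
  have e : (((α_ (⟨l⟩ : Idx s) (⟨1⟩ : Idx s) (⟨1⟩ : Idx s)).hom ≫
      (⟨l⟩ : Idx s) ◁ (β_ (⟨1⟩ : Idx s) (⟨1⟩ : Idx s)).hom ≫
        (α_ (⟨l⟩ : Idx s) (⟨1⟩ : Idx s) (⟨1⟩ : Idx s)).inv).toFun i).val =
      if i.val < l then i.val
      else l + (if i.val - l < 1 then 1 + (i.val - l) else i.val - l - 1) := by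
    refine (Idx.wedge_val (𝟙 (⟨l⟩ : Idx s)) (β_ (⟨1⟩ : Idx s) (⟨1⟩ : Idx s)).hom
      ((α_ (⟨l⟩ : Idx s) (⟨1⟩ : Idx s) (⟨1⟩ : Idx s)).hom.toFun i)).trans ?_
    by_cases h : i.val < l
    · exact (dif_pos h).trans (if_pos h).symm
    · refine (dif_neg h).trans (Eq.trans ?_ (if_neg h).symm)
      exact congrArg (l + ·) (Idx.braiding_hom_val (⟨1⟩ : Idx s) (⟨1⟩ : Idx s) _)
  refine Eq.trans ?_ e.symm
  refine Fin.lastCases ?_ (fun i => Fin.lastCases ?_ (fun i => ?_) i) i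
  · rw [Idx.cycle_last]; simp
  · rw [Idx.cycle_castSucc]; simp [Fin.succAbove]
  · rw [Idx.cycle_castSucc]; simp [Fin.succAbove, Fin.lt_def]

end

section

variable {s : SeqKind} (E : BSeq s V) (x : 𝟙_ V ⟶ E.X.functor.obj (op ⟨1⟩))

/-- Exchanging the last two factors of `x^{⊗ (l + 2)}` amounts to permuting the last two inputs. -/
lemma powPt_swap (l : ℕ) :
    powPt E x (l + 2) ≫ (E.swap (E.pow l)).natTrans.app (op ⟨l + 2⟩) =
      powPt E x (l + 2) ≫ (E.pow (l + 2)).functor.map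
        (Idx.cycle (Fin.last l).castSucc).op := by
  have e1 := tensorPt_associator (powPt E x l) x x
  have n1 := (E.pow l ◁ (β_ E.X E.X).hom ≫ (α_ (E.pow l) E.X E.X).inv).natTrans.naturality
    (α_ (op (⟨l⟩ : Idx s)) (op ⟨1⟩) (op ⟨1⟩)).inv
  have e2 := tensorPt_whiskerLeft (powPt E x l) (tensorPt x x) (β_ E.X E.X).hom
  have e3 := tensorPt_braiding x x
  have e4 := tensorPt_map (powPt E x l) (tensorPt x x) (𝟙 (op (⟨l⟩ : Idx s)))
    (β_ (op (⟨1⟩ : Idx s)) (op (⟨1⟩ : Idx s))).hom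
  have n2 := (α_ (E.pow l) E.X E.X).inv.natTrans.naturality
    (𝟙 (op (⟨l⟩ : Idx s)) ⊗ₘ (β_ (op (⟨1⟩ : Idx s)) (op (⟨1⟩ : Idx s))).hom)
  have e5 := tensorPt_associator_inv (powPt E x l) x x
  rw [CategoryTheory.Functor.map_id, Category.comp_id] at e4
  rw [e3, ← e4] at e2
  have key : tensorPt (tensorPt (powPt E x l) x) x ≫
      ((α_ (E.pow l) E.X E.X).hom ≫ E.pow l ◁ (β_ E.X E.X).hom ≫
        (α_ (E.pow l) E.X E.X).inv).natTrans.app ((op ⟨l⟩ ⊗ op ⟨1⟩) ⊗ op ⟨1⟩) =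
      tensorPt (tensorPt (powPt E x l) x) x ≫ ((E.pow l ⊗ E.X) ⊗ E.X).functor.map
        ((α_ (op (⟨l⟩ : Idx s)) (op ⟨1⟩) (op ⟨1⟩)).hom ≫
          (𝟙 (op (⟨l⟩ : Idx s)) ⊗ₘ (β_ (op (⟨1⟩ : Idx s)) (op (⟨1⟩ : Idx s))).hom) ≫
            (α_ (op (⟨l⟩ : Idx s)) (op ⟨1⟩) (op ⟨1⟩)).inv) := by
    rw [DayFunctor.comp_natTrans, NatTrans.comp_app, reassoc_of% e1, n1, DayFunctor.comp_natTrans,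
      NatTrans.comp_app, Category.assoc, reassoc_of% e2, reassoc_of% n2, reassoc_of% e5]
    simp only [CategoryTheory.Functor.map_comp]
  refine key.trans (congrArg (fun t => _ ≫ (E.pow (l + 2)).functor.map t) ?_)
  exact Quiver.Hom.unop_inj (Idx.cycle_castSucc_last l).symm

/-- Moving the last factor of `x^{⊗ (l + 1)}` amounts to permuting the inputs. -/
lemma powPt_insert (l : ℕ) (j : Fin (l + 1)) :
    powPt E x (l + 1) ≫ (E.insert l j).natTrans.app (op ⟨l + 1⟩) =
      powPt E x (l + 1) ≫ (E.pow (l + 1)).functor.map (Idx.cycle j).op := by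
  have last (l : ℕ) : powPt E x (l + 1) ≫ (E.insert l (Fin.last l)).natTrans.app (op ⟨l + 1⟩) =
      powPt E x (l + 1) ≫ (E.pow (l + 1)).functor.map (Idx.cycle (Fin.last l)).op := by
    rw [Pointed.insert_last, Idx.cycle_eq_id, op_id, CategoryTheory.Functor.map_id]
    rfl
  induction l with
  | zero =>
    obtain rfl : j = Fin.last 0 := by ext; omega
    exact last 0
  | succ l ih =>
    refine Fin.lastCases (last (l + 1)) (fun j => ?_) j
    have e1 := tensorPt_whiskerRight (powPt E x (l + 1)) x (E.insert l j)
    have e2 := tensorPt_map (powPt E x (l + 1)) x (Idx.cycle j).op (𝟙 (op (⟨1⟩ : Idx s)))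
    have n := (E.insert l j ▷ E.X).natTrans.naturality (Idx.cycle (s := s) (Fin.last l).castSucc).op
    rw [CategoryTheory.Functor.map_id, Category.comp_id, ← ih] at e2
    have e3 : powPt E x (l + 2) ≫ (E.insert l j ▷ E.X).natTrans.app (op ⟨l + 2⟩) =
      powPt E x (l + 2) ≫ (E.pow (l + 2)).functor.map ((Idx.cycle j).op ⊗ₘ 𝟙 (op (⟨1⟩ : Idx s))) :=
        e1.trans e2.symm
    rw [Pointed.insert_castSucc, DayFunctor.comp_natTrans, NatTrans.comp_app,
      reassoc_of% (powPt_swap E x l)]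
    refine (congrArg (_ ≫ ·) n).trans ?_
    refine (reassoc_of% e3) _ |>.trans ?_
    refine congrArg (_ ≫ ·) ?_
    refine ((E.pow (l + 2)).functor.map_comp _ _).symm.trans ?_
    exact congrArg (E.pow (l + 2)).functor.map
      (Quiver.Hom.unop_inj (Idx.cycle_castSucc_eq j).symm)

/-- If forgetting the input of `x` gives the base point, then forgetting all inputs of `x^{⊗ l}`
gives the tensor power of the base point. -/
lemma powPt_powBase (hx : ∀ hs : s = .lambda, x ≫ E.X.functor.map (Idx.zeroOne hs).op =
      incUnit V (Idx s)ᵒᵖ ≫ (E.base hs).natTrans.app (op ⟨0⟩))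
    (hs : s = .lambda) (l : ℕ) (f : (⟨0⟩ : Idx s) ⟶ ⟨l⟩) :
    powPt E x l ≫ (E.pow l).functor.map f.op =
      incUnit V (Idx s)ᵒᵖ ≫ (E.powBase l (.inr hs)).natTrans.app (op ⟨0⟩) := by
  induction l with
  | zero =>
    obtain rfl : f = 𝟙 _ := Idx.hom_ext fun i => i.elim0
    rw [op_id, CategoryTheory.Functor.map_id]
    rfl
  | succ l ih =>
    let f' : (⟨0⟩ : Idx s) ⟶ ⟨l⟩ := ⟨Fin.elim0, fun i => i.elim0, fun h => by simp [hs] at h⟩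
    have e1 := tensorPt_map (powPt E x l) x f'.op (Idx.zeroOne hs).op
    rw [ih f', hx hs] at e1
    have e2 := comp_rightUnitor_inv
      (incUnit V (Idx s)ᵒᵖ ≫ (E.powBase l (.inr hs)).natTrans.app (op ⟨0⟩))
    have e3 := tensorPt_whiskerLeft (incUnit V (Idx s)ᵒᵖ ≫
      (E.powBase l (.inr hs)).natTrans.app (op ⟨0⟩)) (incUnit V (Idx s)ᵒᵖ) (E.base hs)
    have n := (E.pow l ◁ E.base hs).natTrans.naturality (ρ_ (op (⟨0⟩ : Idx s))).hom
    rw [Pointed.powBase_succ _ hs, DayFunctor.comp_natTrans, NatTrans.comp_app, Pointed.push,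
      DayFunctor.comp_natTrans, NatTrans.comp_app]
    have key : incUnit V (Idx s)ᵒᵖ ≫ (E.powBase l (.inr hs)).natTrans.app (op ⟨0⟩) ≫
        (ρ_ (E.pow l)).inv.natTrans.app (op ⟨0⟩) ≫
          (E.pow l ◁ E.base hs).natTrans.app (op ⟨0⟩) =
        (tensorPt (powPt E x l) x ≫
          (E.pow l ⊗ E.X).functor.map (f'.op ⊗ₘ (Idx.zeroOne hs).op)) ≫
            (E.pow l ⊗ E.X).functor.map (ρ_ (op (⟨0⟩ : Idx s))).hom := by
      refine Eq.trans ?_ (congrArg (· ≫ _) (e1.trans e3.symm)).symm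
      refine ((reassoc_of% e2) _).trans ?_
      rw [n, Category.assoc]
    refine Eq.trans ?_ key.symm
    refine Eq.trans ?_ (Category.assoc _ _ _).symm
    refine Eq.trans ?_ (congrArg (_ ≫ ·) ((E.pow l ⊗ E.X).functor.map_comp _ _))
    exact congrArg (fun t => _ ≫ (E.pow l ⊗ E.X).functor.map t)
      (Quiver.Hom.unop_inj (Idx.hom_ext fun i => i.elim0))

/-- The points `x^{⊗ k}` of `E^{⊠ k} k` form a dinatural family: an injection `f : k ⟶ l` acts in
the same way through the inputs of `x^{⊗ l}` and through the factors of `x^{⊗ k}`. -/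
lemma powPt_natural (hx : ∀ hs : s = .lambda, x ≫ E.X.functor.map (Idx.zeroOne hs).op =
      incUnit V (Idx s)ᵒᵖ ≫ (E.base hs).natTrans.app (op ⟨0⟩))
    {k l : ℕ} (f : (⟨k⟩ : Idx s) ⟶ ⟨l⟩) :
    powPt E x l ≫ (E.pow l).functor.map f.op =
      powPt E x k ≫ (E.powMap k l f).natTrans.app (op ⟨k⟩) := by
  induction k generalizing l with
  | zero =>
    rcases Idx.hom_zero_left f with rfl | hs
    · obtain rfl : f = 𝟙 _ := Idx.hom_ext fun i => i.elim0
      rw [op_id, CategoryTheory.Functor.map_id]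
      rfl
    · exact powPt_powBase E x hx hs l f
  | succ k ih =>
    rcases l with _ | l
    · exact (Idx.hom_zero_right f).elim
    have e1 := tensorPt_whiskerRight (powPt E x k) x (E.powMap k l (Idx.remove f (Fin.last k)))
    have e2 := tensorPt_map (powPt E x l) x (Idx.remove f (Fin.last k)).op (𝟙 (op (⟨1⟩ : Idx s)))
    rw [CategoryTheory.Functor.map_id, Category.comp_id, ih] at e2
    have e3 : powPt E x (k + 1) ≫
        (E.powMap k l (Idx.remove f (Fin.last k)) ▷ E.X).natTrans.app (op ⟨k + 1⟩) =
      powPt E x (l + 1) ≫ (E.pow (l + 1)).functor.map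
        (Idx.wedge (Idx.remove f (Fin.last k)) (𝟙 (⟨1⟩ : Idx s))).op := e1.trans e2.symm
    have n := (E.insert l (f.toFun (Fin.last k))).natTrans.naturality
      (Idx.wedge (Idx.remove f (Fin.last k)) (𝟙 (⟨1⟩ : Idx s))).op
    rw [Pointed.powMap_succ, DayFunctor.comp_natTrans, NatTrans.comp_app, reassoc_of% e3]
    refine Eq.trans ?_ (congrArg (_ ≫ ·) n).symm
    rw [reassoc_of% (powPt_insert E x l (f.toFun (Fin.last k)))]
    refine congrArg (_ ≫ ·) ?_
    refine Eq.trans ?_ ((E.pow (l + 1)).functor.map_comp _ _)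
    exact congrArg (fun t => (E.pow (l + 1)).functor.map (Quiver.Hom.op t))
      (Idx.eq_wedge_comp_cycle f)

lemma powPt_powHom {E F : BSeq s V} (x : 𝟙_ V ⟶ E.X.functor.obj (op ⟨1⟩)) (f : E ⟶ F) (n : ℕ) :
    powPt E x n ≫ (Pointed.powHom f n).natTrans.app (op ⟨n⟩) =
      powPt F (x ≫ f.hom.natTrans.app (op ⟨1⟩)) n := by
  induction n with
  | zero => exact Category.comp_id _
  | succ n ih =>
    have e := tensorPt_tensorHom (powPt E x n) x (Pointed.powHom f n) f.hom
    rw [ih] at e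
    exact e

/-- `x^{⊗ k} ⊗ x^{⊗ l} = x^{⊗ (k + l)}`. -/
lemma tensorPt_powPt (k l : ℕ) :
    tensorPt (powPt E x k) (powPt E x l) ≫
      (E.powAdd k l).hom.natTrans.app (op ⟨k⟩ ⊗ op ⟨l⟩) = powPt E x (k + l) := by
  induction l with
  | zero =>
    have e := tensorPt_rightUnitor (powPt E x k)
    refine e.trans ?_
    refine (congrArg (_ ≫ ·) ?_).trans (Category.comp_id _)
    refine Eq.trans ?_ ((E.pow k).functor.map_id _)
    exact congrArg (E.pow k).functor.map (Quiver.Hom.unop_inj (Idx.hom_ext fun i => rfl))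
  | succ l ih =>
    have e1 := tensorPt_associator_inv (powPt E x k) (powPt E x l) x
    have e2 := tensorPt_whiskerRight (tensorPt (powPt E x k) (powPt E x l)) x (E.powAdd k l).hom
    have e3 : ((E.pow k ⊗ E.pow l) ⊗ E.X).functor.map
        (α_ (op (⟨k⟩ : Idx s)) (op (⟨l⟩ : Idx s)) (op (⟨1⟩ : Idx s))).hom = 𝟙 _ := by
      refine Eq.trans ?_ (((E.pow k ⊗ E.pow l) ⊗ E.X).functor.map_id _)
      exact congrArg ((E.pow k ⊗ E.pow l) ⊗ E.X).functor.map
        (Quiver.Hom.unop_inj (Idx.hom_ext fun i => rfl))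
    rw [ih] at e2
    rw [e3] at e1
    refine (congrArg (_ ≫ ·) (congrArg (fun t => (DayFunctor.Hom.natTrans t).app _)
      (E.powAdd_succ k l))).trans ?_
    refine (Category.assoc _ _ _).symm.trans ((congrArg (· ≫ _) e1).trans ?_)
    exact (congrArg (· ≫ _) (Category.comp_id _)).trans e2

end

end

/-! ### Insertion of a point into the Kelly product -/

section

open scoped DayFunctor
open Functor.LaxMonoidal

variable {V : Type u} [Category.{v} V] [MonoidalCategory V] [SymmetricCategory V]
  [MonoidalClosed V] [HasColimits V] {s : SeqKind}

lemma comp_app_eq {C : Type} [Category.{0} C] [MonoidalCategory C] {F G H : C ⊛⥤ V} {f : F ⟶ G}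
    {g : G ⟶ H} {h : F ⟶ H} (e : f ≫ g = h) (c : C) :
    f.natTrans.app c ≫ g.natTrans.app c = h.natTrans.app c := by
  rw [← e]; rfl

instance isIso_odotμ (D D' : Seq s V) (F : BSeq s V) : IsIso (odotμ D D' F) :=
  isIso_kellyμ F.powFunctor D D'

instance isIso_odotε (F : BSeq s V) : IsIso (odotε F) := isIso_kellyε F.powFunctor

/-- `(E ⊙ F)^{⊠ k}` is isomorphic to `E^{⊠ k} ⊙ F`. -/
instance isIso_powOdotHom (E F : BSeq s V) (k : ℕ) : IsIso (powOdotHom E F k) := by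
  induction k with
  | zero => exact isIso_odotε F
  | succ k ih =>
    rw [powOdotHom_succ]
    have : IsIso (powOdotHom E F k ▷ odot E.X F) := inferInstance
    exact IsIso.comp_isIso' this inferInstance

lemma rightUnitor_inv_tensorμ (X Y : V) : ((ρ_ X).inv ⊗ₘ (ρ_ Y).inv) ≫ tensorμ X (𝟙_ V) Y (𝟙_ V) =
    (ρ_ (X ⊗ Y)).inv ≫ (X ⊗ Y) ◁ (λ_ (𝟙_ V)).inv := by
  have h := ((ρ_ X).inv ⊗ₘ (ρ_ Y).inv) ≫= rightUnitor_monoidal X Y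
  rw [tensorHom_comp_tensorHom, Iso.inv_hom_id, Iso.inv_hom_id, id_tensorHom_id] at h
  rw [← cancel_mono ((X ⊗ Y) ◁ (λ_ (𝟙_ V)).hom), ← cancel_mono (ρ_ (X ⊗ Y)).hom]
  simp only [Category.assoc, ← h, whiskerLeft_inv_hom_assoc, Iso.inv_hom_id]

lemma leftUnitor_inv_tensorμ (X Y : V) : ((λ_ X).inv ⊗ₘ (λ_ Y).inv) ≫ tensorμ (𝟙_ V) X (𝟙_ V) Y =
    (λ_ (X ⊗ Y)).inv ≫ (λ_ (𝟙_ V)).inv ▷ (X ⊗ Y) := by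
  have h := ((λ_ X).inv ⊗ₘ (λ_ Y).inv) ≫= leftUnitor_monoidal X Y
  rw [tensorHom_comp_tensorHom, Iso.inv_hom_id, Iso.inv_hom_id, id_tensorHom_id] at h
  rw [← cancel_mono ((λ_ (𝟙_ V)).hom ▷ (X ⊗ Y)), ← cancel_mono (λ_ (X ⊗ Y)).hom]
  simp only [Category.assoc, ← h, inv_hom_whiskerRight_assoc, Iso.inv_hom_id]

section

variable (E : BSeq s V) (x : 𝟙_ V ⟶ E.X.functor.obj (op ⟨1⟩))

/-- The maps `D n ⟶ (D ⊙ E) n`, `d ↦ d ⊗ x^{⊗ n}`. -/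
noncomputable def odotPt (D : Seq s V) (n : ℕ) :
    D.functor.obj (op ⟨n⟩) ⟶ (odot D E).functor.obj (op ⟨n⟩) :=
  (ρ_ _).inv ≫ D.functor.obj (op ⟨n⟩) ◁ powPt E x n ≫ odotι D E ⟨n⟩ (op ⟨n⟩)

lemma odotRight_odotMap (D : Seq s V) (e : unitB s V ⟶ E) (n : ℕ) :
    odotRight D ⟨n⟩ ≫ (odotMap (𝟙 D) e).natTrans.app (op ⟨n⟩) =
      odotPt E (unitSeqι (𝟙 (⟨1⟩ : Idx s)) ≫ e.hom.natTrans.app (op ⟨1⟩)) D n := by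
  have e1 := odotι_odotMap (𝟙 D) e ⟨n⟩ (op ⟨n⟩)
  have e2 := powPt_powHom (unitSeqι (𝟙 (⟨1⟩ : Idx s))) e n
  have e3 : (𝟙 D : D ⟶ D).natTrans.app (op ⟨n⟩) = 𝟙 (D.functor.obj (op ⟨n⟩)) := rfl
  rw [e3, id_tensorHom] at e1
  unfold odotRight odotPt
  rw [Category.assoc, Category.assoc, e1, ← e2, MonoidalCategory.whiskerLeft_comp_assoc]

variable (hx : ∀ hs : s = .lambda, x ≫ E.X.functor.map (Idx.zeroOne hs).op =
      incUnit V (Idx s)ᵒᵖ ≫ (E.base hs).natTrans.app (op ⟨0⟩))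

/-- The maps `odotPt`, as a map of sequences. -/
noncomputable def odotPtHom (D : Seq s V) : D ⟶ odot D E where
  natTrans :=
    { app n := odotPt E x D n.unop.n
      naturality n m u := by
        have e1 := odotι_condition D E u.unop m
        have e2 := odotι_map D E n.unop u
        have e3 := powPt_natural E x hx u.unop
        change D.functor.map u ≫ (ρ_ _).inv ≫ _ ◁ powPt E x m.unop.n ≫ odotι D E m.unop m =
          ((ρ_ _).inv ≫ _ ◁ powPt E x n.unop.n ≫ odotι D E n.unop n) ≫ (odot D E).functor.map u
        have e1' : D.functor.map u ▷ (E.pow m.unop.n).functor.obj m ≫ odotι D E m.unop m =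
          D.functor.obj n ◁ (E.powMap m.unop.n n.unop.n u.unop).natTrans.app m ≫
            odotι D E n.unop m := e1
        have e3' : powPt E x m.unop.n ≫ (E.powMap m.unop.n n.unop.n u.unop).natTrans.app m =
          powPt E x n.unop.n ≫ (E.pow n.unop.n).functor.map u := e3.symm
        rw [rightUnitor_inv_naturality_assoc, ← whisker_exchange_assoc, e1',
          ← MonoidalCategory.whiskerLeft_comp_assoc]
        refine (congrArg (fun t => _ ≫ D.functor.obj n ◁ t ≫ _) e3').trans ?_
        rw [Category.assoc, Category.assoc, e2]
        exact congrArg (_ ≫ ·) (MonoidalCategory.whiskerLeft_comp_assoc _ _ _ _) }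

/-- The maps `d ↦ d ⊗ x^{⊗ n}` are monoidal in `D`. -/
lemma odotPtHom_tensor (D D' : Seq s V) :
    (odotPtHom E x hx D ⊗ₘ odotPtHom E x hx D') ≫ odotμ D D' E = odotPtHom E x hx (D ⊗ D') := by
  apply inc_hom_ext
  intro c d
  have e1 := inc_tensorHom (odotPtHom E x hx D) (odotPtHom E x hx D') c d
  have e2 := odotι_odotμ D D' E c.unop d.unop c d
  have e3 : (λ_ _).inv ≫ (powPt E x c.unop.n ⊗ₘ powPt E x d.unop.n) ≫
      powInc E c.unop.n d.unop.n c d = powPt E x (c.unop.n + d.unop.n) := by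
    refine Eq.trans ?_ (tensorPt_powPt E x c.unop.n d.unop.n)
    unfold tensorPt powInc
    rw [Category.assoc, Category.assoc]
  rw [DayFunctor.comp_natTrans, NatTrans.comp_app, reassoc_of% e1]
  change (((ρ_ (D.functor.obj c)).inv ≫ _ ◁ powPt E x c.unop.n ≫ odotι D E c.unop c) ⊗ₘ
    ((ρ_ (D'.functor.obj d)).inv ≫ _ ◁ powPt E x d.unop.n ≫ odotι D' E d.unop d)) ≫ _ =
    inc D D' c d ≫ (ρ_ ((D ⊗ D').functor.obj (c ⊗ d))).inv ≫
      (D ⊗ D').functor.obj (c ⊗ d) ◁ powPt E x (c.unop.n + d.unop.n) ≫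
        odotι (D ⊗ D') E ⟨c.unop.n + d.unop.n⟩ (c ⊗ d)
  rw [← tensorHom_comp_tensorHom_assoc, ← tensorHom_comp_tensorHom_assoc, e2, ← id_tensorHom,
    ← id_tensorHom, tensorμ_natural_assoc, tensorHom_comp_tensorHom_assoc, id_tensorHom_id,
    Category.id_comp, ← e3, rightUnitor_inv_naturality_assoc, ← whisker_exchange_assoc]
  rw [MonoidalCategory.whiskerLeft_comp_assoc, reassoc_of% (rightUnitor_inv_tensorμ
    (D.functor.obj c) (D'.functor.obj d))]
  refine congrArg (fun t => _ ≫ _ ≫ t) ?_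
  exact (congrArg (· ≫ _) (MonoidalCategory.tensorHom_def' _ _)).trans (Category.assoc _ _ _)

lemma odotPtHom_unit : odotPtHom E x hx (𝟙_ (Seq s V)) = odotε E := by
  apply incUnit_hom_ext
  refine Eq.trans ?_ (odotε_comp E).symm
  change incUnit V (Idx s)ᵒᵖ ≫ (ρ_ _).inv ≫ (𝟙_ (Seq s V)).functor.obj (op ⟨0⟩) ◁
    incUnit V (Idx s)ᵒᵖ ≫ odotι (𝟙_ (Seq s V)) E ⟨0⟩ (op ⟨0⟩) = _
  refine (rightUnitor_inv_naturality_assoc _ _).trans ?_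
  rw [unitors_inv_equal, MonoidalCategory.tensorHom_def, Category.assoc]
  rfl

lemma whiskerLeft_leftUnitor_inv_powInc (k : ℕ) (c d : (Idx s)ᵒᵖ) :
    (E.pow k).functor.obj c ◁ (λ_ E.X).inv.natTrans.app d ≫ powInc E k 1 c d =
      inc (E.pow k) E.X c d := by
  have e : E.pow k ◁ (λ_ E.X).inv ≫ (E.powAdd k 1).hom = 𝟙 _ := by
    rw [Pointed.powAdd_succ, Pointed.powAdd_zero]
    simp
  unfold powInc
  rw [← inc_whiskerLeft_assoc, comp_app_eq e]
  exact Category.comp_id _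

/-- The map `E^{⊠ k} ⟶ E^{⊠ k} ⊙ E`, `c ↦ x^{⊗ k} ⊗ c`. -/
noncomputable def powPtHom (k : ℕ) : E.pow k ⟶ odot (E.pow k) E where
  natTrans :=
    { app n := (λ_ _).inv ≫ powPt E x k ▷ _ ≫ odotι (E.pow k) E ⟨k⟩ n
      naturality n m u := by
        rw [leftUnitor_inv_naturality_assoc, whisker_exchange_assoc, Category.assoc,
          Category.assoc, odotι_map] }

/-- The map `E ⟶ E ⊙ E`, `c ↦ x ⊗ c`. -/
noncomputable def ptHom : E.X ⟶ odot E.X E where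
  natTrans :=
    { app n := (λ_ _).inv ≫ (x ⊗ₘ (λ_ E.X).inv.natTrans.app n) ≫ odotι E.X E ⟨1⟩ n
      naturality n m u := by
        rw [leftUnitor_inv_naturality_assoc, whiskerLeft_comp_tensorHom_assoc, Category.assoc,
          Category.assoc, odotι_map, tensorHom_comp_whiskerLeft_assoc, NatTrans.naturality] }

lemma powPtHom_succ (k : ℕ) :
    (powPtHom E x k ⊗ₘ ptHom E x) ≫ odotμ (E.pow k) E.X E = powPtHom E x (k + 1) := by
  apply inc_hom_ext
  intro c d
  have e1 := inc_tensorHom (powPtHom E x k) (ptHom E x) c d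
  have e2 := odotι_odotμ (E.pow k) E.X E ⟨k⟩ ⟨1⟩ c d
  rw [DayFunctor.comp_natTrans, NatTrans.comp_app, reassoc_of% e1]
  change (((λ_ ((E.pow k).functor.obj c)).inv ≫ powPt E x k ▷ _ ≫ odotι (E.pow k) E ⟨k⟩ c) ⊗ₘ
    ((λ_ (E.X.functor.obj d)).inv ≫ (x ⊗ₘ (λ_ E.X).inv.natTrans.app d) ≫ odotι E.X E ⟨1⟩ d)) ≫ _ =
    inc (E.pow k) E.X c d ≫ (λ_ ((E.pow k ⊗ E.X).functor.obj (c ⊗ d))).inv ≫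
      tensorPt (powPt E x k) x ▷ _ ≫
        odotι (E.pow k ⊗ E.X) E ⟨k + 1⟩ (c ⊗ d)
  rw [← tensorHom_comp_tensorHom_assoc, ← tensorHom_comp_tensorHom_assoc, e2, ← tensorHom_id,
    tensorμ_natural_assoc, tensorHom_comp_tensorHom_assoc,
    leftUnitor_inv_naturality_assoc, whisker_exchange_assoc]
  rw [reassoc_of% (leftUnitor_inv_tensorμ ((E.pow k).functor.obj c) (E.X.functor.obj d)),
    id_tensorHom, whiskerLeft_leftUnitor_inv_powInc]
  unfold tensorPt
  rw [comp_whiskerRight_assoc]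
  refine congrArg (fun t => _ ≫ _ ≫ t) ?_
  exact (congrArg (· ≫ _) (MonoidalCategory.tensorHom_def _ _)).trans (Category.assoc _ _ _)

lemma powPtHom_zero : powPtHom E x 0 = odotε E := by
  apply incUnit_hom_ext
  refine Eq.trans ?_ (odotε_comp E).symm
  change incUnit V (Idx s)ᵒᵖ ≫ (λ_ _).inv ≫
    incUnit V (Idx s)ᵒᵖ ▷ (𝟙_ (Seq s V)).functor.obj (op ⟨0⟩) ≫
      odotι (𝟙_ (Seq s V)) E ⟨0⟩ (op ⟨0⟩) = _
  refine (leftUnitor_inv_naturality_assoc _ _).trans ?_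
  rw [MonoidalCategory.tensorHom_def', Category.assoc]
  rfl

lemma odotLeft_odotMap (u : unitSeq s V ⟶ E.X) :
    odotLeft E ≫ odotMap u (𝟙 E) =
      ptHom E (unitSeqι (𝟙 (⟨1⟩ : Idx s)) ≫ u.natTrans.app (op ⟨1⟩)) := by
  rw [← odotWhisker_eq]
  ext n
  have e := odotLeft_app E n
  refine (congrArg (· ≫ _) e).trans ?_
  rw [Category.assoc, Category.assoc, odotι_odotWhisker, tensorHom_comp_whiskerRight_assoc]
  rfl

end

end

/-! ### Operads as composition maps on tensor powers -/

section

open scoped DayFunctor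
open Functor.LaxMonoidal

variable {V : Type u} [Category.{v} V] [MonoidalCategory V] [SymmetricCategory V]
  [MonoidalClosed V] [HasColimits V] {s : SeqKind}

namespace KellyMonoid

variable (C : KellyMonoid s V)

/-- The unit element `I ⟶ C 1`. -/
noncomputable def onePt : 𝟙_ V ⟶ C.X.X.functor.obj (op ⟨1⟩) :=
  unitSeqι (𝟙 (⟨1⟩ : Idx s)) ≫ C.one.hom.natTrans.app (op ⟨1⟩)

/-- Forgetting the input of the unit element gives the base point. -/
lemma onePt_map (hs : s = .lambda) : C.onePt ≫ C.X.X.functor.map (Idx.zeroOne hs).op =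
    incUnit V (Idx s)ᵒᵖ ≫ (C.X.base hs).natTrans.app (op ⟨0⟩) := by
  have e1 := comp_app_eq (C.one.base_hom hs) (op (⟨0⟩ : Idx s))
  have e2 := incUnit_unitBase (V := V) hs
  have e3 := unitSeqι_map (V := V) (Idx.zeroOne hs) (𝟙 (⟨1⟩ : Idx s))
  have n := C.one.hom.natTrans.naturality (Idx.zeroOne hs).op
  unfold onePt
  rw [Category.assoc, ← n, reassoc_of% e3, ← e1]
  exact ((reassoc_of% e2) _).symm

/-- The point `1^{⊗ n}` of `C^{⊠ n} n`. -/
noncomputable def pt (n : ℕ) : 𝟙_ V ⟶ (C.X.pow n).functor.obj (op ⟨n⟩) := powPt C.X C.onePt n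

/-- The point of `C^{⊠ n} m` given by a morphism `f : m ⟶ n`. -/
noncomputable def ptMap {m n : ℕ} (f : (⟨m⟩ : Idx s) ⟶ ⟨n⟩) :
    𝟙_ V ⟶ (C.X.pow n).functor.obj (op ⟨m⟩) := C.pt n ≫ (C.X.pow n).functor.map f.op

lemma ptMap_id (n : ℕ) : C.ptMap (𝟙 (⟨n⟩ : Idx s)) = C.pt n := by
  unfold ptMap
  rw [op_id, CategoryTheory.Functor.map_id, Category.comp_id]

/-- The right action of `C` on its tensor powers, given by `C^{⊠ k} ⊙ C ≅ (C ⊙ C)^{⊠ k}` and the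
multiplication of `C`. -/
noncomputable def powComp (k : ℕ) : odot (C.X.pow k) C.X ⟶ C.X.pow k :=
  inv (powOdotHom C.X C.X k) ≫ Pointed.powHom C.mul k

lemma powOdotHom_powComp (k : ℕ) :
    powOdotHom C.X C.X k ≫ C.powComp k = Pointed.powHom C.mul k := by simp [powComp]

lemma odotε_powComp : odotε C.X ≫ C.powComp 0 = 𝟙 _ := C.powOdotHom_powComp 0

lemma odotμ_powComp (k : ℕ) : odotμ (C.X.pow k) C.X.X C.X ≫ C.powComp (k + 1) =
    C.powComp k ⊗ₘ C.mul.hom := by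
  have e := C.powOdotHom_powComp (k + 1)
  rw [powOdotHom_succ, Pointed.powHom_succ, ← C.powOdotHom_powComp k] at e
  have e' : powOdotHom C.X C.X k ▷ odot C.X.X C.X ≫
      odotμ (C.X.pow k) C.X.X C.X ≫ C.powComp (k + 1) =
        powOdotHom C.X C.X k ▷ odot C.X.X C.X ≫ (C.powComp k ⊗ₘ C.mul.hom) := by
    rw [whiskerRight_comp_tensorHom]
    exact (Category.assoc _ _ _).symm.trans e
  exact (cancel_epi _).1 e'

lemma odotPtHom_mul : odotPtHom C.X C.onePt C.onePt_map C.X.X ≫ C.mul.hom = 𝟙 _ := by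
  ext n
  have e1 := C.mul_one n.unop
  have e2 := odotRight_odotMap C.X C.X.X C.one n.unop.n
  rw [DayFunctor.comp_natTrans, NatTrans.comp_app] at e1
  refine Eq.trans ?_ e1
  exact ((reassoc_of% e2) _).symm

lemma ptHom_mul : ptHom C.X C.onePt ≫ C.mul.hom = 𝟙 _ := by
  have e := odotLeft_odotMap C.X C.one.hom
  exact ((reassoc_of% e) _).symm.trans C.one_mul

/-- The right unit law for the composition on `C^{⊠ k}`. -/
lemma odotPtHom_powComp (k : ℕ) :
    odotPtHom C.X C.onePt C.onePt_map (C.X.pow k) ≫ C.powComp k = 𝟙 _ := by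
  induction k with
  | zero => rw [odotPtHom_unit]; exact C.odotε_powComp
  | succ k ih =>
    have e := odotPtHom_tensor C.X C.onePt C.onePt_map (C.X.pow k) C.X.X
    refine (congrArg (· ≫ _) e.symm).trans ?_
    rw [Category.assoc, odotμ_powComp, tensorHom_comp_tensorHom, ih, odotPtHom_mul]
    exact id_tensorHom_id _ _

/-- The left unit law for the composition on `C^{⊠ k}`. -/
lemma powPtHom_powComp (k : ℕ) : powPtHom C.X C.onePt k ≫ C.powComp k = 𝟙 _ := by
  induction k with
  | zero => rw [powPtHom_zero]; exact C.odotε_powComp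
  | succ k ih =>
    have e := powPtHom_succ C.X C.onePt k
    refine (congrArg (· ≫ _) e.symm).trans ?_
    rw [Category.assoc, odotμ_powComp, tensorHom_comp_tensorHom, ih, ptHom_mul]
    exact id_tensorHom_id _ _

/-- The composition maps `C^{⊠ k} l ⊗ C^{⊠ l} n ⟶ C^{⊠ k} n`. -/
noncomputable def comp (k l n : ℕ) : (C.X.pow k).functor.obj (op ⟨l⟩) ⊗
    (C.X.pow l).functor.obj (op ⟨n⟩) ⟶ (C.X.pow k).functor.obj (op ⟨n⟩) :=
  odotι (C.X.pow k) C.X ⟨l⟩ (op ⟨n⟩) ≫ (C.powComp k).natTrans.app (op ⟨n⟩)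

/-- Composition with the point of `f` on the left is the functoriality of `C^{⊠ k}` in `k`. -/
lemma ptMap_comp {l k : ℕ} (f : (⟨l⟩ : Idx s) ⟶ ⟨k⟩) (n : ℕ) :
    C.ptMap f ▷ (C.X.pow l).functor.obj (op ⟨n⟩) ≫ C.comp k l n =
      (λ_ _).hom ≫ (C.X.powMap l k f).natTrans.app (op ⟨n⟩) := by
  have e1 := odotι_condition (C.X.pow k) C.X f (op ⟨n⟩)
  have e2 : (λ_ _).inv ≫ C.pt k ▷ _ ≫ odotι (C.X.pow k) C.X ⟨k⟩ (op ⟨n⟩) ≫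
    (C.powComp k).natTrans.app (op ⟨n⟩) = 𝟙 _ := by
    refine Eq.trans ?_ (comp_app_eq (C.powPtHom_powComp k) (op (⟨n⟩ : Idx s)))
    exact (congrArg (_ ≫ ·) (Category.assoc _ _ _).symm).trans (Category.assoc _ _ _).symm
  unfold ptMap comp
  rw [comp_whiskerRight_assoc, reassoc_of% e1, ← whisker_exchange_assoc]
  rw [Iso.inv_comp_eq, Category.comp_id] at e2
  rw [e2, leftUnitor_naturality]

/-- Composition with the point of `g` on the right is the functoriality of the sequence
`C^{⊠ k}`. -/
lemma comp_ptMap {n m : ℕ} (k : ℕ) (g : (⟨m⟩ : Idx s) ⟶ ⟨n⟩) :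
    (C.X.pow k).functor.obj (op ⟨n⟩) ◁ C.ptMap g ≫ C.comp k n m =
      (ρ_ _).hom ≫ (C.X.pow k).functor.map g.op := by
  have e1 := odotι_map (C.X.pow k) C.X ⟨n⟩ g.op
  have e2 : (ρ_ _).inv ≫ _ ◁ C.pt n ≫ odotι (C.X.pow k) C.X ⟨n⟩ (op ⟨n⟩) ≫
    (C.powComp k).natTrans.app (op ⟨n⟩) = 𝟙 _ := by
    refine Eq.trans ?_ (comp_app_eq (C.odotPtHom_powComp k) (op (⟨n⟩ : Idx s)))
    exact (congrArg (_ ≫ ·) (Category.assoc _ _ _).symm).trans (Category.assoc _ _ _).symm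
  rw [Iso.inv_comp_eq, Category.comp_id] at e2
  have n := (C.powComp k).natTrans.naturality g.op
  unfold ptMap comp
  rw [MonoidalCategory.whiskerLeft_comp_assoc, ← reassoc_of% e1, n, reassoc_of% e2]

/-- The action maps `D k ⊗ C^{⊠ k} n ⟶ D n`. -/
noncomputable def actι {D : Seq s V} (act : odot D C.X ⟶ D) (k n : ℕ) :
    D.functor.obj (op ⟨k⟩) ⊗ (C.X.pow k).functor.obj (op ⟨n⟩) ⟶ D.functor.obj (op ⟨n⟩) :=
  odotι D C.X ⟨k⟩ (op ⟨n⟩) ≫ act.natTrans.app (op ⟨n⟩)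

/-- The associativity of an action in terms of its components. -/
lemma act_assoc_iff {D : Seq s V} (act : odot D C.X ⟶ D) :
    odotAssoc D C.X C.X ≫ odotMap act (𝟙 C.X) ≫ act = odotMap (𝟙 D) C.mul ≫ act ↔
      ∀ k l n, C.actι act k l ▷ (C.X.pow l).functor.obj (op ⟨n⟩) ≫ C.actι act l n =
        (α_ _ _ _).hom ≫ D.functor.obj (op ⟨k⟩) ◁ C.comp k l n ≫ C.actι act k n := by
  have L (k l n : ℕ) : D.functor.obj (op ⟨k⟩) ◁ odotι (C.X.pow k) C.X ⟨l⟩ (op ⟨n⟩) ≫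
      D.functor.obj (op ⟨k⟩) ◁ (inv (powOdotHom C.X C.X k)).natTrans.app (op ⟨n⟩) ≫
        odotι D (bodot C.X C.X) ⟨k⟩ (op ⟨n⟩) ≫
          (odotAssoc D C.X C.X ≫ odotMap act (𝟙 C.X) ≫ act).natTrans.app (op ⟨n⟩) =
      (α_ _ _ _).inv ≫ C.actι act k l ▷ (C.X.pow l).functor.obj (op ⟨n⟩) ≫ C.actι act l n := by
    rw [← odotWhisker_eq]
    simp only [DayFunctor.comp_natTrans, NatTrans.comp_app]
    have e1 := odotι_odotAssoc D C.X C.X ⟨k⟩ (op ⟨n⟩)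
    have e2 := kι_assocComp D C.X C.X ⟨k⟩ ⟨l⟩ (op ⟨n⟩)
    have e3 := odotι_odotWhisker act C.X ⟨l⟩ (op ⟨n⟩)
    rw [reassoc_of% e1, ← MonoidalCategory.whiskerLeft_comp_assoc _
      ((inv (powOdotHom C.X C.X k)).natTrans.app (op ⟨n⟩)), inv_app_comp_app,
      MonoidalCategory.whiskerLeft_id, Category.id_comp, reassoc_of% e2]
    unfold assocComp₂ actι
    rw [Category.assoc, Category.assoc, reassoc_of% e3, comp_whiskerRight_assoc]
  have R (k l n : ℕ) : D.functor.obj (op ⟨k⟩) ◁ odotι (C.X.pow k) C.X ⟨l⟩ (op ⟨n⟩) ≫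
      D.functor.obj (op ⟨k⟩) ◁ (inv (powOdotHom C.X C.X k)).natTrans.app (op ⟨n⟩) ≫
        odotι D (bodot C.X C.X) ⟨k⟩ (op ⟨n⟩) ≫
          (odotMap (𝟙 D) C.mul ≫ act).natTrans.app (op ⟨n⟩) =
      D.functor.obj (op ⟨k⟩) ◁ C.comp k l n ≫ C.actι act k n := by
    simp only [DayFunctor.comp_natTrans, NatTrans.comp_app]
    have e1 := odotι_odotMap (𝟙 D) C.mul ⟨k⟩ (op ⟨n⟩)
    have e3 : (𝟙 D : D ⟶ D).natTrans.app (op ⟨k⟩) = 𝟙 (D.functor.obj (op ⟨k⟩)) := rfl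
    rw [e3, id_tensorHom] at e1
    rw [reassoc_of% e1]
    unfold comp actι powComp
    rw [DayFunctor.comp_natTrans, NatTrans.comp_app, MonoidalCategory.whiskerLeft_comp_assoc,
      MonoidalCategory.whiskerLeft_comp_assoc]
  constructor
  · intro h k l n
    rw [← R, ← h, L, Iso.hom_inv_id_assoc]
  · intro h
    apply odot_hom_ext
    intro k n
    -- `(C ⊙ C)^{⊠ k}` may be replaced by `C^{⊠ k} ⊙ C`, which is a coend.
    rw [← cancel_epi (D.functor.obj (op k) ◁ (inv (powOdotHom C.X C.X k.n)).natTrans.app n)]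
    apply odot_whiskerLeft_ext
    intro l
    refine (L k.n l.n n.unop.n).trans (Eq.trans ?_ (R k.n l.n n.unop.n).symm)
    rw [h, Iso.inv_hom_id_assoc]

/-- The unitality of an action in terms of its components. -/
lemma act_one_iff {D : Seq s V} (act : odot D C.X ⟶ D) (n : ℕ) :
    odotRight D ⟨n⟩ ≫ (odotMap (𝟙 D) C.one ≫ act).natTrans.app (op ⟨n⟩) = 𝟙 _ ↔
      D.functor.obj (op ⟨n⟩) ◁ C.pt n ≫ C.actι act n n = (ρ_ _).hom := by
  have e2 := odotRight_odotMap C.X D C.one n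
  rw [DayFunctor.comp_natTrans, NatTrans.comp_app, reassoc_of% e2]
  unfold odotPt actι
  rw [Category.assoc, Category.assoc, Iso.inv_comp_eq, Category.comp_id]
  rfl

end KellyMonoid

end

/-! ### Right modules as families of action maps -/

section

open scoped DayFunctor
open Functor.LaxMonoidal

variable {V : Type u} [Category.{v} V] [MonoidalCategory V] [SymmetricCategory V]
  [MonoidalClosed V] [HasColimits V] {s : SeqKind}

namespace RightModule

variable {C : KellyMonoid s V}

section

variable (M : RightModule C)

lemma actι_assoc (k l n : ℕ) :
    C.actι M.act k l ▷ (C.X.pow l).functor.obj (op ⟨n⟩) ≫ C.actι M.act l n =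
      (α_ _ _ _).hom ≫ M.X.functor.obj (op ⟨k⟩) ◁ C.comp k l n ≫ C.actι M.act k n :=
  (C.act_assoc_iff M.act).1 M.assoc k l n

lemma actι_pt (n : ℕ) :
    M.X.functor.obj (op ⟨n⟩) ◁ C.pt n ≫ C.actι M.act n n = (ρ_ _).hom :=
  (C.act_one_iff M.act n).1 (M.act_one ⟨n⟩)

/-- The functoriality of a right module is the action of the points `ptMap f`. -/
lemma actι_ptMap {m n : ℕ} (f : (⟨m⟩ : Idx s) ⟶ ⟨n⟩) :
    M.X.functor.obj (op ⟨n⟩) ◁ C.ptMap f ≫ C.actι M.act n m =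
      (ρ_ _).hom ≫ M.X.functor.map f.op := by
  have e := odotι_map M.X C.X ⟨n⟩ f.op
  have n := M.act.natTrans.naturality f.op
  unfold KellyMonoid.ptMap
  rw [MonoidalCategory.whiskerLeft_comp_assoc]
  unfold KellyMonoid.actι
  rw [← reassoc_of% e, n, ← actι_pt]
  simp only [KellyMonoid.actι, Category.assoc]

lemma actι_hom {M N : RightModule C} (φ : M ⟶ N) (k n : ℕ) :
    C.actι M.act k n ≫ φ.hom.natTrans.app (op ⟨n⟩) =
      φ.hom.natTrans.app (op ⟨k⟩) ▷ _ ≫ C.actι N.act k n := by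
  have e := comp_app_eq φ.act_hom (op (⟨n⟩ : Idx s))
  have e2 := odotι_odotWhisker φ.hom C.X ⟨k⟩ (op ⟨n⟩)
  unfold KellyMonoid.actι
  rw [Category.assoc, e, ← odotWhisker_eq, DayFunctor.comp_natTrans, NatTrans.comp_app,
    reassoc_of% e2]

section

variable {M N : RightModule C}
  (φ : ∀ n : ℕ, M.X.functor.obj (op ⟨n⟩) ⟶ N.X.functor.obj (op ⟨n⟩))
  (hφ : ∀ k n, C.actι M.act k n ≫ φ n = φ k ▷ _ ≫ C.actι N.act k n)

/-- A family of maps that is compatible with the action maps is natural. -/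
def seqHomOfActι : M.X ⟶ N.X where
  natTrans :=
    { app n := φ n.unop.n
      naturality n m u := by
        have e1 := M.actι_ptMap u.unop
        have e2 := N.actι_ptMap u.unop
        have h := hφ n.unop.n m.unop.n
        change M.X.functor.map u.unop.op ≫ φ m.unop.n = φ n.unop.n ≫ N.X.functor.map u.unop.op
        rw [← cancel_epi (ρ_ _).hom, ← reassoc_of% e1, h, whisker_exchange_assoc, e2,
          rightUnitor_naturality_assoc] }

/-- A family of maps that is compatible with the action maps is a map of right modules. -/
def homOfActι : M ⟶ N where
  hom := seqHomOfActι φ hφ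
  act_hom := by
    apply odot_hom_ext
    intro k n
    rw [← odotWhisker_eq]
    have e := odotι_odotWhisker (seqHomOfActι φ hφ) C.X k n
    rw [DayFunctor.comp_natTrans, DayFunctor.comp_natTrans, NatTrans.comp_app, NatTrans.comp_app,
      reassoc_of% e]
    exact (Category.assoc _ _ _).symm.trans (hφ k.n n.unop.n)

end

end

end RightModule

variable (C : KellyMonoid s V)

/-- A family of objects of `V` with associative and unital action maps of `C`. No functoriality is
required: it is recovered from the action. -/
structure ActionMaps where
  obj : ℕ → V
  act : ∀ k n, obj k ⊗ (C.X.pow k).functor.obj (op ⟨n⟩) ⟶ obj n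
  assoc : ∀ k l n, act k l ▷ (C.X.pow l).functor.obj (op ⟨n⟩) ≫ act l n =
    (α_ _ _ _).hom ≫ obj k ◁ C.comp k l n ≫ act k n
  unit : ∀ n, obj n ◁ C.pt n ≫ act n n = (ρ_ _).hom

namespace ActionMaps

variable {C} (A : ActionMaps C)

/-- The map `A n ⟶ A m` given by the action on the point of `f : m ⟶ n`. -/
noncomputable def map {m n : ℕ} (f : (⟨m⟩ : Idx s) ⟶ ⟨n⟩) : A.obj n ⟶ A.obj m :=
  (ρ_ _).inv ≫ A.obj n ◁ C.ptMap f ≫ A.act n m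

/-- The action maps `A p ⊗ C^{⊠ p} n ⟶ A n` are natural in `n`. -/
lemma act_map {m n : ℕ} (p : ℕ) (f : (⟨m⟩ : Idx s) ⟶ ⟨n⟩) :
    A.act p n ≫ A.map f = A.obj p ◁ (C.X.pow p).functor.map f.op ≫ A.act p m := by
  unfold map
  have e := C.comp_ptMap p f
  rw [rightUnitor_inv_naturality_assoc, ← whisker_exchange_assoc, A.assoc,
    associator_naturality_right_assoc, ← MonoidalCategory.whiskerLeft_comp_assoc, e]
  simp

/-- The action maps `A n ⊗ C^{⊠ n} p ⟶ A p` are dinatural in `n`. -/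
lemma map_act {m n : ℕ} (f : (⟨m⟩ : Idx s) ⟶ ⟨n⟩) (p : ℕ) :
    A.map f ▷ (C.X.pow m).functor.obj (op ⟨p⟩) ≫ A.act m p =
      A.obj n ◁ (C.X.powMap m n f).natTrans.app (op ⟨p⟩) ≫ A.act n p := by
  unfold map
  have e := C.ptMap_comp f p
  rw [comp_whiskerRight_assoc, comp_whiskerRight_assoc, A.assoc,
    associator_naturality_middle_assoc, ← MonoidalCategory.whiskerLeft_comp_assoc, e]
  simp

/-- The sequence underlying a family of action maps. -/
noncomputable def seq : Seq s V where
  functor :=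
    { obj n := A.obj n.unop.n
      map f := A.map f.unop
      map_id n := by
        change A.map (𝟙 n.unop) = _
        unfold map
        rw [C.ptMap_id, A.unit, Iso.inv_hom_id]
      map_comp {n m p} f g := by
        have e : C.ptMap (g.unop ≫ f.unop) = C.ptMap f.unop ≫ (C.X.pow n.unop.n).functor.map g := by
          unfold KellyMonoid.ptMap
          rw [Category.assoc]
          exact congrArg (_ ≫ ·) ((C.X.pow n.unop.n).functor.map_comp f g)
        have e2 := A.act_map n.unop.n g.unop
        change A.map (g.unop ≫ f.unop) = A.map f.unop ≫ A.map g.unop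
        rw [map, map, Category.assoc, Category.assoc, e2, e,
          MonoidalCategory.whiskerLeft_comp_assoc]
        rfl }

/-- The components of the action on `seq`. -/
noncomputable def seqActApp (n : (Idx s)ᵒᵖ) :
    (odot A.seq C.X).functor.obj n ⟶ A.seq.functor.obj n :=
  odotDesc A.seq C.X (X := A.obj n.unop.n) (fun k => A.act k.n n.unop.n)
    (fun i j g => A.map_act g n.unop.n)

lemma odotι_seqActApp (k : Idx s) (n : (Idx s)ᵒᵖ) :
    odotι A.seq C.X k n ≫ A.seqActApp n = A.act k.n n.unop.n :=
  odotι_odotDesc A.seq C.X _ (fun i j g => A.map_act g n.unop.n) k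

/-- The action on `seq`. -/
noncomputable def seqAct : odot A.seq C.X ⟶ A.seq where
  natTrans :=
    { app := A.seqActApp
      naturality n m u := by
        apply odot_ext
        intro k
        have e1 := A.odotι_seqActApp k n
        have e2 := A.odotι_seqActApp k m
        rw [odotι_map_assoc, e2, reassoc_of% e1]
        exact (A.act_map k.n u.unop).symm }

lemma actι_seqAct (k n : ℕ) : C.actι A.seqAct k n = A.act k n :=
  A.odotι_seqActApp ⟨k⟩ (op ⟨n⟩)

/-- The right module given by a family of action maps. -/
noncomputable def toModule : RightModule C where
  X := A.seq
  act := A.seqAct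
  assoc := by
    rw [KellyMonoid.act_assoc_iff]
    intro k l n
    rw [actι_seqAct, actι_seqAct, actι_seqAct]
    exact A.assoc k l n
  act_one n := by
    refine (C.act_one_iff _ n.n).2 ?_
    rw [actι_seqAct]
    exact A.unit n.n

end ActionMaps

end

/-! ### Restriction of right modules to `Σ` -/

section

open scoped DayFunctor
open Functor.LaxMonoidal

variable {V : Type u} [Category.{v} V] [MonoidalCategory V] [SymmetricCategory V]
  [MonoidalClosed V] [HasColimits V]

namespace KellyMonoid

section

variable {s' s : SeqKind} (h : s' = .lambda → s = .lambda) (C : KellyMonoid s V)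

lemma restrict_powComp (k : ℕ) : (C.restrict h).powComp k ≫ resPow h C.X k =
    odotWhisker (resPow h C.X k) (resB h C.X) ≫ resOdot h (C.X.pow k) C.X ≫
      (res h).map (C.powComp k) := by
  have e1 : powOdotHom (resB h C.X) (resB h C.X) k ≫ (C.restrict h).powComp k =
    Pointed.powHom (resOdotB h C.X C.X ≫ resBMap h C.mul) k :=
      (C.restrict h).powOdotHom_powComp k
  have e2 := powOdotHom_resOdot h C.X C.X k
  have e3 := congrArg (res h).map (C.powOdotHom_powComp k)
  rw [Functor.map_comp] at e3
  have e4 := resPow_powHom h C.mul k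
  refine (cancel_epi (powOdotHom (resB h C.X) (resB h C.X) k)).1 ?_
  refine ((Category.assoc _ _ _).symm.trans (congrArg (· ≫ resPow h C.X k) e1)).trans
    (Eq.trans ?_ ((reassoc_of% e2) _).symm)
  rw [Pointed.powHom_comp, Category.assoc, e4]
  exact congrArg (fun t => _ ≫ _ ≫ t) e3.symm

lemma restrict_comp (k l n : ℕ) :
    (C.restrict h).comp k l n ≫ (resPow h C.X k).natTrans.app (op ⟨n⟩) =
      ((resPow h C.X k).natTrans.app (op ⟨l⟩) ⊗ₘ (resPow h C.X l).natTrans.app (op ⟨n⟩)) ≫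
        C.comp k l n := by
  have e1 := comp_app_eq (C.restrict_powComp h k) (op (⟨n⟩ : Idx s'))
  have e2 := odotι_odotWhisker (resPow h C.X k) (resB h C.X) ⟨l⟩ (op ⟨n⟩)
  have e3 := odotι_resOdot h (C.X.pow k) C.X ⟨l⟩ (op ⟨n⟩)
  refine (Category.assoc _ _ _).trans ((congrArg (_ ≫ ·) e1).trans ?_)
  simp only [DayFunctor.comp_natTrans, NatTrans.comp_app]
  refine ((reassoc_of% e2) _).trans ?_
  refine (congrArg (_ ≫ ·) ((reassoc_of% e3) _)).trans ?_
  rw [MonoidalCategory.tensorHom_def, Category.assoc]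
  rfl

lemma restrict_pt (n : ℕ) :
    (C.restrict h).pt n ≫ (resPow h C.X n).natTrans.app (op ⟨n⟩) = C.pt n := by
  have e1 := powPt_powHom (unitSeqι (V := V) (𝟙 (⟨1⟩ : Idx s')))
    (resUnit h V ≫ resBMap h C.one) n
  have e2 := powPt_res (V := V) h n
  have e3 := powPt_powHom (unitSeqι (V := V) (𝟙 (⟨1⟩ : Idx s))) C.one n
  have e4 := comp_app_eq (resPow_powHom h C.one n) (op (⟨n⟩ : Idx s'))
  rw [Pointed.powHom_comp, DayFunctor.comp_natTrans, NatTrans.comp_app] at e1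
  refine (congrArg (· ≫ _) e1.symm).trans ?_
  rw [Category.assoc, Category.assoc, e4]
  refine Eq.trans ?_ e3
  exact (reassoc_of% e2) _

lemma restrict_actι (M : RightModule C) (k n : ℕ) :
    (C.restrict h).actι ((RightModule.restrict h C).obj M).act k n =
      M.X.functor.obj (op ⟨k⟩) ◁ (resPow h C.X k).natTrans.app (op ⟨n⟩) ≫ C.actι M.act k n := by
  have e := odotι_resOdot h M.X C.X ⟨k⟩ (op ⟨n⟩)
  exact ((reassoc_of% e) (M.act.natTrans.app (op ⟨n⟩)))

end

end KellyMonoid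

/-- Transport of the associativity of action maps along isomorphisms `i`, `i'` and `i''` that
intertwine the compositions `c` and `c'`. -/
lemma action_assoc_of_iso {X Y Z A A' B B' D D' : V} {i : A ⟶ A'} {j : A' ⟶ A} {i' : B ⟶ B'}
    {j' : B' ⟶ B} {i'' : D ⟶ D'} {j'' : D' ⟶ D} {c : A ⊗ B ⟶ D} {c' : A' ⊗ B' ⟶ D'}
    {a₁ : X ⊗ A ⟶ Y} {a₂ : Y ⊗ B ⟶ Z} {a₃ : X ⊗ D ⟶ Z} (h : j ≫ i = 𝟙 A') (h' : j' ≫ i' = 𝟙 B')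
    (h'' : i'' ≫ j'' = 𝟙 D) (hc : c ≫ i'' = (i ⊗ₘ i') ≫ c')
    (ha : a₁ ▷ B ≫ a₂ = (α_ _ _ _).hom ≫ X ◁ c ≫ a₃) :
    (X ◁ j ≫ a₁) ▷ B' ≫ Y ◁ j' ≫ a₂ = (α_ _ _ _).hom ≫ X ◁ c' ≫ X ◁ j'' ≫ a₃ := by
  have e : c' ≫ j'' = (j ⊗ₘ j') ≫ c := by
    have e1 : c' = (j ⊗ₘ j') ≫ c ≫ i'' := by
      rw [hc, tensorHom_comp_tensorHom_assoc, h, h', id_tensorHom_id, Category.id_comp]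
    rw [e1, Category.assoc, Category.assoc, h'', Category.comp_id]
  rw [← MonoidalCategory.whiskerLeft_comp_assoc, e, MonoidalCategory.whiskerLeft_comp_assoc,
    comp_whiskerRight_assoc, ← whisker_exchange_assoc, ha, MonoidalCategory.tensorHom_def,
    MonoidalCategory.whiskerLeft_comp_assoc]
  simp

lemma action_unit_of_iso {X A A' : V} {i : A ⟶ A'} {j : A' ⟶ A} {p : 𝟙_ V ⟶ A} {p' : 𝟙_ V ⟶ A'}
    {a : X ⊗ A ⟶ X} (h : i ≫ j = 𝟙 A) (hp : p ≫ i = p') (ha : X ◁ p ≫ a = (ρ_ _).hom) :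
    X ◁ p' ≫ X ◁ j ≫ a = (ρ_ _).hom := by
  rw [← hp, MonoidalCategory.whiskerLeft_comp_assoc, ← MonoidalCategory.whiskerLeft_comp_assoc _ i,
    h, MonoidalCategory.whiskerLeft_id, Category.id_comp, ha]

lemma whiskerLeft_cancel_inv {X A A' Y : V} {i : A ⟶ A'} {j : A' ⟶ A} (h : i ≫ j = 𝟙 A)
    (a : X ⊗ A ⟶ Y) : X ◁ i ≫ X ◁ j ≫ a = a := by
  rw [← MonoidalCategory.whiskerLeft_comp_assoc, h, MonoidalCategory.whiskerLeft_id,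
    Category.id_comp]

namespace RightModule

variable {C : KellyMonoid .lambda V}

/-- The action maps of `C` on a right module in `Σ`-sequences: the restriction to `Σ` of `C^{⊠ k}`
is the `k`-th tensor power of the restriction of `C`. -/
noncomputable def extend (X : RightModule (C.restrict Idx.sigmaToLambda)) : ActionMaps C where
  obj n := X.X.functor.obj (op ⟨n⟩)
  act k n := X.X.functor.obj (op ⟨k⟩) ◁
      (inv (resPow Idx.sigmaToLambda C.X k)).natTrans.app (op ⟨n⟩) ≫
    (C.restrict Idx.sigmaToLambda).actι X.act k n
  assoc k l n := action_assoc_of_iso (inv_app_comp_app (resPow Idx.sigmaToLambda C.X k) (op ⟨l⟩))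
    (inv_app_comp_app (resPow Idx.sigmaToLambda C.X l) (op ⟨n⟩))
    (app_comp_inv_app (resPow Idx.sigmaToLambda C.X k) (op ⟨n⟩))
    (C.restrict_comp Idx.sigmaToLambda k l n) (X.actι_assoc k l n)
  unit n := action_unit_of_iso (app_comp_inv_app (resPow Idx.sigmaToLambda C.X n) (op ⟨n⟩))
    (C.restrict_pt Idx.sigmaToLambda n) (X.actι_pt n)

lemma resPow_extend (X : RightModule (C.restrict Idx.sigmaToLambda)) (k n : ℕ) :
    X.X.functor.obj (op ⟨k⟩) ◁ (resPow Idx.sigmaToLambda C.X k).natTrans.app (op ⟨n⟩) ≫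
      X.extend.act k n = (C.restrict Idx.sigmaToLambda).actι X.act k n :=
  whiskerLeft_cancel_inv (app_comp_inv_app _ _) _

end RightModule

end

/-! ### Comparison of right modules in `Λ`-objects and in `Σ`-objects -/

section

open scoped DayFunctor

variable {V : Type u} [Category.{v} V] [MonoidalCategory V] [SymmetricCategory V]
  [MonoidalClosed V] [HasColimits V]

lemma action_hom_of_iso {X X' Y Y' A A' : V} {i : A ⟶ A'} {j : A' ⟶ A} (h : j ≫ i = 𝟙 A')
    {a : X ⊗ A ⟶ X'} {b : Y ⊗ A ⟶ Y'} {a' : X ⊗ A' ⟶ X'} {b' : Y ⊗ A' ⟶ Y'} {f : X ⟶ Y}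
    {g : X' ⟶ Y'} (ha : a = X ◁ i ≫ a') (hb : b = Y ◁ i ≫ b') (hab : a ≫ g = f ▷ A ≫ b) :
    a' ≫ g = f ▷ A' ≫ b' := by
  have e : X ◁ j ≫ a ≫ g = X ◁ j ≫ f ▷ A ≫ b := by rw [hab]
  rwa [ha, hb, Category.assoc, ← MonoidalCategory.whiskerLeft_comp_assoc, h,
    MonoidalCategory.whiskerLeft_id, Category.id_comp, whisker_exchange_assoc,
    ← MonoidalCategory.whiskerLeft_comp_assoc, h, MonoidalCategory.whiskerLeft_id,
    Category.id_comp] at e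

namespace RightModule

lemma eqToHom_app {s : SeqKind} {C : KellyMonoid s V} {M N : RightModule C} (e : M = N)
    (n : (Idx s)ᵒᵖ) : (eqToHom e).hom.natTrans.app n =
      eqToHom (congrArg (fun M : RightModule C => M.X.functor.obj n) e) := by
  subst e
  rfl

end RightModule

namespace BasedOperad

variable (C : BasedOperad V)

instance : (modulesToSigma C).Faithful where
  map_injective {M N f g} e := by
    apply RightModule.hom_ext
    apply DayFunctor.hom_ext
    ext n
    exact congrArg (fun t : (modulesToSigma C).obj M ⟶ (modulesToSigma C).obj N =>
      t.hom.natTrans.app (op ⟨n.unop.n⟩)) e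

/-- A map between the restrictions to `Σ` of two modules commutes with the action maps over `Λ`. -/
lemma modulesToSigma_hom_actι {M N : RightModule C}
    (g : (modulesToSigma C).obj M ⟶ (modulesToSigma C).obj N) (k n : ℕ) :
    C.actι M.act k n ≫ g.hom.natTrans.app (op ⟨n⟩) =
      g.hom.natTrans.app (op ⟨k⟩) ▷ _ ≫ C.actι N.act k n :=
  action_hom_of_iso (inv_app_comp_app (resPow Idx.sigmaToLambda C.X k) (op ⟨n⟩))
    (C.restrict_actι Idx.sigmaToLambda M k n) (C.restrict_actι Idx.sigmaToLambda N k n)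
    (RightModule.actι_hom g k n)

instance : (modulesToSigma C).Full where
  map_surjective g := ⟨RightModule.homOfActι (fun n => g.hom.natTrans.app (op ⟨n⟩))
    (modulesToSigma_hom_actι C g), by
      apply RightModule.hom_ext
      apply DayFunctor.hom_ext
      ext n
      rfl⟩

lemma modulesToSigma_obj_injective : Function.Injective (modulesToSigma C).obj := by
  intro M N e
  refine RightModule.eq_of_hom ((modulesToSigma C).preimage (eqToHom e))
    (fun n => congrArg (fun X : RightModule C.toOperad => X.X.functor.obj (op ⟨n.unop.n⟩)) e)
    fun n => ?_
  have e1 := congrArg (fun t : (modulesToSigma C).obj M ⟶ (modulesToSigma C).obj N =>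
    t.hom.natTrans.app (op ⟨n.unop.n⟩)) ((modulesToSigma C).map_preimage (eqToHom e))
  exact e1.trans (RightModule.eqToHom_app e _)

lemma modulesToSigma_obj_surjective : Function.Surjective (modulesToSigma C).obj := by
  intro X
  -- The restriction of the extension has the objects and the action maps of `X`, so that the
  -- identities form a morphism of right modules.
  refine ⟨X.extend.toModule, RightModule.eq_of_hom
    (RightModule.homOfActι (fun n => 𝟙 (X.X.functor.obj (op ⟨n⟩))) fun k n => ?_)
    (fun _ => rfl) fun _ => rfl⟩
  have e := C.restrict_actι Idx.sigmaToLambda X.extend.toModule k n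
  have e1 : C.actι X.extend.toModule.act k n = X.extend.act k n := X.extend.actι_seqAct k n
  rw [e1] at e
  have e2 := e.trans (X.resPow_extend k n)
  refine ((Category.comp_id _).trans e2).trans ?_
  exact ((congrArg (· ≫ _) (id_whiskerRight _ _)).trans (Category.id_comp _)).symm

theorem isIsoOfCategories_modulesToSigma : IsIsoOfCategories (modulesToSigma C) :=
  .of_fullyFaithful _ ⟨modulesToSigma_obj_injective C, modulesToSigma_obj_surjective C⟩

end BasedOperad

end

/-! ### Tensor powers of `I_1` -/

section

open scoped DayFunctor

variable {V : Type u} [Category.{v} V] [MonoidalCategory V] [SymmetricCategory V]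
  [MonoidalClosed V] [HasColimits V] {s : SeqKind}

/-- The point of `I_1^{⊠ k} n` given by a morphism `f : n ⟶ k`. These points exhibit
`I_1^{⊠ k} n` as the coproduct of copies of `I` indexed by the morphisms `n ⟶ k`. -/
noncomputable def unitPt {n k : ℕ} (f : (⟨n⟩ : Idx s) ⟶ ⟨k⟩) :
    𝟙_ V ⟶ ((unitB s V).pow k).functor.obj (op ⟨n⟩) :=
  powPt (unitB s V) (unitSeqι (𝟙 (⟨1⟩ : Idx s))) k ≫ ((unitB s V).pow k).functor.map f.op

lemma unitMonoid_ptMap {n k : ℕ} (f : (⟨n⟩ : Idx s) ⟶ ⟨k⟩) :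
    (unitMonoid s V).ptMap f = unitPt f := by
  have e : (unitMonoid s V).onePt = unitSeqι (𝟙 (⟨1⟩ : Idx s)) := Category.comp_id _
  unfold KellyMonoid.ptMap KellyMonoid.pt
  rw [e]
  rfl

lemma unitPt_map {n m k : ℕ} (f : (⟨n⟩ : Idx s) ⟶ ⟨k⟩) (g : (⟨m⟩ : Idx s) ⟶ ⟨n⟩) :
    unitPt (V := V) f ≫ ((unitB s V).pow k).functor.map g.op = unitPt (g ≫ f) := by
  unfold unitPt
  rw [op_comp, Functor.map_comp, Category.assoc]

lemma tensorPt_unitPt {k : ℕ} {x y : Idx s} (f : x ⟶ ⟨k⟩) (a : y ⟶ ⟨1⟩) :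
    tensorPt (unitPt (V := V) f) (unitSeqι a) =
      unitPt (n := x.n + y.n) (k := k + 1) (f ⊗ₘ a : x ⊗ y ⟶ ⟨k⟩ ⊗ ⟨1⟩) := by
  have e1 := tensorPt_map (powPt (unitB s V) (unitSeqι (𝟙 (⟨1⟩ : Idx s))) k)
    (unitSeqι (V := V) (𝟙 (⟨1⟩ : Idx s))) f.op a.op
  rw [unitSeqι_map, Category.comp_id] at e1
  exact e1.symm

/-- The points `unitPt a` generate `I_1^{⊠ k} n`. -/
lemma unitPow_ext (k : ℕ) {n : ℕ} {X : V} {f g : ((unitB s V).pow k).functor.obj (op ⟨n⟩) ⟶ X}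
    (h : ∀ a : (⟨n⟩ : Idx s) ⟶ ⟨k⟩, unitPt a ≫ f = unitPt a ≫ g) : f = g := by
  induction k generalizing n X with
  | zero =>
    apply incUnit_ext_at
    intro w
    exact (Category.assoc _ _ _).symm.trans ((h w.unop).trans (Category.assoc _ _ _))
  | succ k ih =>
    refine inc_hom_ext_at (F := (unitB s V).pow k) (G := unitSeq s V) fun x y u => ?_
    apply MonoidalClosed.curry_injective
    apply unitSeq_ext
    intro a
    rw [← MonoidalClosed.curry_natural_left, ← MonoidalClosed.curry_natural_left]
    congr 1
    rw [← cancel_epi (ρ_ _).inv]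
    apply ih (n := x.unop.n)
    intro b
    have e := h (u.unop ≫ (b ⊗ₘ a : (x.unop ⊗ y.unop : Idx s) ⟶ ⟨k⟩ ⊗ ⟨1⟩))
    rw [← unitPt_map] at e
    have e2 := tensorPt_unitPt (V := V) b a
    have key (f : ((unitB s V).pow (k + 1)).functor.obj (op ⟨n⟩) ⟶ X) :
        unitPt b ≫ (ρ_ _).inv ≫ ((unitB s V).pow k).functor.obj x ◁ unitSeqι a ≫
        inc ((unitB s V).pow k) (unitSeq s V) x y ≫
          ((unitB s V).pow k ⊗ unitSeq s V).functor.map u ≫ f =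
      tensorPt (unitPt (V := V) b) (unitSeqι a) ≫ ((unitB s V).pow (k + 1)).functor.map u ≫ f := by
      rw [rightUnitor_inv_naturality_assoc, ← unitors_inv_equal]
      unfold tensorPt
      rw [MonoidalCategory.tensorHom_def]
      simp only [Category.assoc]
    rw [e2] at key
    exact (key f).trans (((Category.assoc _ _ _).symm.trans (e.trans (Category.assoc _ _ _))).trans
      (key g).symm)

lemma unitPow_whiskerLeft_ext (k : ℕ) {n : ℕ} {X Z : V}
    {f g : Z ⊗ ((unitB s V).pow k).functor.obj (op ⟨n⟩) ⟶ X}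
    (h : ∀ a : (⟨n⟩ : Idx s) ⟶ ⟨k⟩, Z ◁ unitPt a ≫ f = Z ◁ unitPt a ≫ g) :
    f = g := by
  apply MonoidalClosed.curry_injective
  apply unitPow_ext
  intro a
  rw [← MonoidalClosed.curry_natural_left, ← MonoidalClosed.curry_natural_left, h]

/-- The shift `n ↦ D (n + 1)` of a sequence. -/
@[reducible]
def shift (D : Seq s V) : Seq s V where
  functor :=
    { obj n := D.functor.obj (n ⊗ op ⟨1⟩)
      map u := D.functor.map (u ▷ op ⟨1⟩)
      map_id n := by simp
      map_comp u w := by simp }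

/-- The map `D (x + 1) ⊗ I_1 y ⟶ D (x + y)`, given by the functoriality of `D` in the last variable
on the summand of `I_1 y` of a morphism `y ⟶ 1`. -/
noncomputable def unitEval (D : Seq s V) (x y : (Idx s)ᵒᵖ) :
    D.functor.obj (x ⊗ op ⟨1⟩) ⊗ (unitSeq s V).functor.obj y ⟶ D.functor.obj (x ⊗ y) :=
  MonoidalClosed.uncurry (unitSeqDesc fun a =>
    MonoidalClosed.curry ((ρ_ _).hom ≫ D.functor.map (x ◁ a.op)))

lemma unitSeqι_unitEval (D : Seq s V) (x y : (Idx s)ᵒᵖ) (a : y.unop ⟶ ⟨1⟩) :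
    D.functor.obj (x ⊗ op ⟨1⟩) ◁ unitSeqι a ≫ unitEval D x y =
      (ρ_ _).hom ≫ D.functor.map (x ◁ a.op) := by
  unfold unitEval
  rw [← MonoidalClosed.uncurry_natural_left]
  have e := unitSeqι_desc (fun a : y.unop ⟶ (⟨1⟩ : Idx s) =>
    MonoidalClosed.curry ((ρ_ _).hom ≫ D.functor.map (x ◁ a.op))) a
  exact (congrArg _ e).trans (MonoidalClosed.uncurry_curry _)

lemma unitEval_natural (D : Seq s V) {x x' y y' : (Idx s)ᵒᵖ} (u : x ⟶ x') (w : y ⟶ y') :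
    (D.functor.map (u ▷ op ⟨1⟩) ⊗ₘ (unitSeq s V).functor.map w) ≫ unitEval D x' y' =
      unitEval D x y ≫ D.functor.map (u ⊗ₘ w) := by
  apply MonoidalClosed.curry_injective
  apply unitSeq_ext
  intro a
  rw [← MonoidalClosed.curry_natural_left, ← MonoidalClosed.curry_natural_left]
  congr 1
  have e := unitSeqι_unitEval D x y a
  have e2 := unitSeqι_unitEval D x' y' (w.unop ≫ a)
  have e3 := unitSeqι_map' (V := V) w a
  rw [reassoc_of% e, MonoidalCategory.tensorHom_def', Category.assoc,
    ← MonoidalCategory.whiskerLeft_comp_assoc, e3, whisker_exchange_assoc, e2,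
    rightUnitor_naturality_assoc, ← Functor.map_comp, ← Functor.map_comp]
  congr 2
  rw [MonoidalCategory.tensorHom_def', op_comp, Quiver.Hom.op_unop,
    MonoidalCategory.whiskerLeft_comp, ← whisker_exchange_assoc, ← whisker_exchange]

lemma curry_uncurry_natural {Z A A' B B' P P' Q Q' : V} {F : A ⟶ (ihom Z).obj P}
    {F' : A' ⟶ (ihom Z).obj P'} {p : A ⟶ A'} {q : P ⟶ P'} {r : B ⟶ B'} {t : Q ⟶ Q'}
    {e : P ⊗ B ⟶ Q} {e' : P' ⊗ B' ⟶ Q'} (hF : p ≫ F' = F ≫ (ihom Z).map q)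
    (he : (q ⊗ₘ r) ≫ e' = e ≫ t) :
    (p ⊗ₘ r) ≫ MonoidalClosed.curry ((α_ _ _ _).inv ≫ MonoidalClosed.uncurry F' ▷ B' ≫ e') =
      MonoidalClosed.curry ((α_ _ _ _).inv ≫ MonoidalClosed.uncurry F ▷ B ≫ e) ≫
        (ihom Z).map t := by
  have hF' : Z ◁ p ≫ MonoidalClosed.uncurry F' = MonoidalClosed.uncurry F ≫ q := by
    rw [← MonoidalClosed.uncurry_natural_left, hF, MonoidalClosed.uncurry_natural_right]
  rw [← MonoidalClosed.curry_natural_left, ← MonoidalClosed.curry_natural_right]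
  congr 1
  rw [Category.assoc, Category.assoc, ← he, whiskerRight_comp_tensorHom_assoc, ← hF',
    ← id_tensorHom, associator_inv_naturality_assoc, tensorHom_comp_whiskerRight_assoc,
    id_tensorHom]

lemma curry_uncurry_unit {Z A B : V} {F : A ⟶ (ihom Z).obj Z} {p : 𝟙_ V ⟶ A} {x : 𝟙_ V ⟶ B}
    {e : Z ⊗ B ⟶ Z} (hF : p ≫ F = MonoidalClosed.curry (ρ_ Z).hom) (he : Z ◁ x ≫ e = (ρ_ Z).hom) :
    (λ_ _).inv ≫ (p ⊗ₘ x) ≫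
      MonoidalClosed.curry ((α_ _ _ _).inv ≫ MonoidalClosed.uncurry F ▷ B ≫ e) =
        MonoidalClosed.curry (ρ_ Z).hom := by
  have hF' : Z ◁ p ≫ MonoidalClosed.uncurry F = (ρ_ Z).hom := by
    rw [← MonoidalClosed.uncurry_natural_left, hF, MonoidalClosed.uncurry_curry]
  rw [← MonoidalClosed.curry_natural_left, ← MonoidalClosed.curry_natural_left]
  congr 1
  rw [← id_tensorHom Z (p ⊗ₘ x), associator_inv_naturality_assoc,
    tensorHom_comp_whiskerRight_assoc, id_tensorHom, hF', MonoidalCategory.tensorHom_def,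
    Category.assoc, he]
  simp

/-- The maps `I_1^{⊠ k} n ⟶ [D k, D n]` that send the point of `f : n ⟶ k` to `D f`, defined
recursively: the first `k` of `k + 1` factors act on the shift of `D`, the last one by
`unitEval`. -/
noncomputable def unitAct : ∀ (k : ℕ) (D : Seq s V),
    (unitB s V).pow k ⟶ ihomDay (D.functor.obj (op ⟨k⟩)) D
  | 0, D => unitDesc (MonoidalClosed.curry (ρ_ _).hom)
  | k + 1, D => dayDesc (F := (unitB s V).pow k) (G := unitSeq s V)
      (fun x y => MonoidalClosed.curry ((α_ _ _ _).inv ≫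
        MonoidalClosed.uncurry ((unitAct k (shift D)).natTrans.app x) ▷ _ ≫ unitEval D x y))
      (fun x x' y y' a b => curry_uncurry_natural ((unitAct k (shift D)).natTrans.naturality a)
        (unitEval_natural D a b))

lemma powPt_unitAct (k : ℕ) (D : Seq s V) :
    powPt (unitB s V) (unitSeqι (𝟙 (⟨1⟩ : Idx s))) k ≫ (unitAct k D).natTrans.app (op ⟨k⟩) =
      MonoidalClosed.curry (ρ_ _).hom := by
  induction k generalizing D with
  | zero => exact incUnit_unitDesc (F := ihomDay (D.functor.obj (op ⟨0⟩)) D) _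
  | succ k ih =>
    rw [powPt_succ]
    have e := inc_dayDesc (F := (unitB s V).pow k) (G := unitSeq s V)
      (H := ihomDay (D.functor.obj (op ⟨k + 1⟩)) D)
      (fun x y => MonoidalClosed.curry ((α_ _ _ _).inv ≫
        MonoidalClosed.uncurry ((unitAct k (shift D)).natTrans.app x) ▷ _ ≫ unitEval D x y))
      (fun x x' y y' a b => curry_uncurry_natural ((unitAct k (shift D)).natTrans.naturality a)
        (unitEval_natural D a b)) (op ⟨k⟩) (op ⟨1⟩)
    refine (Category.assoc _ _ _).trans ((congrArg (_ ≫ ·) ((Category.assoc _ _ _).trans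
      (congrArg (_ ≫ ·) e))).trans (curry_uncurry_unit (ih (shift D)) ?_))
    have e2 := unitSeqι_unitEval D (op ⟨k⟩) (op ⟨1⟩) (𝟙 _)
    rw [op_id, MonoidalCategory.whiskerLeft_id, CategoryTheory.Functor.map_id,
      Category.comp_id] at e2
    exact e2

end

/-! ### Right modules over `I_1` -/

section

open scoped DayFunctor

variable {V : Type u} [Category.{v} V] [MonoidalCategory V] [SymmetricCategory V]
  [MonoidalClosed V] [HasColimits V] {s : SeqKind}

/-- The action maps `D k ⊗ I_1^{⊠ k} n ⟶ D n`. -/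
noncomputable def unitActι (D : Seq s V) (k n : ℕ) :
    D.functor.obj (op ⟨k⟩) ⊗ ((unitB s V).pow k).functor.obj (op ⟨n⟩) ⟶ D.functor.obj (op ⟨n⟩) :=
  MonoidalClosed.uncurry ((unitAct k D).natTrans.app (op ⟨n⟩))

lemma unitActι_map (D : Seq s V) (k : ℕ) {n m : ℕ} (g : (⟨m⟩ : Idx s) ⟶ ⟨n⟩) :
    D.functor.obj (op ⟨k⟩) ◁ ((unitB s V).pow k).functor.map g.op ≫ unitActι D k m =
      unitActι D k n ≫ D.functor.map g.op := by
  refine (MonoidalClosed.uncurry_natural_left _ _).symm.trans (Eq.trans ?_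
    (MonoidalClosed.uncurry_natural_right _ _))
  exact congrArg MonoidalClosed.uncurry ((unitAct k D).natTrans.naturality g.op)

/-- The point of `f` acts on `D` as `D f`. -/
lemma unitPt_unitActι (D : Seq s V) {n k : ℕ} (f : (⟨n⟩ : Idx s) ⟶ ⟨k⟩) :
    D.functor.obj (op ⟨k⟩) ◁ unitPt f ≫ unitActι D k n = (ρ_ _).hom ≫ D.functor.map f.op := by
  have e : D.functor.obj (op ⟨k⟩) ◁ powPt (unitB s V) (unitSeqι (𝟙 (⟨1⟩ : Idx s))) k ≫
      unitActι D k k = (ρ_ _).hom :=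
    (MonoidalClosed.uncurry_natural_left _ _).symm.trans
      ((congrArg MonoidalClosed.uncurry (powPt_unitAct k D)).trans (MonoidalClosed.uncurry_curry _))
  unfold unitPt
  rw [MonoidalCategory.whiskerLeft_comp_assoc, unitActι_map, reassoc_of% e]

lemma unitPt_unitMonoid_comp {k l n : ℕ} (g : (⟨n⟩ : Idx s) ⟶ ⟨l⟩) :
    ((unitB s V).pow k).functor.obj (op ⟨l⟩) ◁ unitPt g ≫ (unitMonoid s V).comp k l n =
      (ρ_ _).hom ≫ ((unitB s V).pow k).functor.map g.op := by
  rw [← unitMonoid_ptMap]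
  exact (unitMonoid s V).comp_ptMap k g

/-- If `p` acts on `B` as `d` and on `A` as `m`, and these are compatible, then the associativity of
the action holds on the point `p`. -/
lemma action_assoc_of_pt {X A B Y Z D : V} {p : 𝟙_ V ⟶ Y} {a₁ : X ⊗ A ⟶ B} {a₂ : B ⊗ Y ⟶ Z}
    {a₃ : X ⊗ D ⟶ Z} {c : A ⊗ Y ⟶ D} {d : B ⟶ Z} {m : A ⟶ D} (h : B ◁ p ≫ a₂ = (ρ_ _).hom ≫ d)
    (hc : A ◁ p ≫ c = (ρ_ _).hom ≫ m) (hm : X ◁ m ≫ a₃ = a₁ ≫ d) :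
    (X ⊗ A) ◁ p ≫ a₁ ▷ Y ≫ a₂ = (X ⊗ A) ◁ p ≫ (α_ _ _ _).hom ≫ X ◁ c ≫ a₃ := by
  rw [whisker_exchange_assoc, h, rightUnitor_naturality_assoc, associator_naturality_right_assoc,
    ← MonoidalCategory.whiskerLeft_comp_assoc, hc, MonoidalCategory.whiskerLeft_comp_assoc, hm]
  simp

/-- The action maps `unitActι` are associative and unital. -/
noncomputable def unitActionMaps (D : Seq s V) : ActionMaps (unitMonoid s V) where
  obj n := D.functor.obj (op ⟨n⟩)
  act := unitActι D
  assoc k l n := unitPow_whiskerLeft_ext (s := s) l fun g => action_assoc_of_pt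
    (unitPt_unitActι D g) (unitPt_unitMonoid_comp g) (unitActι_map D k g)
  unit n := by
    have e := unitPt_unitActι D (𝟙 (⟨n⟩ : Idx s))
    rw [← unitMonoid_ptMap, KellyMonoid.ptMap_id, op_id, CategoryTheory.Functor.map_id,
      Category.comp_id] at e
    exact e

lemma unitActionMaps_map (D : Seq s V) {m n : ℕ} (f : (⟨m⟩ : Idx s) ⟶ ⟨n⟩) :
    (unitActionMaps D).map f = D.functor.map f.op := by
  have e := unitPt_unitActι D f
  rw [← unitMonoid_ptMap] at e
  exact (Iso.inv_comp_eq _).2 e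

lemma unitActionMaps_seq (D : Seq s V) : (unitActionMaps D).seq = D := by
  have e : (unitActionMaps D).seq.functor = D.functor :=
    CategoryTheory.Functor.ext (fun _ => rfl) fun n m f =>
      (unitActionMaps_map D f.unop).trans
        ((Category.id_comp _).trans (Category.comp_id _)).symm
  cases D
  exact congrArg DayFunctor.mk e

namespace RightModule

/-- Every map of sequences commutes with actions of `I_1`. -/
lemma hom_actι_of_unitMonoid {M N : RightModule (unitMonoid s V)} (f : M.X ⟶ N.X) (k n : ℕ) :
    (unitMonoid s V).actι M.act k n ≫ f.natTrans.app (op ⟨n⟩) =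
      f.natTrans.app (op ⟨k⟩) ▷ _ ≫ (unitMonoid s V).actι N.act k n := by
  refine unitPow_whiskerLeft_ext (s := s) k fun a => ?_
  have e1 := M.actι_ptMap a
  have e2 := N.actι_ptMap a
  rw [unitMonoid_ptMap] at e1 e2
  refine ((reassoc_of% e1) _).trans ?_
  refine Eq.trans ?_ ((whisker_exchange_assoc _ _ _).symm)
  refine Eq.trans ?_ (congrArg (_ ≫ ·) e2.symm)
  rw [rightUnitor_naturality_assoc, f.natTrans.naturality]

instance : (forget (unitMonoid s V)).Faithful where
  map_injective e := hom_ext e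

instance : (forget (unitMonoid s V)).Full where
  map_surjective f :=
    ⟨homOfActι (fun n => f.natTrans.app (op ⟨n⟩)) (hom_actι_of_unitMonoid f), rfl⟩

lemma forget_unitMonoid_injective : Function.Injective (forget (unitMonoid s V)).obj := by
  intro M N e
  have key : ∀ {D D' : Seq s V} (e : D = D') (n : (Idx s)ᵒᵖ), (eqToHom e).natTrans.app n =
      eqToHom (congrArg (fun D : Seq s V => D.functor.obj n) e) := by
    rintro D _ rfl n
    rfl
  refine eq_of_hom ((forget _).preimage (eqToHom e))
    (fun n => congrArg (fun D : Seq s V => D.functor.obj n) e) fun n => ?_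
  exact (congrArg (fun t : M.X ⟶ N.X => t.natTrans.app n)
    ((forget (unitMonoid s V)).map_preimage (eqToHom e))).trans (key e n)

theorem isIsoOfCategories_forget_unitMonoid : IsIsoOfCategories (forget (unitMonoid s V)) :=
  .of_fullyFaithful _ ⟨forget_unitMonoid_injective, fun D =>
    ⟨(unitActionMaps D).toModule, unitActionMaps_seq D⟩⟩

end RightModule

end

end Kelly

/-- Right modules over a based operad in `Λ`-objects and in `Σ`-objects agree. -/
theorem mainTheorem5 {V : Type u} [Category.{v} V] [MonoidalCategory V] [SymmetricCategory V]
    [MonoidalClosed V] [HasColimits V] :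
    (∀ C : Kelly.BasedOperad V, Kelly.IsIsoOfCategories (Kelly.BasedOperad.modulesToSigma C)) ∧
    Kelly.IsIsoOfCategories (Kelly.RightModule.forget (Kelly.unitOperad V)) ∧
    (∃ F : Kelly.LambdaObj V ⥤ Kelly.RightModule (Kelly.BasedOperad.toOperad (Kelly.unitOperad V)),
      Kelly.IsIsoOfCategories F ∧
        Kelly.RightModule.forget (Kelly.unitOperad V) ⋙ F =
          Kelly.BasedOperad.modulesToSigma (Kelly.unitOperad V) ∧
        F ⋙ Kelly.RightModule.forget _ = Kelly.LambdaObj.toSigma V) := by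
  refine ⟨Kelly.BasedOperad.isIsoOfCategories_modulesToSigma,
    Kelly.RightModule.isIsoOfCategories_forget_unitMonoid, ?_⟩
  obtain ⟨G, hG, hG'⟩ :=
    Kelly.RightModule.isIsoOfCategories_forget_unitMonoid (V := V) (s := .lambda)
  refine ⟨G ⋙ Kelly.BasedOperad.modulesToSigma (Kelly.unitOperad V),
    Kelly.IsIsoOfCategories.comp ⟨_, hG', hG⟩
      (Kelly.BasedOperad.isIsoOfCategories_modulesToSigma _), ?_, ?_⟩
  · exact (congrArg (· ⋙ Kelly.BasedOperad.modulesToSigma (Kelly.unitOperad V)) hG).trans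
      (CategoryTheory.Functor.id_comp _)
  · exact (congrArg (· ⋙ Kelly.LambdaObj.toSigma V) hG').trans
      (CategoryTheory.Functor.id_comp _)
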